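/- **Theorem (asymptotic normality of the local linear estimator under cluster sampling).** *Sampling.* Let $d_{\rm ind}\ge 1$, $d_{\rm cls}\ge 0$, $d=d_{\rm ind}+d_{\rm cls}$. Consider a sequence of samples, indexed by $t\to\infty$ (the index is suppressed). Each sample consists of $G$ clusters of nonrandom sizes $n_g\ge 1$, with $n=\sum_{g=1}^G n_g$ observations $(Y_{gj},X_{gj})\in\mathbb R\times\mathbb R^d$, $1\le j\le n_g$, where $X_{gj}=(X^{(\rm ind)}_{gj},X^{(\rm cls)}_g)$ with $X^{(\rm ind)}_{gj}\in\mathbb R^{d_{\rm ind}}$ and $X^{(\rm cls)}_g\in\mathbb R^{d_{\rm cls}}$. Write $\mathbf X_g=(X_{g1},\dots,X_{gn_g})$. The functions $m,f,f_2,f_3,f_4,\sigma^2(\cdot),\sigma(\cdot,\cdot;\cdot)$ below do not depend on the sample. Fix $x=(x^{(\rm ind)},x^{(\rm cls)})\in\mathbb R^d$, bandwidths $h>0$, and an open neighborhood $\mathcal N$ of $x$. Suppose: 1. (Data) The clusters are mutually independent. $Y_{gj}=m(X_{gj})+e_{gj}$ with $m$ Borel measurable, $\mathbb E[e_{gj}\mid\mathbf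 X_g]=0$, $\mathbb E[e_{gj}^2\mid\mathbf X_g]=\sigma^2(X_{gj})$, and $\mathbb E[e_{gj}e_{g\ell}\mid\mathbf X_g]=\sigma(X^{(\rm ind)}_{gj},X^{(\rm ind)}_{g\ell};X^{(\rm cls)}_g)$ for $j\ne\ell$. Every $X_{gj}$ has Lebesgue density $f$; for $\underline n\in\{2,3,4\}$, every cluster with $n_g\ge\underline n$ and all distinct $j_1,\dots,j_{\underline n}$, the vector $(X^{(\rm ind)}_{gj_1},\dots,X^{(\rm ind)}_{gj_{\underline n}};X^{(\rm cls)}_g)$ has Lebesgue density $f_{\underline n}$. 2. (Bandwidth) $nh^d\to\infty$, $h\to0$ and $(\max_{g}n_g)h^{d_{\rm ind}}=O(1)$. 3. (Smoothness) $f(x)>0$; $m$ and $f$ are twice continuously differentiable on $\mathcal N$, and $\sigma^2(\cdot)$ is continuous on $\mathcal N$; on the set of tuples $(x_1,\dots,x_{\underline n};c)$ with $(x_i,c)\in\mathcal N$ for all $i$, $f_2$ is continuously differentiable and $f_3$, $f_4$, $\sigma(\cdot,\cdot;\cdot)$ are continuous (with $\underline n=2,3,4,2$ respectively). 4. (Cluster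 sizes) $\bigl(\frac1n\sum_{g}n_g^2\bigr)h^{d_{\rm ind}}\to\lambda\in[0,\infty)$. 5. (Moments and rates) There is $r\ge2$ such that, for a finite constant $\overline v$, $\mathbb E[|e_{gj}|^{2r}\mid X_{gj}=\tilde x]\le\overline v^2$ for almost all $\tilde x\in\mathcal N$ and for all observations of all samples; $(\sum_{g}n_g^r)^{1/r}/n^{1/4}\le C$ for a constant $C>0$; and $1/(n^{r/2}h^{dr-d})=O(1)$. Moreover $nh^{d+4}=O(1)$, $\max_{g}n_g^4/n\to0$, and $$R_k^d f(x)\sigma^2(x)+\lambda R_k^{d_{\rm cls}}f_2(x^{(\rm ind)},x^{(\rm ind)};x^{(\rm cls)})\,\sigma(x^{(\rm ind)},x^{(\rm ind)};x^{(\rm cls)})>0 .$$ 6. (Kernel) $K(u)=\prod_{q=1}^d k(u^{(q)})$ has compact support, where $k:\mathbb R\to\mathbb R$ is a Borel function that is bounded, nonnegative and even, with $\int k=1$, $\kappa_2=\int u^2k(u)\,du<\infty$ and $\int u^4k(u)\,du<\infty$. Here $R_k=\int k(u)^2\,du$. *Estimator.* With $K_h(u)=h^{-d}K(u/h)$, let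 $\mathbf X_x$ be the $n\times(d+1)$ matrix with rows $(1,(X_{gj}-x)^\top)$, $\mathbf W_x$ the diagonal $n\times n$ matrix with entries $K_h(X_{gj}-x)$, and $\mathbf e_1=(1,0,\dots,0)^\top\in\mathbb R^{d+1}$. Put $$\widehat m_{\rm LL}(x)=\sum_{g=1}^G\sum_{j=1}^{n_g}\mathbf e_1^\top(\mathbf X_x^\top\mathbf W_x\mathbf X_x)^{-1}\begin{bmatrix}1\\X_{gj}-x\end{bmatrix}K_h(X_{gj}-x)\,Y_{gj}$$ (with the inverse read as $0$ when the matrix is singular). *Conclusion.* With $B_{\rm LL}(x)=\frac{\kappa_2}{2}\sum_{q=1}^d\partial_{qq}m(x)$, $$\sqrt{nh^d}\,\bigl(\widehat m_{\rm LL}(x)-m(x)-h^2B_{\rm LL}(x)\bigr)\ \overset{d}{\longrightarrow}\ \mathrm N\!\left(0,\ \frac{R_k^d\sigma^2(x)}{f(x)}+\frac{\lambda R_k^{d_{\rm cls}}f_2(x^{(\rm ind)},x^{(\rm ind)};x^{(\rm cls)})\,\sigma(x^{(\rm ind)},x^{(\rm ind)};x^{(\rm cls)})}{f(x)^2}\right).$$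 -/

import Mathlib

open MeasureTheory ProbabilityTheory Filter Topology Asymptotics

noncomputable section

/-- The space of regressors `(x_ind, x_cls)`, i.e. `ℝ^d` with `d = dI + dC`. -/
abbrev Regressor (dI dC : ℕ) : Type := Fin dI ⊕ Fin dC → ℝ

/-- The space of tuples `(x_1_ind, …, x_k_ind; x_cls)`: `k` individual-level regressor vectors and
one common cluster-level regressor vector. -/
abbrev JointRegressor (dI dC k : ℕ) : Type := (Fin k → Fin dI → ℝ) × (Fin dC → ℝ)

/-- One clustered sample: `G` clusters of nonrandom sizes, individual-level regressors `Xind g j`,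
cluster-level regressors `Xcls g` and outcomes `Y g j`. -/
structure ClusterSample (dI dC : ℕ) (Ω : Type*) where
  G : ℕ
  size : Fin G → ℕ
  size_pos : ∀ g, 0 < size g
  Xind : (g : Fin G) → Fin (size g) → Ω → Fin dI → ℝ
  Xcls : Fin G → Ω → Fin dC → ℝ
  Y : (g : Fin G) → Fin (size g) → Ω → ℝ

/-- The population functions: the regression function `m`, the marginal density `f` of a regressor,
the joint densities `fJoint k` of `(X_1_ind, …, X_k_ind; X_cls)` within a cluster (used for
`k = 2, 3, 4`), the conditional variance function `condVar` and the within-cluster conditional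
covariance function `condCov`. -/
structure RegressionModel (dI dC : ℕ) where
  m : Regressor dI dC → ℝ
  measurable_m : Measurable m
  f : Regressor dI dC → ℝ
  fJoint : (k : ℕ) → JointRegressor dI dC k → ℝ
  condVar : Regressor dI dC → ℝ
  condCov : JointRegressor dI dC 2 → ℝ

namespace ClusterSample

variable {dI dC : ℕ} {Ω : Type*}

/-- The total number of observations `n = ∑_g n_g`. -/
def n (S : ClusterSample dI dC Ω) : ℕ := ∑ g, S.size g

/-- The largest cluster size `max_g n_g`. -/
def maxSize (S : ClusterSample dI dC Ω) : ℕ := Finset.univ.sup S.size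

/-- The regressor `X_{gj} = (X_{gj}_ind, X_g_cls)`. -/
def X (S : ClusterSample dI dC Ω) (g : Fin S.G) (j : Fin (S.size g)) (ω : Ω) : Regressor dI dC :=
  Sum.elim (S.Xind g j ω) (S.Xcls g ω)

/-- All regressors `(X_{g1}, …, X_{g n_g})` of the cluster `g`. -/
def clusterX (S : ClusterSample dI dC Ω) (g : Fin S.G) (ω : Ω) :
    Fin (S.size g) → Regressor dI dC :=
  fun j => S.X g j ω

/-- The vector `(X_{g j_1}_ind, …, X_{g j_k}_ind; X_g_cls)`. -/
def jointX (S : ClusterSample dI dC Ω) (g : Fin S.G) {k : ℕ} (j : Fin k → Fin (S.size g)) (ω : Ω) :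
    JointRegressor dI dC k :=
  (fun i => S.Xind g (j i) ω, S.Xcls g ω)

/-- The error term `e_{gj} = Y_{gj} - m(X_{gj})`. -/
def err (S : ClusterSample dI dC Ω) (M : RegressionModel dI dC) (g : Fin S.G)
    (j : Fin (S.size g)) (ω : Ω) : ℝ :=
  S.Y g j ω - M.m (S.X g j ω)

/-- The index set of all `n` observations. -/
abbrev Obs (S : ClusterSample dI dC Ω) : Type := Σ g : Fin S.G, Fin (S.size g)

end ClusterSample

/-- `E[Z | X = z] = φ z` for almost every value `z` of `X`: the regular conditional distribution of
`Z` given `X = z` has a finite mean, equal to `φ z`. -/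
def HasCondMean {Ω E : Type*} [MeasurableSpace Ω] [MeasurableSpace E] (P : Measure Ω)
    [IsProbabilityMeasure P] (Z : Ω → ℝ) (X : Ω → E) (φ : E → ℝ) : Prop :=
  ∀ᵐ z ∂(P.map X), Integrable (fun y : ℝ => y) (condDistrib Z X P z) ∧
    ∫ y, y ∂(condDistrib Z X P z) = φ z

/-- The measure `ν` has the (Borel, nonnegative) Lebesgue density `f`. -/
def IsDensity {E : Type*} [MeasureSpace E] (ν : Measure E) (f : E → ℝ) : Prop :=
  Measurable f ∧ (∀ z, 0 ≤ f z) ∧ ν = volume.withDensity (fun z => ENNReal.ofReal (f z))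

/-- The tuples `(x_1_ind, …, x_k_ind; x_cls)` such that `(x_i_ind, x_cls) ∈ N` for every `i`. -/
def jointNhd {dI dC : ℕ} (N : Set (Regressor dI dC)) (k : ℕ) : Set (JointRegressor dI dC k) :=
  {z | ∀ i, (Sum.elim (z.1 i) z.2 : Regressor dI dC) ∈ N}

/-- The point `(x_ind, x_ind; x_cls)`. -/
def diagPoint {dI dC : ℕ} (x : Regressor dI dC) : JointRegressor dI dC 2 :=
  (fun _ => x ∘ Sum.inl, x ∘ Sum.inr)

/-- The sampling assumptions on one clustered sample: independent clusters; the regression model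
with conditional moments given all regressors of the cluster (the same identities given only the
regressors that occur on the right-hand side follow from the tower property); common marginal and
joint densities of the regressors. -/
structure ClusterDGP {dI dC : ℕ} {Ω : Type*} [MeasurableSpace Ω] (P : Measure Ω)
    [IsProbabilityMeasure P] (S : ClusterSample dI dC Ω) (M : RegressionModel dI dC) : Prop where
  measurable_Xind : ∀ g j, Measurable (S.Xind g j)
  measurable_Xcls : ∀ g, Measurable (S.Xcls g)
  measurable_Y : ∀ g j, Measurable (S.Y g j)
  indep : iIndepFun (fun (g : Fin S.G) (ω : Ω) =>
    (fun j => (S.Y g j ω, S.X g j ω) : Fin (S.size g) → ℝ × Regressor dI dC)) P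
  cond_mean : ∀ g j, HasCondMean P (S.err M g j) (S.clusterX g) (fun _ => 0)
  cond_var : ∀ g j, HasCondMean P (fun ω => S.err M g j ω ^ 2) (S.clusterX g)
    (fun z => M.condVar (z j))
  cond_cov : ∀ g j l, j ≠ l →
    HasCondMean P (fun ω => S.err M g j ω * S.err M g l ω) (S.clusterX g)
      (fun z => M.condCov (![z j ∘ Sum.inl, z l ∘ Sum.inl], z j ∘ Sum.inr))
  marginal_density : ∀ g j, IsDensity (P.map (S.X g j)) M.f
  joint_density : ∀ k ∈ ({2, 3, 4} : Set ℕ), ∀ g, ∀ j : Fin k → Fin (S.size g),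
    Function.Injective j → IsDensity (P.map (S.jointX g j)) (M.fJoint k)

/-- Univariate kernel functions. -/
structure IsUnivariateKernel (k : ℝ → ℝ) : Prop where
  measurable : Measurable k
  nonneg : ∀ u, 0 ≤ k u
  bounded : ∃ kbar : ℝ, ∀ u, k u ≤ kbar
  even : ∀ u, k (-u) = k u
  integral_eq_one : ∫ u, k u = 1
  integrable_sq : Integrable (fun u => u ^ 2 * k u)
  integrable_four : Integrable (fun u => u ^ 4 * k u)

/-- `κ₂ = ∫ u² k(u) du`. -/
def kernelSecondMoment (k : ℝ → ℝ) : ℝ := ∫ u, u ^ 2 * k u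

/-- `R_k = ∫ k(u)² du`. -/
def kernelRoughness (k : ℝ → ℝ) : ℝ := ∫ u, k u ^ 2

/-- The multivariate product kernel `K(u) = ∏_q k(u_q)`. -/
def productKernel {dI dC : ℕ} (k : ℝ → ℝ) (u : Regressor dI dC) : ℝ := ∏ q, k (u q)

/-- `K_h(u) = h^{-d} K(u / h)`. -/
def scaledKernel {dI dC : ℕ} (k : ℝ → ℝ) (h : ℝ) (u : Regressor dI dC) : ℝ :=
  (h ^ (dI + dC))⁻¹ * productKernel k (h⁻¹ • u)

section LocalLinear

variable {dI dC : ℕ} {Ω : Type*} (S : ClusterSample dI dC Ω) (k : ℝ → ℝ) (h : ℝ)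
  (x : Regressor dI dC) (ω : Ω)

/-- The vector `(1, u - x)` in `ℝ^{1+d}`. -/
def llVector {dI dC : ℕ} (x u : Regressor dI dC) : Unit ⊕ (Fin dI ⊕ Fin dC) → ℝ :=
  Sum.elim (fun _ => 1) (u - x)

/-- The `n × (1+d)` design matrix with rows `(1, (X_i - x)ᵀ)`. -/
def llDesign : Matrix S.Obs (Unit ⊕ (Fin dI ⊕ Fin dC)) ℝ :=
  Matrix.of fun i => llVector x (S.X i.1 i.2 ω)

/-- The `n × n` diagonal weight matrix with entries `K_h(X_i - x)`. -/
def llWeightMatrix : Matrix S.Obs S.Obs ℝ :=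
  Matrix.diagonal fun i => scaledKernel k h (S.X i.1 i.2 ω - x)

/-- The effective kernel
`K_LL(u, x) = e₁ᵀ (X_xᵀ W_x X_x)⁻¹ (1, u - x) K_h(u - x)` of the local linear estimator. -/
def llKernel (u : Regressor dI dC) : ℝ :=
  (((llDesign S x ω).transpose * llWeightMatrix S k h x ω * llDesign S x ω)⁻¹.mulVec
    (llVector x u)) (Sum.inl ()) * scaledKernel k h (u - x)

/-- The local linear estimator of `m(x)`. -/
def localLinear : ℝ :=
  ∑ g, ∑ j, llKernel S k h x ω (S.X g j ω) * S.Y g j ω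

end LocalLinear

/-- The partial derivative `∂_q m`. -/
def partialDeriv {dI dC : ℕ} (m : Regressor dI dC → ℝ) (q : Fin dI ⊕ Fin dC)
    (x : Regressor dI dC) : ℝ :=
  lineDeriv ℝ m x (Pi.single q 1)

/-- `B_LL(x) = (κ₂ / 2) ∑_q ∂_qq m(x)`. -/
def llBias {dI dC : ℕ} (k : ℝ → ℝ) (m : Regressor dI dC → ℝ) (x : Regressor dI dC) : ℝ :=
  kernelSecondMoment k / 2 * ∑ q, partialDeriv (partialDeriv m q) q x

/-- The asymptotic variance
`R_k^d σ²(x) / f(x) + λ R_k^{d_cls} f₂(x_ind, x_ind; x_cls) σ(x_ind, x_ind; x_cls) / f(x)²`. -/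
def asymptoticVariance {dI dC : ℕ} (k : ℝ → ℝ) (M : RegressionModel dI dC)
    (x : Regressor dI dC) (lam : ℝ) : ℝ :=
  kernelRoughness k ^ (dI + dC) * M.condVar x / M.f x +
    lam * kernelRoughness k ^ dC * M.fJoint 2 (diagPoint x) * M.condCov (diagPoint x) / M.f x ^ 2

/-- `n h^d → ∞`, `h → 0` and `(max_g n_g) h^{d_ind} = O(1)`. -/
structure BandwidthCondition {dI dC : ℕ} {Ω : ℕ → Type*} (S : ∀ t, ClusterSample dI dC (Ω t))
    (h : ℕ → ℝ) : Prop where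
  pos : ∀ t, 0 < h t
  tendsto_zero : Tendsto h atTop (𝓝 0)
  effective_size : Tendsto (fun t => ((S t).n : ℝ) * h t ^ (dI + dC)) atTop atTop
  max_size : (fun t => ((S t).maxSize : ℝ) * h t ^ dI) =O[atTop] (fun _ => (1 : ℝ))

/-- Positivity of the density at `x` and smoothness of the population functions on `N`. -/
structure SmoothnessCondition {dI dC : ℕ} (M : RegressionModel dI dC) (x : Regressor dI dC)
    (N : Set (Regressor dI dC)) : Prop where
  density_pos : 0 < M.f x
  contDiff_m : ContDiffOn ℝ 2 M.m N
  contDiff_f : ContDiffOn ℝ 2 M.f N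
  contDiff_f2 : ContDiffOn ℝ 1 (M.fJoint 2) (jointNhd N 2)
  continuous_f3 : ContinuousOn (M.fJoint 3) (jointNhd N 3)
  continuous_f4 : ContinuousOn (M.fJoint 4) (jointNhd N 4)
  continuous_condVar : ContinuousOn M.condVar N
  continuous_condCov : ContinuousOn M.condCov (jointNhd N 2)

/-- `(n⁻¹ ∑_g n_g²) h^{d_ind} → λ`. -/
def ClusterSizeLimit {dI dC : ℕ} {Ω : ℕ → Type*} (S : ∀ t, ClusterSample dI dC (Ω t))
    (h : ℕ → ℝ) (lam : ℝ) : Prop :=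
  Tendsto (fun t => (1 / ((S t).n : ℝ) * ∑ g, ((S t).size g : ℝ) ^ 2) * h t ^ dI) atTop (𝓝 lam)

/-- The moment condition with exponent `r`: `E[|e|^{2r} | X = z] ≤ v²` for (almost) every `z ∈ N`,
`(∑_g n_g^r)^{1/r} / n^{1/4} ≤ C`, and `1 / (n^{r/2} h^{dr-d}) = O(1)`. -/
structure MomentCondition {dI dC : ℕ} {Ω : ℕ → Type*} [∀ t, MeasurableSpace (Ω t)]
    (P : ∀ t, Measure (Ω t)) [∀ t, IsProbabilityMeasure (P t)]
    (S : ∀ t, ClusterSample dI dC (Ω t)) (M : RegressionModel dI dC) (h : ℕ → ℝ)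
    (N : Set (Regressor dI dC)) (r : ℝ) : Prop where
  two_le : 2 ≤ r
  error_moment : ∃ v : ℝ, ∀ t g j, ∀ᵐ z ∂((P t).map ((S t).X g j)), z ∈ N →
    ∫⁻ y, ENNReal.ofReal (|y| ^ (2 * r)) ∂(condDistrib ((S t).err M g j) ((S t).X g j) (P t) z)
      ≤ ENNReal.ofReal (v ^ 2)
  size_moment : ∃ C : ℝ, 0 < C ∧ ∀ t,
    (∑ g, ((S t).size g : ℝ) ^ r) ^ (1 / r) / ((S t).n : ℝ) ^ (1 / 4 : ℝ) ≤ C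
  bandwidth_moment :
    (fun t => 1 / (((S t).n : ℝ) ^ (r / 2) * h t ^ (((dI + dC : ℕ) : ℝ) * r - ((dI + dC : ℕ) : ℝ))))
      =O[atTop] (fun _ => (1 : ℝ))

/-- `n h^{d+4} = O(1)`, nondegeneracy of the asymptotic variance, and `max_g n_g⁴ / n → 0`. -/
structure NormalityCondition {dI dC : ℕ} {Ω : ℕ → Type*} (S : ∀ t, ClusterSample dI dC (Ω t))
    (M : RegressionModel dI dC) (k : ℝ → ℝ) (h : ℕ → ℝ) (x : Regressor dI dC) (lam : ℝ) :
    Prop where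
  bandwidth_upper :
    (fun t => ((S t).n : ℝ) * h t ^ (dI + dC + 4)) =O[atTop] (fun _ => (1 : ℝ))
  variance_pos : 0 < kernelRoughness k ^ (dI + dC) * M.f x * M.condVar x +
    lam * kernelRoughness k ^ dC * M.fJoint 2 (diagPoint x) * M.condCov (diagPoint x)
  max_size_four : Tendsto (fun t => ((S t).maxSize : ℝ) ^ 4 / ((S t).n : ℝ)) atTop (𝓝 0)

end

/-! ### Characteristic functions of sums of a triangular array -/

/-! Put z = (X - x)/h and expand Y = m(x) + h ∇m(x)·z + h² ρ_h(z) + e, where ρ_h is the rescaled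
Taylor remainder. Whenever the normalised Gram matrix A is invertible, weighted least squares
reproduces the affine part exactly (`localLinear_sub_eq`). The centred, rescaled estimator is then
√(nh^d) h² (∑_a (A⁻¹)_{1a} L_a - B) + ∑_a (A⁻¹)_{1a} T_a, with L_a a local average of ρ_h and T_a a
normalised local sum of errors, both weighted by K(z)(1, z)_a.

A second-moment law of large numbers (`tendstoInProb_localAverage`) gives A → f(x) diag(1, κ₂, …,
κ₂), which is invertible, and L_a → f(x) ∫ K(u)(1, u)_a D²m(x)(u, u)/2. The limiting inverse has
first row (1/f(x), 0, …, 0), so the bias bracket tends to 0 in probability; its prefactor is bounded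
because nh^{d+4} = O(1). As each T_a is bounded in probability, A⁻¹ may be replaced by its limit,
and only T_1/f(x) remains, with T_1 the error sum weighted by K alone.

T_1 is a sum of independent centred cluster totals, and Lyapunov's theorem applies
(`tendsto_charFun_localError`). One observation has local mass of order h^d. A pair from one cluster
shares its cluster-level coordinates and has local mass of order h^{2 d_ind + d_cls} = h^d
h^{d_ind}. The variance is therefore a diagonal term plus n⁻¹ ∑ n_g(n_g - 1) h^{d_ind} times a pair
term, and this rate tends to λ.

The Lyapunov sum is at most a constant times (nh^d)^{-r/2} h^d ∑ n_g^r, which the size and bandwidth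
rates send to 0. Although r = 2 is formally admitted, ∑ n_g^r ≥ n and n → ∞ make the size bound
impossible for r < 4. -/

/-- Telescoping: exchange one factor at a time while all the others stay in the closed unit disc. -/
lemma norm_prod_sub_prod_le_sum {ι : Type*} (s : Finset ι) (a b : ι → ℂ)
    (ha : ∀ i ∈ s, ‖a i‖ ≤ 1) (hb : ∀ i ∈ s, ‖b i‖ ≤ 1) :
    ‖∏ i ∈ s, a i - ∏ i ∈ s, b i‖ ≤ ∑ i ∈ s, ‖a i - b i‖ := by
  classical
  induction s using Finset.induction_on with
  | empty => simp
  | insert i s hi ih =>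
    rw [Finset.prod_insert hi, Finset.prod_insert hi, Finset.sum_insert hi]
    have h1 : a i * ∏ j ∈ s, a j - b i * ∏ j ∈ s, b j
        = (a i - b i) * ∏ j ∈ s, a j + b i * (∏ j ∈ s, a j - ∏ j ∈ s, b j) := by ring
    have h2 : ‖∏ j ∈ s, a j‖ ≤ 1 := by
      rw [norm_prod]
      exact Finset.prod_le_one (fun _ _ => norm_nonneg _)
        fun j hj => ha j (Finset.mem_insert_of_mem hj)
    rw [h1]
    refine (norm_add_le _ _).trans (add_le_add ?_ ?_)
    · rw [norm_mul]
      exact mul_le_of_le_one_right (norm_nonneg _) h2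
    · rw [norm_mul]
      refine (mul_le_of_le_one_left (norm_nonneg _) (hb i (Finset.mem_insert_self _ _))).trans ?_
      exact ih (fun j hj => ha j (Finset.mem_insert_of_mem hj))
        fun j hj => hb j (Finset.mem_insert_of_mem hj)

lemma sq_le_rpow_of_le {x ε r : ℝ} (hε : 0 < ε) (hr : 2 ≤ r) (hx : ε ≤ |x|) :
    x ^ 2 ≤ ε ^ (2 - r) * |x| ^ r := by
  have hx0 : 0 < |x| := hε.trans_le hx
  have h1 : |x| ^ r = |x| ^ (r - 2) * x ^ 2 := by
    rw [← sq_abs, ← Real.rpow_natCast, ← Real.rpow_add hx0]; norm_num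
  have h2 : ε ^ (r - 2) ≤ |x| ^ (r - 2) := Real.rpow_le_rpow hε.le hx (by linarith)
  have h3 : ε ^ (2 - r) * ε ^ (r - 2) = 1 := by
    rw [← Real.rpow_add hε]; norm_num
  calc x ^ 2 = ε ^ (2 - r) * ε ^ (r - 2) * x ^ 2 := by rw [h3, one_mul]
    _ ≤ ε ^ (2 - r) * |x| ^ (r - 2) * x ^ 2 := by
        have := Real.rpow_nonneg hε.le (2 - r)
        gcongr
    _ = _ := by rw [h1]; ring

/-- Integrated, this bounds each single variance by ε² plus a multiple of the Lyapunov sum, so that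
no summand dominates. -/
lemma sq_le_sq_add_rpow {x ε r : ℝ} (hε : 0 < ε) (hr : 2 ≤ r) :
    x ^ 2 ≤ ε ^ 2 + ε ^ (2 - r) * |x| ^ r := by
  rcases le_total ε |x| with h | h
  · exact (sq_le_rpow_of_le hε hr h).trans (le_add_of_nonneg_left (sq_nonneg _))
  · have : x ^ 2 ≤ ε ^ 2 := by rw [← sq_abs]; gcongr
    exact this.trans (le_add_of_nonneg_right (by positivity))

/-- Split at |x| = ε. Below, the cubic Taylor remainder is at most |x|³ ≤ ε x²; above, a crude bound
is absorbed by the r-th power. The free parameter ε is sent to 0 only at the end. -/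
lemma norm_cexp_sub_taylor_two_le {x ε r : ℝ} (hε : 0 < ε) (hε1 : ε ≤ 1) (hr : 2 ≤ r) :
    ‖Complex.exp (x * Complex.I) - (1 + x * Complex.I - x ^ 2 / 2)‖
      ≤ ε * x ^ 2 + 4 * ε ^ (-r) * |x| ^ r := by
  rcases le_total ε |x| with h | h
  · have hx0 : 0 < |x| := hε.trans_le h
    have h1 : ‖Complex.exp (x * Complex.I) - (1 + x * Complex.I - x ^ 2 / 2)‖
        ≤ 2 + |x| + x ^ 2 / 2 := by
      have e1 : ‖Complex.exp (x * Complex.I)‖ = 1 := Complex.norm_exp_ofReal_mul_I x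
      have e2 : ‖(x * Complex.I : ℂ)‖ = |x| := by simp
      have e3 : ‖((x : ℂ) ^ 2 / 2)‖ = x ^ 2 / 2 := by simp
      calc _ ≤ ‖Complex.exp (x * Complex.I)‖ + ‖1 + x * Complex.I - (x : ℂ) ^ 2 / 2‖ :=
            norm_sub_le _ _
        _ ≤ ‖Complex.exp (x * Complex.I)‖ + (‖(1 : ℂ)‖ + ‖(x * Complex.I : ℂ)‖
              + ‖(x : ℂ) ^ 2 / 2‖) := by
            gcongr
            exact (norm_sub_le _ _).trans (by gcongr; exact norm_add_le _ _)
        _ = _ := by rw [e1, e2, e3, norm_one]; ring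
    -- From ε ≤ 1 and ε ≤ |x| the three terms are at most 2x², x² and x²/2, in total 7x²/2.
    have h2 : ε ^ 2 * (2 + |x| + x ^ 2 / 2) ≤ 4 * x ^ 2 := by
      rw [← sq_abs x]
      nlinarith [mul_le_mul h h hε.le (abs_nonneg x), mul_le_mul h hε1 hε.le (abs_nonneg x),
        mul_le_mul hε1 hε1 hε.le zero_le_one, sq_nonneg |x|,
        mul_le_mul_of_nonneg_right (mul_le_mul hε1 hε1 hε.le zero_le_one) (sq_nonneg |x|),
        mul_le_mul_of_nonneg_right (mul_le_mul h hε1 hε.le (abs_nonneg x)) (abs_nonneg x)]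
    have h3 := sq_le_rpow_of_le hε hr h
    have h4 : ε ^ (2 - r) = ε ^ 2 * ε ^ (-r) := by
      rw [← Real.rpow_natCast, ← Real.rpow_add hε]; norm_num [sub_eq_add_neg]
    have h5 : 2 + |x| + x ^ 2 / 2 ≤ 4 * ε ^ (-r) * |x| ^ r := by
      have : ε ^ 2 * (2 + |x| + x ^ 2 / 2) ≤ ε ^ 2 * (4 * ε ^ (-r) * |x| ^ r) := by
        rw [h4] at h3
        calc _ ≤ 4 * x ^ 2 := h2
          _ ≤ 4 * (ε ^ 2 * ε ^ (-r) * |x| ^ r) := by gcongr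
          _ = _ := by ring
      exact le_of_mul_le_mul_left this (by positivity)
    exact (h1.trans h5).trans (le_add_of_nonneg_left (by positivity))
  · have hx1 : ‖(x * Complex.I : ℂ)‖ ≤ 1 := by simpa using h.trans hε1
    have h1 := Complex.exp_bound hx1 (n := 3) (by norm_num)
    have e : ∑ m ∈ Finset.range 3, (x * Complex.I : ℂ) ^ m / (m.factorial : ℂ)
        = 1 + x * Complex.I - x ^ 2 / 2 := by
      simp [Finset.sum_range_succ, mul_pow]
      ring
    rw [e] at h1
    refine h1.trans ?_
    have e2 : ‖(x * Complex.I : ℂ)‖ = |x| := by simp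
    rw [e2]
    -- The constant in the exponential bound is 4/(3!·3) = 2/9, rounded up to 1.
    have h2 : |x| ^ 3 * (((3 : ℕ).succ : ℝ) * (((3 : ℕ).factorial : ℝ) * ((3 : ℕ) : ℝ))⁻¹)
        ≤ |x| ^ 3 * 1 := by
      gcongr
      norm_num [Nat.factorial]
    refine h2.trans ?_
    have h3 : |x| ^ 3 * 1 ≤ ε * x ^ 2 := by
      rw [← sq_abs x]
      nlinarith [mul_le_mul_of_nonneg_right h (sq_nonneg |x|)]
    exact h3.trans (le_add_of_nonneg_right (by positivity))

lemma abs_exp_neg_sub_le_sq {y : ℝ} (hy : 0 ≤ y) : |Real.exp (-y) - (1 - y)| ≤ y ^ 2 := by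
  rcases le_total y 1 with h | h
  · have := Real.abs_exp_sub_one_sub_id_le (x := -y) (by rw [abs_neg, abs_of_nonneg hy]; exact h)
    rw [neg_sq] at this
    convert this using 2
    ring
  · have h1 := Real.add_one_le_exp (-y)
    have h2 : Real.exp (-y) ≤ 1 := Real.exp_le_one_iff.2 (by linarith)
    rw [abs_of_nonneg (by linarith)]
    nlinarith

section CharFun

variable {Ω : Type*} [MeasurableSpace Ω] {P : Measure Ω}

lemma charFun_map_eq_integral {X : Ω → ℝ} (hX : AEMeasurable X P) (s : ℝ) :
    charFun (P.map X) s = ∫ ω, Complex.exp ((s * X ω : ℝ) * Complex.I) ∂P := by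
  rw [charFun_apply_real, integral_map hX (by fun_prop)]
  simp

variable [IsProbabilityMeasure P]

/-- Integrate the pointwise Taylor bound at s X; the linear term vanishes because X is centred. -/
lemma norm_charFun_sub_le {X : Ω → ℝ} {r ε : ℝ} (hr : 2 ≤ r) (hε : 0 < ε) (hε1 : ε ≤ 1)
    (hX : MemLp X 2 P) (hX0 : ∫ ω, X ω ∂P = 0) (hXr : Integrable (fun ω => |X ω| ^ r) P) (s : ℝ) :
    ‖charFun (P.map X) s - (1 - s ^ 2 * (∫ ω, X ω ^ 2 ∂P) / 2 : ℝ)‖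
      ≤ ε * (s ^ 2 * ∫ ω, X ω ^ 2 ∂P) + 4 * ε ^ (-r) * (|s| ^ r * ∫ ω, |X ω| ^ r ∂P) := by
  have hXm := hX.aestronglyMeasurable.aemeasurable
  have hX1 : Integrable X P := hX.integrable (by norm_num)
  have hX2 : Integrable (fun ω => X ω ^ 2) P := hX.integrable_sq
  have hexp : Integrable (fun ω => Complex.exp ((s * X ω : ℝ) * Complex.I)) P := by
    refine Integrable.of_bound (C := 1) ?_ (ae_of_all _ fun ω => ?_)
    · exact (Complex.continuous_exp.comp_aestronglyMeasurable
        ((Complex.continuous_ofReal.comp_aestronglyMeasurable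
          (hX.aestronglyMeasurable.const_mul s)).mul_const _))
    · rw [Complex.norm_exp_ofReal_mul_I]
  have hpol : Integrable (fun ω => (1 : ℂ) + ((s * X ω : ℝ) : ℂ) * Complex.I
      - ((s * X ω : ℝ) : ℂ) ^ 2 / 2) P := by
    have a1 : Integrable (fun ω => ((s * X ω : ℝ) : ℂ) * Complex.I) P :=
      (hX1.const_mul s).ofReal.mul_const _
    have a2 : Integrable (fun ω => ((s ^ 2 * X ω ^ 2 / 2 : ℝ) : ℂ)) P :=
      ((hX2.const_mul (s ^ 2)).div_const 2).ofReal
    refine (((integrable_const (1 : ℂ)).add a1).sub a2).congr (ae_of_all _ fun ω => ?_)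
    simp [mul_pow]
  have hint : ∫ ω, ((1 : ℂ) + ((s * X ω : ℝ) : ℂ) * Complex.I - ((s * X ω : ℝ) : ℂ) ^ 2 / 2) ∂P
      = ((1 - s ^ 2 * (∫ ω, X ω ^ 2 ∂P) / 2 : ℝ) : ℂ) := by
    have a1 : Integrable (fun ω => ((s * X ω : ℝ) : ℂ) * Complex.I) P :=
      (hX1.const_mul s).ofReal.mul_const _
    have a2 : Integrable (fun ω => ((s ^ 2 * X ω ^ 2 / 2 : ℝ) : ℂ)) P :=
      ((hX2.const_mul (s ^ 2)).div_const 2).ofReal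
    have : (fun ω => (1 : ℂ) + ((s * X ω : ℝ) : ℂ) * Complex.I - ((s * X ω : ℝ) : ℂ) ^ 2 / 2)
        = fun ω => ((1 : ℂ) + ((s * X ω : ℝ) : ℂ) * Complex.I)
          - ((s ^ 2 * X ω ^ 2 / 2 : ℝ) : ℂ) := by
      funext ω; push_cast; ring
    have a3 : Integrable (fun ω => (1 : ℂ) + ((s * X ω : ℝ) : ℂ) * Complex.I) P :=
      (integrable_const (1 : ℂ)).add a1
    rw [this, integral_sub a3 a2, integral_add (integrable_const (1 : ℂ)) a1, integral_mul_const,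
      integral_complex_ofReal, integral_complex_ofReal, integral_const_mul, hX0, integral_div, integral_const_mul]
    simp
  rw [charFun_map_eq_integral hXm, ← hint, ← integral_sub hexp hpol]
  calc _ ≤ ∫ ω, (ε * (s ^ 2 * X ω ^ 2) + 4 * ε ^ (-r) * (|s| ^ r * |X ω| ^ r)) ∂P := by
        refine norm_integral_le_of_norm_le (((hX2.const_mul _).const_mul _).add
          ((hXr.const_mul _).const_mul _)) (ae_of_all _ fun ω => ?_)
        refine (norm_cexp_sub_taylor_two_le hε hε1 hr).trans_eq ?_
        rw [abs_mul, Real.mul_rpow (abs_nonneg _) (abs_nonneg _), mul_pow]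
    _ = _ := by
        rw [integral_add ((hX2.const_mul _).const_mul _) ((hXr.const_mul _).const_mul _)]
        simp only [integral_const_mul]

/-- A quantitative Lyapunov central limit theorem. -/
lemma norm_charFun_sum_sub_le {ι : Type*} [Fintype ι] {X : ι → Ω → ℝ} {r ε : ℝ} (hr : 2 ≤ r)
    (hε : 0 < ε) (hε1 : ε ≤ 1) (hind : iIndepFun X P) (hX : ∀ i, MemLp (X i) 2 P)
    (hX0 : ∀ i, ∫ ω, X i ω ∂P = 0) (hXr : ∀ i, Integrable (fun ω => |X i ω| ^ r) P) (s : ℝ) :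
    ‖charFun (P.map (fun ω => ∑ i, X i ω)) s
        - (Real.exp (-(s ^ 2 * (∑ i, ∫ ω, X i ω ^ 2 ∂P) / 2)) : ℝ)‖
      ≤ ε * (s ^ 2 * ∑ i, ∫ ω, X i ω ^ 2 ∂P)
        + 4 * ε ^ (-r) * (|s| ^ r * ∑ i, ∫ ω, |X i ω| ^ r ∂P)
        + (ε ^ 2 * s ^ 2 + ε ^ (2 - r) * (s ^ 2 * ∑ i, ∫ ω, |X i ω| ^ r ∂P))
          * (s ^ 2 * ∑ i, ∫ ω, X i ω ^ 2 ∂P) := by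
  have hLnn : ∀ i, 0 ≤ ∫ ω, |X i ω| ^ r ∂P := fun i => integral_nonneg fun ω => by positivity
  have hVnn : ∀ i, 0 ≤ ∫ ω, X i ω ^ 2 ∂P := fun i => integral_nonneg fun ω => by positivity
  rw [hind.charFun_map_fun_sum_eq_prod fun i => (hX i).aestronglyMeasurable.aemeasurable]
  have e1 : ((Real.exp (-(s ^ 2 * (∑ i, ∫ ω, X i ω ^ 2 ∂P) / 2)) : ℝ) : ℂ)
      = ∏ i, ((Real.exp (-(s ^ 2 * (∫ ω, X i ω ^ 2 ∂P) / 2)) : ℝ) : ℂ) := by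
    rw [← Complex.ofReal_prod, ← Real.exp_sum]
    congr 2
    rw [Finset.mul_sum, Finset.sum_div, Finset.sum_neg_distrib]
  rw [e1, Finset.prod_apply]
  refine (norm_prod_sub_prod_le_sum _ _ _ (fun i _ => ?_) (fun i _ => ?_)).trans ?_
  · have := Measure.isProbabilityMeasure_map (μ := P)
      (hX i).aestronglyMeasurable.aemeasurable
    exact norm_charFun_le_one s
  · rw [Complex.norm_real, Real.norm_of_nonneg (Real.exp_pos _).le, Real.exp_le_one_iff]
    have := hVnn i
    have : 0 ≤ s ^ 2 * (∫ ω, X i ω ^ 2 ∂P) / 2 := by positivity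
    linarith
  have key : ∀ i, ‖charFun (P.map (X i)) s
      - ((Real.exp (-(s ^ 2 * (∫ ω, X i ω ^ 2 ∂P) / 2)) : ℝ) : ℂ)‖
      ≤ ε * (s ^ 2 * ∫ ω, X i ω ^ 2 ∂P) + 4 * ε ^ (-r) * (|s| ^ r * ∫ ω, |X i ω| ^ r ∂P)
        + (ε ^ 2 * s ^ 2 + ε ^ (2 - r) * (s ^ 2 * ∑ i, ∫ ω, |X i ω| ^ r ∂P))
          * (s ^ 2 * ∫ ω, X i ω ^ 2 ∂P) := by
    intro i
    have hV := hVnn i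
    have h1 := norm_charFun_sub_le hr hε hε1 (hX i) (hX0 i) (hXr i) s
    have h2 := abs_exp_neg_sub_le_sq (y := s ^ 2 * (∫ ω, X i ω ^ 2 ∂P) / 2) (by positivity)
    have h3 : ∫ ω, X i ω ^ 2 ∂P ≤ ε ^ 2 + ε ^ (2 - r) * ∑ i, ∫ ω, |X i ω| ^ r ∂P := by
      calc _ ≤ ∫ ω, (ε ^ 2 + ε ^ (2 - r) * |X i ω| ^ r) ∂P :=
            integral_mono (hX i).integrable_sq
              ((integrable_const _).add ((hXr i).const_mul _)) fun ω => sq_le_sq_add_rpow hε hr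
        _ = ε ^ 2 + ε ^ (2 - r) * ∫ ω, |X i ω| ^ r ∂P := by
            rw [integral_add (integrable_const _) ((hXr i).const_mul _), integral_const_mul]
            simp
        _ ≤ _ := by
            gcongr
            exact Finset.single_le_sum (f := fun i => ∫ ω, |X i ω| ^ r ∂P)
              (fun j _ => hLnn j) (Finset.mem_univ i)
    -- One factor of the square is bounded uniformly in i by means of `h3`; the other is kept, so
    -- that summing over i restores the total variance.
    have h4 : (s ^ 2 * (∫ ω, X i ω ^ 2 ∂P) / 2) ^ 2
        ≤ (ε ^ 2 * s ^ 2 + ε ^ (2 - r) * (s ^ 2 * ∑ i, ∫ ω, |X i ω| ^ r ∂P))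
          * (s ^ 2 * ∫ ω, X i ω ^ 2 ∂P) := by
      have h5 : s ^ 2 * ∫ ω, X i ω ^ 2 ∂P
          ≤ ε ^ 2 * s ^ 2 + ε ^ (2 - r) * (s ^ 2 * ∑ i, ∫ ω, |X i ω| ^ r ∂P) := by
        calc _ ≤ s ^ 2 * (ε ^ 2 + ε ^ (2 - r) * ∑ i, ∫ ω, |X i ω| ^ r ∂P) := by gcongr
          _ = _ := by ring
      have h6 : 0 ≤ s ^ 2 * ∫ ω, X i ω ^ 2 ∂P := by positivity
      nlinarith [mul_le_mul_of_nonneg_right h5 h6]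
    calc _ ≤ ‖charFun (P.map (X i)) s - ((1 - s ^ 2 * (∫ ω, X i ω ^ 2 ∂P) / 2 : ℝ) : ℂ)‖
          + ‖((Real.exp (-(s ^ 2 * (∫ ω, X i ω ^ 2 ∂P) / 2)) : ℝ) : ℂ)
            - ((1 - s ^ 2 * (∫ ω, X i ω ^ 2 ∂P) / 2 : ℝ) : ℂ)‖ := by
          rw [norm_sub_rev ((Real.exp _ : ℝ) : ℂ)]
          exact norm_sub_le_norm_sub_add_norm_sub _ _ _
      _ ≤ _ := by
          refine add_le_add h1 ?_
          rw [← Complex.ofReal_sub, Complex.norm_real, Real.norm_eq_abs]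
          exact h2.trans h4
  refine (Finset.sum_le_sum fun i _ => key i).trans_eq ?_
  simp only [Finset.sum_add_distrib, ← Finset.mul_sum]

end CharFun

/-- **Lyapunov's central limit theorem** for triangular arrays, in terms of characteristic
functions. -/
lemma tendsto_charFun_sum_of_lyapunov {Ω : ℕ → Type*} [∀ t, MeasurableSpace (Ω t)]
    {P : ∀ t, Measure (Ω t)} [∀ t, IsProbabilityMeasure (P t)] {ι : ℕ → Type*}
    [∀ t, Fintype (ι t)] {X : ∀ t, ι t → Ω t → ℝ} {r V : ℝ} (hr : 2 ≤ r)
    (hind : ∀ᶠ t in atTop, iIndepFun (X t) (P t))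
    (hX : ∀ᶠ t in atTop, ∀ i, MemLp (X t i) 2 (P t))
    (hX0 : ∀ᶠ t in atTop, ∀ i, ∫ ω, X t i ω ∂(P t) = 0)
    (hXr : ∀ᶠ t in atTop, ∀ i, Integrable (fun ω => |X t i ω| ^ r) (P t))
    (hV : Tendsto (fun t => ∑ i, ∫ ω, X t i ω ^ 2 ∂(P t)) atTop (𝓝 V))
    (hL : Tendsto (fun t => ∑ i, ∫ ω, |X t i ω| ^ r ∂(P t)) atTop (𝓝 0)) (s : ℝ) :
    Tendsto (fun t => charFun ((P t).map (fun ω => ∑ i, X t i ω)) s) atTop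
      (𝓝 (Real.exp (-(s ^ 2 * V / 2)) : ℝ)) := by
  have hexp : Tendsto (fun t =>
      ((Real.exp (-(s ^ 2 * (∑ i, ∫ ω, X t i ω ^ 2 ∂(P t)) / 2)) : ℝ) : ℂ)) atTop
      (𝓝 ((Real.exp (-(s ^ 2 * V / 2)) : ℝ) : ℂ)) := by
    refine (Complex.continuous_ofReal.tendsto _).comp ((Real.continuous_exp.tendsto _).comp ?_)
    exact ((hV.const_mul _).div_const 2).neg
  suffices h : Tendsto (fun t => charFun ((P t).map (fun ω => ∑ i, X t i ω)) s
      - ((Real.exp (-(s ^ 2 * (∑ i, ∫ ω, X t i ω ^ 2 ∂(P t)) / 2)) : ℝ) : ℂ)) atTop (𝓝 0) by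
    simpa using h.add hexp
  rw [tendsto_zero_iff_norm_tendsto_zero]
  refine squeeze_zero' (g := fun t => ‖charFun ((P t).map (fun ω => ∑ i, X t i ω)) s
      - ((Real.exp (-(s ^ 2 * (∑ i, ∫ ω, X t i ω ^ 2 ∂(P t)) / 2)) : ℝ) : ℂ)‖)
    (Eventually.of_forall fun _ => norm_nonneg _) (Eventually.of_forall fun _ => le_rfl) ?_
  rw [Metric.tendsto_nhds]
  intro δ hδ
  -- The order of limits is t → ∞ at fixed ε, then ε → 0. Here the Lyapunov sum is already replaced
  -- by its limit 0, which disarms the negative powers of ε.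
  have hB : Tendsto (fun ε : ℝ => ε * (s ^ 2 * V) + 4 * ε ^ (-r) * (|s| ^ r * 0)
      + (ε ^ 2 * s ^ 2 + ε ^ (2 - r) * (s ^ 2 * 0)) * (s ^ 2 * V)) (𝓝[>] 0) (𝓝 0) := by
    have : Continuous fun ε : ℝ => ε * (s ^ 2 * V) + (ε ^ 2 * s ^ 2) * (s ^ 2 * V) := by
      fun_prop
    have h0 := (this.tendsto 0).mono_left (nhdsWithin_le_nhds (s := Set.Ioi 0))
    simpa using h0
  obtain ⟨ε, hεδ, hε, hε1⟩ := ((hB.eventually (gt_mem_nhds hδ)).and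
    (Ioc_mem_nhdsGT (zero_lt_one' ℝ))).exists
  have hB2 := ((hV.const_mul (s ^ 2)).const_mul ε).add
    ((hL.const_mul (|s| ^ r)).const_mul (4 * ε ^ (-r))) |>.add
    ((((hL.const_mul (s ^ 2)).const_mul (ε ^ (2 - r))).const_add (ε ^ 2 * s ^ 2)).mul
      (hV.const_mul (s ^ 2)))
  filter_upwards [hind, hX, hX0, hXr, hB2.eventually (gt_mem_nhds hεδ)] with t h1 h2 h3 h4 h5
  rw [Real.dist_eq, sub_zero, abs_norm]
  exact (norm_charFun_sum_sub_le hr hε hε1 h1 h2 h3 h4 s).trans_lt h5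

/-! ### Convergence in probability along a sequence of probability spaces -/

section InProbability

variable {Ω : ℕ → Type*} [∀ t, MeasurableSpace (Ω t)]

/-- `Z t` converges in `P t`-probability to the constant `c`. -/
def TendstoInProb {E : Type*} [PseudoMetricSpace E] (P : ∀ t, Measure (Ω t))
    (Z : ∀ t, Ω t → E) (c : E) : Prop :=
  ∀ ε > 0, Tendsto (fun t => P t {ω | ε ≤ dist (Z t ω) c}) atTop (𝓝 0)

/-- `Z t` is stochastically bounded under `P t`. -/
def BoundedInProb (P : ∀ t, Measure (Ω t)) (Z : ∀ t, Ω t → ℝ) : Prop :=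
  ∀ δ > 0, ∃ K : ℝ, ∀ᶠ t in atTop, P t {ω | K ≤ |Z t ω|} ≤ δ

variable {P : ∀ t, Measure (Ω t)} {E F : Type*} [PseudoMetricSpace E] [PseudoMetricSpace F]

/-- Measures are monotone on arbitrary sets, so this calculus of convergence in probability asks for
no measurability. -/
lemma tendsto_measure_zero_of_subset {A B : ∀ t, Set (Ω t)}
    (hB : Tendsto (fun t => P t (B t)) atTop (𝓝 0)) (hAB : ∀ t, A t ⊆ B t) :
    Tendsto (fun t => P t (A t)) atTop (𝓝 0) :=
  tendsto_of_tendsto_of_tendsto_of_le_of_le tendsto_const_nhds hB (fun _ => zero_le)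
    fun t => measure_mono (hAB t)

lemma TendstoInProb.comp {Z : ∀ t, Ω t → E} {c : E} {φ : E → F} (hZ : TendstoInProb P Z c)
    (hφ : ContinuousAt φ c) : TendstoInProb P (fun t ω => φ (Z t ω)) (φ c) := by
  intro ε hε
  obtain ⟨δ, hδ, h⟩ := Metric.continuousAt_iff.1 hφ ε hε
  refine tendsto_measure_zero_of_subset (hZ δ hδ) fun t ω hω => ?_
  by_contra hlt
  exact absurd (h (not_le.1 hlt)) (not_lt.2 hω)

lemma TendstoInProb.prodMk {Y : ∀ t, Ω t → E} {Z : ∀ t, Ω t → F} {b : E} {c : F}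
    (hY : TendstoInProb P Y b) (hZ : TendstoInProb P Z c) :
    TendstoInProb P (fun t ω => (Y t ω, Z t ω)) (b, c) := by
  intro ε hε
  have h := (hY ε hε).add (hZ ε hε)
  rw [add_zero] at h
  refine tendsto_of_tendsto_of_tendsto_of_le_of_le tendsto_const_nhds h (fun _ => zero_le)
    fun t => (measure_mono fun ω hω => ?_).trans (measure_union_le _ _)
  simpa [Prod.dist_eq, le_max_iff] using hω

lemma TendstoInProb.pi {ι : Type*} [Fintype ι] {E : ι → Type*} [∀ i, PseudoMetricSpace (E i)]
    {Z : ∀ t, Ω t → ∀ i, E i} {c : ∀ i, E i}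
    (hZ : ∀ i, TendstoInProb P (fun t ω => Z t ω i) (c i)) : TendstoInProb P Z c := by
  intro ε hε
  have h := tendsto_finsetSum Finset.univ fun i _ => hZ i ε hε
  simp only [Finset.sum_const_zero] at h
  refine tendsto_of_tendsto_of_tendsto_of_le_of_le tendsto_const_nhds h (fun _ => zero_le)
    fun t => (measure_mono fun ω hω => ?_).trans (measure_biUnion_finset_le _ _)
  by_contra hne
  simp only [Finset.mem_univ, Set.iUnion_true, Set.mem_iUnion, Set.mem_ofPred_eq, not_exists,
    not_le] at hne
  exact absurd ((dist_pi_lt_iff hε).2 hne) (not_lt.2 hω)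

lemma tendstoInProb_const (c : E) : TendstoInProb P (fun _ _ => c) c := by
  intro ε hε
  simp [not_le.2 hε]

lemma TendstoInProb.of_tendsto {z : ℕ → E} {c : E} (hz : Tendsto z atTop (𝓝 c)) :
    TendstoInProb P (fun t _ => z t) c := by
  intro ε hε
  refine tendsto_const_nhds.congr' ?_
  filter_upwards [Metric.tendsto_nhds.1 hz ε hε] with t ht
  simp [not_le.2 ht]

lemma TendstoInProb.add {Y Z : ∀ t, Ω t → ℝ} {b c : ℝ} (hY : TendstoInProb P Y b)
    (hZ : TendstoInProb P Z c) : TendstoInProb P (fun t ω => Y t ω + Z t ω) (b + c) :=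
  (hY.prodMk hZ).comp (φ := fun p : ℝ × ℝ => p.1 + p.2) (by fun_prop)

lemma TendstoInProb.sub {Y Z : ∀ t, Ω t → ℝ} {b c : ℝ} (hY : TendstoInProb P Y b)
    (hZ : TendstoInProb P Z c) : TendstoInProb P (fun t ω => Y t ω - Z t ω) (b - c) :=
  (hY.prodMk hZ).comp (φ := fun p : ℝ × ℝ => p.1 - p.2) (by fun_prop)

lemma TendstoInProb.mul {Y Z : ∀ t, Ω t → ℝ} {b c : ℝ} (hY : TendstoInProb P Y b)
    (hZ : TendstoInProb P Z c) : TendstoInProb P (fun t ω => Y t ω * Z t ω) (b * c) :=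
  (hY.prodMk hZ).comp (φ := fun p : ℝ × ℝ => p.1 * p.2) (by fun_prop)

lemma TendstoInProb.sum {ι : Type*} [Fintype ι] {Z : ι → ∀ t, Ω t → ℝ} {c : ι → ℝ}
    (hZ : ∀ i, TendstoInProb P (Z i) (c i)) :
    TendstoInProb P (fun t ω => ∑ i, Z i t ω) (∑ i, c i) :=
  (TendstoInProb.pi (Z := fun t ω i => Z i t ω) hZ).comp (φ := fun p : ι → ℝ => ∑ i, p i)
    (by fun_prop)

/-- Serves identities that hold only where the Gram matrix is invertible, an event whose probability
tends to 1. -/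
lemma TendstoInProb.congr_prob {Y Z : ∀ t, Ω t → E} {c : E} (hY : TendstoInProb P Y c)
    (h : Tendsto (fun t => P t {ω | Z t ω ≠ Y t ω}) atTop (𝓝 0)) : TendstoInProb P Z c := by
  intro ε hε
  have h2 := (hY ε hε).add h
  rw [add_zero] at h2
  refine tendsto_of_tendsto_of_tendsto_of_le_of_le tendsto_const_nhds h2 (fun _ => zero_le)
    fun t => (measure_mono fun ω hω => ?_).trans (measure_union_le _ _)
  by_cases heq : Z t ω = Y t ω
  · left; simpa [← heq] using hω
  · right; exact heq

lemma TendstoInProb.tendsto_measure_eq {Z : ∀ t, Ω t → ℝ} {b c : ℝ} (hZ : TendstoInProb P Z c)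
    (hbc : b ≠ c) : Tendsto (fun t => P t {ω | Z t ω = b}) atTop (𝓝 0) :=
  tendsto_measure_zero_of_subset (hZ (dist b c) (dist_pos.2 hbc)) fun t ω hω => by
    simp only [Set.mem_ofPred_eq] at hω ⊢
    rw [hω]

lemma measure_abs_ge_le {α : Type*} [MeasurableSpace α] {μ : Measure α} {Z : α → ℝ} {ε : ℝ}
    (hε : 0 < ε) (hZ : Integrable (fun ω => Z ω ^ 2) μ) :
    μ {ω | ε ≤ |Z ω|} ≤ ENNReal.ofReal ((∫ ω, Z ω ^ 2 ∂μ) / ε ^ 2) := by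
  have h := mul_meas_ge_le_lintegral₀ (μ := μ) (f := fun ω => ENNReal.ofReal (Z ω ^ 2))
    hZ.aestronglyMeasurable.aemeasurable.ennreal_ofReal (ENNReal.ofReal (ε ^ 2))
  rw [← ofReal_integral_eq_lintegral_ofReal hZ (ae_of_all _ fun ω => sq_nonneg _)] at h
  have hsub : {ω | ε ≤ |Z ω|} ⊆ {ω | ENNReal.ofReal (ε ^ 2) ≤ ENNReal.ofReal (Z ω ^ 2)} := by
    intro ω hω
    refine ENNReal.ofReal_le_ofReal ?_
    rw [← sq_abs (Z ω)]
    exact pow_le_pow_left₀ hε.le hω 2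
  rw [ENNReal.ofReal_div_of_pos (by positivity), ENNReal.le_div_iff_mul_le
    (Or.inl (by simp [hε.ne'])) (Or.inl ENNReal.ofReal_ne_top), mul_comm]
  exact (mul_le_mul_right (measure_mono hsub) _).trans h

lemma TendstoInProb.of_sq {Z : ∀ t, Ω t → ℝ} {c : ℝ}
    (hi : ∀ᶠ t in atTop, Integrable (fun ω => (Z t ω - c) ^ 2) (P t))
    (h : Tendsto (fun t => ∫ ω, (Z t ω - c) ^ 2 ∂(P t)) atTop (𝓝 0)) :
    TendstoInProb P Z c := by
  intro ε hε
  have h1 : Tendsto (fun t => ENNReal.ofReal ((∫ ω, (Z t ω - c) ^ 2 ∂(P t)) / ε ^ 2)) atTop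
      (𝓝 0) := by
    simpa using ENNReal.tendsto_ofReal (h.div_const (ε ^ 2))
  refine tendsto_of_tendsto_of_tendsto_of_le_of_le' tendsto_const_nhds h1
    (Eventually.of_forall fun _ => zero_le) ?_
  filter_upwards [hi] with t ht
  exact measure_abs_ge_le hε ht

lemma BoundedInProb.of_sq {Z : ∀ t, Ω t → ℝ} {c : ℝ}
    (hi : ∀ᶠ t in atTop, Integrable (fun ω => Z t ω ^ 2) (P t))
    (h : Tendsto (fun t => ∫ ω, Z t ω ^ 2 ∂(P t)) atTop (𝓝 c)) :
    BoundedInProb P Z := by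
  intro δ hδ
  have hK : Tendsto (fun K : ℝ => ENNReal.ofReal ((c + 1) / K ^ 2)) atTop (𝓝 0) := by
    have h0 : Tendsto (fun K : ℝ => (c + 1) / K ^ 2) atTop (𝓝 0) :=
      (tendsto_pow_atTop (two_ne_zero)).const_div_atTop _
    simpa using ENNReal.tendsto_ofReal h0
  obtain ⟨K, hKδ, hK0⟩ := ((hK.eventually (gt_mem_nhds hδ)).and (eventually_gt_atTop 0)).exists
  refine ⟨K, ?_⟩
  filter_upwards [hi, h.eventually (gt_mem_nhds (lt_add_one c))] with t h1 h2
  refine (measure_abs_ge_le hK0 h1).trans (le_trans ?_ hKδ.le)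
  exact ENNReal.ofReal_le_ofReal (by gcongr)

/-- The rule O_P(1) · o_P(1) = o_P(1). In the proof, `max K 1` replaces `K` so that the threshold
can be divided by it. -/
lemma BoundedInProb.mul_tendsto_zero {Y Z : ∀ t, Ω t → ℝ} (hY : BoundedInProb P Y)
    (hZ : TendstoInProb P Z 0) : TendstoInProb P (fun t ω => Y t ω * Z t ω) 0 := by
  intro ε hε
  rw [ENNReal.tendsto_nhds_zero]
  intro δ hδ
  obtain ⟨K, hK⟩ := hY (δ / 2) (ENNReal.half_pos hδ.ne')
  have hK1 : 0 < max K 1 := lt_max_of_lt_right one_pos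
  have hZ' := (ENNReal.tendsto_nhds_zero.1 (hZ (ε / max K 1) (by positivity))) (δ / 2)
    (ENNReal.half_pos hδ.ne')
  filter_upwards [hK, hZ'] with t h1 h2
  calc _ ≤ P t ({ω | K ≤ |Y t ω|} ∪ {ω | ε / max K 1 ≤ dist (Z t ω) 0}) := by
        refine measure_mono fun ω hω => ?_
        by_contra hne
        simp only [Set.mem_union, Set.mem_ofPred_eq, not_or, not_le, Real.dist_eq, sub_zero]
          at hne hω
        rw [abs_mul] at hω
        have h3 : |Y t ω| * |Z t ω| < max K 1 * (ε / max K 1) :=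
          mul_lt_mul'' (hne.1.trans_le (le_max_left _ _)) hne.2 (abs_nonneg _) (abs_nonneg _)
        rw [mul_div_cancel₀ _ hK1.ne'] at h3
        linarith
    _ ≤ δ / 2 + δ / 2 := (measure_union_le _ _).trans (add_le_add h1 h2)
    _ = δ := ENNReal.add_halves δ

lemma norm_cexp_mul_I_sub_le (a b : ℝ) :
    ‖Complex.exp (a * Complex.I) - Complex.exp (b * Complex.I)‖ ≤ |a - b| := by
  have h : Complex.exp (a * Complex.I) - Complex.exp (b * Complex.I)
      = Complex.exp (b * Complex.I) * (Complex.exp (Complex.I * ((a - b : ℝ) : ℂ)) - 1) := by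
    rw [mul_sub, ← Complex.exp_add, mul_one]
    congr 2
    push_cast; ring
  rw [h, norm_mul, Complex.norm_exp_ofReal_mul_I, one_mul]
  exact Real.norm_exp_I_mul_ofReal_sub_one_le

/-- Slutsky's lemma for characteristic functions: |e^{isW} - e^{isU}| is at most both 2 and |s| |W -
U|. -/
lemma tendsto_charFun_of_tendstoInProb_sub [∀ t, IsProbabilityMeasure (P t)]
    {U W : ∀ t, Ω t → ℝ} (hU : ∀ t, AEMeasurable (U t) (P t)) (hW : ∀ t, AEMeasurable (W t) (P t))
    (h : TendstoInProb P (fun t ω => W t ω - U t ω) 0) {s : ℝ} {c : ℂ}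
    (hc : Tendsto (fun t => charFun ((P t).map (U t)) s) atTop (𝓝 c)) :
    Tendsto (fun t => charFun ((P t).map (W t)) s) atTop (𝓝 c) := by
  suffices h0 : Tendsto (fun t => charFun ((P t).map (W t)) s - charFun ((P t).map (U t)) s)
      atTop (𝓝 0) by simpa using h0.add hc
  rw [Metric.tendsto_nhds]
  intro δ hδ
  -- Off the exceptional set the integrand is at most δ/4. On it the integrand is at most 2 and the
  -- probability at most δ/8, so the total is δ/2. The added 1 covers s = 0.
  set ε : ℝ := δ / (4 * (|s| + 1)) with hε
  have hε0 : 0 < ε := by positivity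
  have hP := ENNReal.tendsto_nhds_zero.1 (h ε hε0) (ENNReal.ofReal (δ / 8))
    (ENNReal.ofReal_pos.2 (by positivity))
  filter_upwards [hP] with t ht
  rw [dist_zero_right, charFun_map_eq_integral (hW t), charFun_map_eq_integral (hU t)]
  have hmeas : ∀ {X : Ω t → ℝ}, AEMeasurable X (P t) →
      Integrable (fun ω => Complex.exp ((s * X ω : ℝ) * Complex.I)) (P t) := by
    intro X hX
    refine Integrable.of_bound (C := 1) ?_ (ae_of_all _ fun ω => ?_)
    · exact (Complex.continuous_exp.comp_aestronglyMeasurable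
        ((Complex.continuous_ofReal.comp_aestronglyMeasurable
          (hX.aestronglyMeasurable.const_mul s)).mul_const _))
    · rw [Complex.norm_exp_ofReal_mul_I]
  rw [← integral_sub (hmeas (hW t)) (hmeas (hU t))]
  set A : Set (Ω t) := {ω | ε ≤ dist (W t ω - U t ω) 0} with hA
  have hAm : NullMeasurableSet A (P t) :=
    nullMeasurableSet_le aemeasurable_const (((hW t).sub (hU t)).dist aemeasurable_const)
  have hbd : ∀ ω, ‖Complex.exp ((s * W t ω : ℝ) * Complex.I)
      - Complex.exp ((s * U t ω : ℝ) * Complex.I)‖ ≤ δ / 4 + A.indicator (fun _ => (2 : ℝ)) ω := by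
    intro ω
    by_cases hω : ω ∈ A
    · rw [Set.indicator_of_mem hω]
      refine (norm_sub_le _ _).trans ?_
      rw [Complex.norm_exp_ofReal_mul_I, Complex.norm_exp_ofReal_mul_I]
      linarith
    · rw [Set.indicator_of_notMem hω, add_zero]
      refine (norm_cexp_mul_I_sub_le _ _).trans ?_
      have h1 : |W t ω - U t ω| < ε := by
        simpa [hA, Real.dist_eq] using hω
      rw [← mul_sub, abs_mul]
      calc |s| * |W t ω - U t ω| ≤ (|s| + 1) * ε := by
            gcongr
            linarith
        _ = δ / 4 := by rw [hε]; field_simp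
  have hint : Integrable (fun ω => δ / 4 + A.indicator (fun _ => (2 : ℝ)) ω) (P t) :=
    (integrable_const _).add ((integrable_const (2 : ℝ)).indicator₀ hAm)
  refine (norm_integral_le_of_norm_le hint (ae_of_all _ hbd)).trans_lt ?_
  rw [integral_add (integrable_const _) ((integrable_const (2 : ℝ)).indicator₀ hAm),
    integral_indicator₀ hAm]
  have hreal : (P t).real A ≤ δ / 8 := by
    rw [Measure.real]
    exact ENNReal.toReal_le_of_le_ofReal (by positivity) ht
  simp
  linarith

end InProbability

/-! ### Localisation of integrals at a point -/

section Localisation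

variable {E : Type*} [NormedAddCommGroup E] [NormedSpace ℝ E] [MeasurableSpace E] [BorelSpace E]
  [FiniteDimensional ℝ E]

/-- A bounded measurable function vanishing outside a ball around the origin. -/
structure IsBump (R C : ℝ) (ψ : E → ℝ) : Prop where
  measurable : Measurable ψ
  bound : ∀ u, |ψ u| ≤ C
  support : ∀ u, R < ‖u‖ → ψ u = 0

omit [NormedSpace ℝ E] [BorelSpace E] [FiniteDimensional ℝ E] in
lemma IsBump.mul {R C R' C' : ℝ} {ψ φ : E → ℝ} (hψ : IsBump R C ψ) (hφ : IsBump R' C' φ) :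
    IsBump R (C * C') (fun u => ψ u * φ u) where
  measurable := hψ.measurable.mul hφ.measurable
  bound u := by
    rw [abs_mul]
    exact mul_le_mul (hψ.bound u) (hφ.bound u) (abs_nonneg _) ((abs_nonneg _).trans (hψ.bound u))
  support u hu := by rw [hψ.support u hu, zero_mul]

-- The second factor need only be bounded on the supporting ball, which admits coordinates and
-- Taylor remainders as weights.
omit [NormedSpace ℝ E] [BorelSpace E] [FiniteDimensional ℝ E] in
lemma IsBump.mul_of_bound {R C C' : ℝ} {ψ φ : E → ℝ} (hψ : IsBump R C ψ) (hφ : Measurable φ)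
    (hb : ∀ u, ‖u‖ ≤ R → |φ u| ≤ C') :
    IsBump R (C * |C'|) (fun u => ψ u * φ u) where
  measurable := hψ.measurable.mul hφ
  bound u := by
    have hC : 0 ≤ C := (abs_nonneg _).trans (hψ.bound u)
    rcases le_or_gt ‖u‖ R with hu | hu
    · rw [abs_mul]
      exact mul_le_mul (hψ.bound u) ((hb u hu).trans (le_abs_self _)) (abs_nonneg _) hC
    · rw [hψ.support u hu, zero_mul, abs_zero]
      positivity
  support u hu := by rw [hψ.support u hu, zero_mul]

omit [NormedSpace ℝ E] [FiniteDimensional ℝ E] in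
lemma isBump_indicator_closedBall (R : ℝ) :
    IsBump R 1 ((Metric.closedBall (0 : E) R).indicator fun _ => (1 : ℝ)) where
  measurable := measurable_const.indicator Metric.isClosed_closedBall.measurableSet
  bound u := by by_cases h : u ∈ Metric.closedBall (0 : E) R <;> simp [h]
  support u hu := by
    rw [Set.indicator_of_notMem]
    simpa using hu

/-- Substitute z = x + h u. The Jacobian is the source of every power of h: the dimension is d for
one observation and 2 d_ind + d_cls for a pair. -/
lemma integral_rescale_mul (μ : Measure E) [μ.IsAddHaarMeasure] {h : ℝ} (hh : 0 < h) (x : E)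
    (ψ g : E → ℝ) :
    ∫ z, ψ (h⁻¹ • (z - x)) * g z ∂μ
      = h ^ Module.finrank ℝ E * ∫ u, ψ u * g (x + h • u) ∂μ := by
  have h1 := integral_add_left_eq_self (μ := μ) (fun z => ψ (h⁻¹ • (z - x)) * g z) x
  have h2 := Measure.integral_comp_smul μ
    (fun z => ψ (h⁻¹ • (x + z - x)) * g (x + z)) h
  simp only [add_sub_cancel_left, smul_smul, inv_mul_cancel₀ hh.ne', one_smul, smul_eq_mul]
    at h1 h2
  rw [h2, ← h1, abs_of_pos (by positivity), ← mul_assoc, mul_inv_cancel₀ (by positivity), one_mul]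

omit [MeasurableSpace E] [BorelSpace E] [FiniteDimensional ℝ E] in
lemma eventually_forall_norm_le_rescale {h : ℕ → ℝ} (hh : Tendsto h atTop (𝓝 0)) {x : E}
    {p : E → Prop} (hp : ∀ᶠ z in 𝓝 x, p z) (R : ℝ) :
    ∀ᶠ t in atTop, ∀ u : E, ‖u‖ ≤ R → p (x + h t • u) := by
  obtain ⟨δ, hδ, hball⟩ := Metric.eventually_nhds_iff.1 hp
  have h1 : Tendsto (fun t => |h t| * R) atTop (𝓝 0) := by
    simpa using hh.abs.mul_const R
  filter_upwards [h1.eventually (gt_mem_nhds hδ)] with t ht u hu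
  refine hball ?_
  rw [dist_self_add_left, norm_smul, Real.norm_eq_abs]
  exact (mul_le_mul_of_nonneg_left hu (abs_nonneg _)).trans_lt ht

/-- Dominated convergence on a fixed ball: x + h u tends to x uniformly there, and g is bounded near
x by continuity. The weights may vary with t because the Taylor remainder does. -/
lemma tendsto_integral_bump_mul {μ : Measure E} [IsFiniteMeasureOnCompacts μ] {h : ℕ → ℝ}
    (hh : Tendsto h atTop (𝓝 0)) {x : E} {g : E → ℝ} (hg : Measurable g) (hgx : ContinuousAt g x)
    {R C : ℝ} {ψ : ℕ → E → ℝ} {φ : E → ℝ} (hψ : ∀ᶠ t in atTop, IsBump R C (ψ t))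
    (hlim : ∀ u, Tendsto (fun t => ψ t u) atTop (𝓝 (φ u))) :
    Tendsto (fun t => ∫ u, ψ t u * g (x + h t • u) ∂μ) atTop (𝓝 (g x * ∫ u, φ u ∂μ)) := by
  have : ProperSpace E := FiniteDimensional.proper ℝ E
  rw [← integral_const_mul]
  refine tendsto_integral_filter_of_dominated_convergence
    ((Metric.closedBall (0 : E) R).indicator fun _ => |C| * (|g x| + 1)) ?_ ?_ ?_ ?_
  · filter_upwards [hψ] with t ht
    exact (ht.measurable.mul (hg.comp (by fun_prop))).aestronglyMeasurable
  · have hb : ∀ᶠ z in 𝓝 x, |g z| < |g x| + 1 :=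
      hgx.abs.eventually (gt_mem_nhds (lt_add_one _))
    filter_upwards [hψ, eventually_forall_norm_le_rescale hh hb R] with t ht hgt
    refine ae_of_all _ fun u => ?_
    rcases le_or_gt ‖u‖ R with hu | hu
    · rw [Set.indicator_of_mem (by simpa using hu), norm_mul]
      exact mul_le_mul ((ht.bound u).trans (le_abs_self C)) (hgt u hu).le (norm_nonneg _)
        (abs_nonneg _)
    · rw [Set.indicator_of_notMem (by simpa using hu), ht.support u hu]
      simp
  · refine (integrable_indicator_iff Metric.isClosed_closedBall.measurableSet).2 ?_
    exact integrableOn_const (isCompact_closedBall (0 : E) R).measure_lt_top.ne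
  · refine ae_of_all _ fun u => ?_
    rw [mul_comm]
    refine (hlim u).mul (hgx.tendsto.comp ?_)
    simpa using ((hh.smul_const u).const_add x)

omit [MeasurableSpace E] [BorelSpace E] [FiniteDimensional ℝ E] in
/-- The remainder of the second-order Taylor expansion of a `C²` function. -/
lemma isLittleO_taylor_two {m : E → ℝ} {x : E} (hm : ContDiffAt ℝ 2 m x) :
    (fun v => m (x + v) - m x - fderiv ℝ m x v - fderiv ℝ (fderiv ℝ m) x v v / 2)
      =o[𝓝 0] fun v => ‖v‖ ^ 2 := by
  have hsymm : IsSymmSndFDerivAt ℝ m x := hm.isSymmSndFDerivAt (by simp)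
  have hd : ∀ᶠ y in 𝓝 x, DifferentiableAt ℝ m y := by
    filter_upwards [hm.eventually (by simp)] with y hy
    exact hy.differentiableAt (by simp)
  have hd2 : HasFDerivAt (fderiv ℝ m) (fderiv ℝ (fderiv ℝ m) x) x :=
    ((hm.fderiv_right (m := 1) (by norm_num)).differentiableAt (by simp)).hasFDerivAt
  rw [isLittleO_iff]
  intro c hc
  have hlit := (isLittleO_iff.1 (hasFDerivAt_iff_isLittleO_nhds_zero.1 hd2)) hc
  have hd' : ∀ᶠ v in 𝓝 (0 : E), DifferentiableAt ℝ m (x + v) := by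
    have : Tendsto (fun v : E => x + v) (𝓝 0) (𝓝 x) := by
      simpa using (tendsto_id (x := 𝓝 (0 : E))).const_add x
    exact this.eventually hd
  obtain ⟨δ, hδ, hball⟩ := Metric.eventually_nhds_iff.1 (hlit.and hd')
  refine Metric.eventually_nhds_iff.2 ⟨δ, hδ, fun v hv => ?_⟩
  rw [dist_zero_right] at hv
  -- The derivative of the second-order remainder is the first-order remainder of Dm; symmetry of
  -- D²m(x) merges the two halves of the quadratic term. That derivative is at most c‖v‖ on the
  -- ball, and the mean value inequality gives c‖v‖².
  have hderiv : ∀ w ∈ Metric.closedBall (0 : E) ‖v‖, HasFDerivWithinAt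
      (fun v => m (x + v) - m x - fderiv ℝ m x v - fderiv ℝ (fderiv ℝ m) x v v / 2)
      (fderiv ℝ m (x + w) - fderiv ℝ m x - fderiv ℝ (fderiv ℝ m) x w)
      (Metric.closedBall (0 : E) ‖v‖) w := by
    intro w hw
    have hwδ : dist w 0 < δ := (Metric.mem_closedBall.1 hw).trans_lt hv
    have h1 : HasFDerivAt (fun v => m (x + v)) (fderiv ℝ m (x + w)) w := by
      have := (hball hwδ).2.hasFDerivAt.comp w ((hasFDerivAt_id w).const_add x)
      simpa using! this
    have h2 : HasFDerivAt (fun v => fderiv ℝ (fderiv ℝ m) x v v)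
        (fderiv ℝ (fderiv ℝ m) x w + (fderiv ℝ (fderiv ℝ m) x).flip w) w := by
      have := (fderiv ℝ (fderiv ℝ m) x).hasFDerivAt (x := w) |>.clm_apply (hasFDerivAt_id w)
      convert! this using 1
    have h3 : (fderiv ℝ (fderiv ℝ m) x).flip w = fderiv ℝ (fderiv ℝ m) x w := by
      ext y
      exact hsymm y w
    have h4 := ((h1.sub_const (m x)).sub (fderiv ℝ m x).hasFDerivAt).sub (h2.mul_const (2 : ℝ)⁻¹)
    refine (HasFDerivAt.hasFDerivWithinAt ?_)
    convert! h4 using 1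
    rw [h3]
    ext y
    simp
    ring
  have hbound : ∀ w ∈ Metric.closedBall (0 : E) ‖v‖,
      ‖fderiv ℝ m (x + w) - fderiv ℝ m x - fderiv ℝ (fderiv ℝ m) x w‖ ≤ c * ‖v‖ := by
    intro w hw
    have hwv := Metric.mem_closedBall.1 hw
    refine (hball (hwv.trans_lt hv)).1.trans ?_
    rw [dist_zero_right] at hwv
    gcongr
  have h5 := (convex_closedBall (0 : E) ‖v‖).norm_image_sub_le_of_norm_hasFDerivWithin_le
    hderiv hbound (x := 0) (y := v) (by simp) (by simp)
  simp only [add_zero, sub_self, map_zero, zero_div, sub_zero] at h5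
  refine h5.trans_eq ?_
  rw [Real.norm_of_nonneg (sq_nonneg ‖v‖)]
  ring

/-- The rescaled remainder of the first-order Taylor expansion of `m` at `x`. -/
noncomputable def taylorRemainder (m : E → ℝ) (x : E) (h : ℝ) (u : E) : ℝ :=
  (m (x + h • u) - m x - h * fderiv ℝ m x u) / h ^ 2

omit [MeasurableSpace E] [BorelSpace E] [FiniteDimensional ℝ E] in
lemma taylorRemainder_eq {m : E → ℝ} {x : E} {h : ℝ} (hh : 0 < h) (u : E) :
    taylorRemainder m x h u = (m (x + h • u) - m x - fderiv ℝ m x (h • u)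
      - fderiv ℝ (fderiv ℝ m) x (h • u) (h • u) / 2) / h ^ 2
      + fderiv ℝ (fderiv ℝ m) x u u / 2 := by
  have := hh.ne'
  simp only [taylorRemainder, map_smul, smul_eq_mul, FunLike.coe_smul, Pi.smul_apply]
  field_simp
  ring

omit [MeasurableSpace E] [BorelSpace E] [FiniteDimensional ℝ E] in
lemma tendsto_taylorRemainder {m : E → ℝ} {x : E} (hm : ContDiffAt ℝ 2 m x) {h : ℕ → ℝ}
    (hpos : ∀ t, 0 < h t) (hh : Tendsto h atTop (𝓝 0)) (u : E) :
    Tendsto (fun t => taylorRemainder m x (h t) u) atTop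
      (𝓝 (fderiv ℝ (fderiv ℝ m) x u u / 2)) := by
  simp_rw [fun t => taylorRemainder_eq (m := m) (x := x) (hpos t) u]
  have hv : Tendsto (fun t => h t • u) atTop (𝓝 0) := by simpa using hh.smul_const u
  have h1 := (isLittleO_taylor_two hm).comp_tendsto hv
  have h2 : ((fun v : E => ‖v‖ ^ 2) ∘ fun t => h t • u) =O[atTop] fun t => h t ^ 2 := by
    refine IsBigO.of_bound (‖u‖ ^ 2) (Eventually.of_forall fun t => ?_)
    simp only [Function.comp, norm_smul, mul_pow, norm_mul, norm_pow, norm_norm]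
    rw [mul_comm]
  simpa using (h1.trans_isBigO h2).tendsto_div_nhds_zero.add_const
    (fderiv ℝ (fderiv ℝ m) x u u / 2)

omit [MeasurableSpace E] [BorelSpace E] [FiniteDimensional ℝ E] in
lemma exists_bound_taylorRemainder {m : E → ℝ} {x : E} (hm : ContDiffAt ℝ 2 m x) {h : ℕ → ℝ}
    (hpos : ∀ t, 0 < h t) (hh : Tendsto h atTop (𝓝 0)) (R : ℝ) :
    ∃ C, ∀ᶠ t in atTop, ∀ u, ‖u‖ ≤ R → |taylorRemainder m x (h t) u| ≤ C := by
  refine ⟨R ^ 2 + ‖fderiv ℝ (fderiv ℝ m) x‖ * R * R / 2, ?_⟩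
  have h1 := isLittleO_iff.1 (isLittleO_taylor_two hm) one_pos
  filter_upwards [eventually_forall_norm_le_rescale hh h1 R] with t ht u hu
  have hR : 0 ≤ R := (norm_nonneg u).trans hu
  have h2 := ht u hu
  rw [zero_add, one_mul, norm_smul, Real.norm_eq_abs, Real.norm_eq_abs, Real.norm_eq_abs, abs_pow,
    abs_mul, abs_abs, abs_norm, abs_of_pos (hpos t), mul_pow] at h2
  rw [taylorRemainder_eq (hpos t)]
  refine (abs_add_le _ _).trans (add_le_add ?_ ?_)
  · have hp := pow_pos (hpos t) 2
    rw [abs_div, abs_of_pos hp, div_le_iff₀ hp]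
    refine h2.trans ?_
    rw [mul_comm]
    gcongr
  · rw [abs_div, abs_two]
    gcongr
    refine ((fderiv ℝ (fderiv ℝ m) x).le_opNorm₂ u u).trans ?_
    gcongr

end Localisation

/-! ### Moments of product kernels -/

section Kernel

variable {dI dC : ℕ} {k : ℝ → ℝ}

/-- A non-integrable function has Bochner integral 0, not 1. -/
lemma IsUnivariateKernel.integrable (hk : IsUnivariateKernel k) : Integrable k := by
  by_contra h
  have := hk.integral_eq_one
  rw [integral_undef h] at this
  exact zero_ne_one this

lemma IsUnivariateKernel.integral_id_mul (hk : IsUnivariateKernel k) : ∫ u, u * k u = 0 := by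
  have h := integral_neg_eq_self (fun u => u * k u) volume
  simp only [hk.even, neg_mul, integral_neg] at h
  linarith

/-- If κ₂ were 0, then k would vanish almost everywhere, against ∫ k = 1. Positivity makes the
limiting Gram matrix invertible. -/
lemma IsUnivariateKernel.kernelSecondMoment_pos (hk : IsUnivariateKernel k) :
    0 < kernelSecondMoment k := by
  have hnn : ∀ u, 0 ≤ u ^ 2 * k u := fun u => mul_nonneg (sq_nonneg u) (hk.nonneg u)
  refine lt_of_le_of_ne (integral_nonneg hnn) fun h => ?_
  have h0 := (integral_eq_zero_iff_of_nonneg hnn hk.integrable_sq).1 h.symm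
  have h1 : k =ᵐ[volume] 0 := by
    have hne : ∀ᵐ u : ℝ, u ≠ 0 := by simp [ae_iff]
    filter_upwards [h0, hne] with u hu hu0
    simpa [hu0] using hu
  have h2 := hk.integral_eq_one
  rw [integral_congr_ae h1] at h2
  simp at h2

lemma measurable_productKernel (hk : IsUnivariateKernel k) :
    Measurable (productKernel k : Regressor dI dC → ℝ) := by
  unfold productKernel
  exact Finset.measurable_prod _ fun q _ => hk.measurable.comp (measurable_pi_apply q)

lemma exists_isBump_productKernel (hk : IsUnivariateKernel k)
    (hK : HasCompactSupport (productKernel k : Regressor dI dC → ℝ)) :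
    ∃ R C, IsBump R C (productKernel k : Regressor dI dC → ℝ) := by
  obtain ⟨kbar, hkbar⟩ := hk.bounded
  obtain ⟨R, hR⟩ := hK.isCompact.isBounded.subset_closedBall 0
  refine ⟨R, ∏ _q : Fin dI ⊕ Fin dC, kbar, measurable_productKernel hk, fun u => ?_,
    fun u hu => ?_⟩
  · rw [productKernel, Finset.abs_prod]
    refine Finset.prod_le_prod (fun _ _ => abs_nonneg _) fun q _ => ?_
    rw [abs_of_nonneg (hk.nonneg _)]
    exact hkbar _
  · by_contra hne
    have := hR (subset_tsupport _ hne)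
    rw [mem_closedBall_zero_iff] at this
    linarith

/-- Fubini for product integrands; the choice of `w` produces the moments of K and its roughness. -/
lemma integral_prod_mul_kernel (w : Fin dI ⊕ Fin dC → ℝ → ℝ) :
    ∫ u : Regressor dI dC, productKernel k u * ∏ q, w q (u q) = ∏ q, ∫ s, k s * w q s := by
  simp only [productKernel, ← Finset.prod_mul_distrib]
  exact integral_fintype_prod_volume_eq_prod fun q s => k s * w q s

lemma integral_productKernel (hk : IsUnivariateKernel k) :
    ∫ u : Regressor dI dC, productKernel k u = 1 := by
  have := integral_prod_mul_kernel (k := k) (dI := dI) (dC := dC) fun _ _ => 1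
  simpa [hk.integral_eq_one] using this

lemma integral_productKernel_sq :
    ∫ u : Regressor dI dC, productKernel k u ^ 2 = kernelRoughness k ^ (dI + dC) := by
  have := integral_prod_mul_kernel (k := k) (dI := dI) (dC := dC) fun _ => k
  simpa [kernelRoughness, ← sq, productKernel] using this

lemma integral_productKernel_mul_apply (hk : IsUnivariateKernel k) (p : Fin dI ⊕ Fin dC) :
    ∫ u : Regressor dI dC, productKernel k u * u p = 0 := by
  have := integral_prod_mul_kernel (k := k) (dI := dI) (dC := dC) fun q s => if q = p then s else 1
  simp only [Finset.prod_ite_eq', Finset.mem_univ, if_true] at this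
  rw [this, Finset.prod_eq_zero (Finset.mem_univ p)]
  simp only [if_true, mul_comm (k _), hk.integral_id_mul]

lemma integral_productKernel_mul_apply_mul_apply (hk : IsUnivariateKernel k)
    (p q : Fin dI ⊕ Fin dC) :
    ∫ u : Regressor dI dC, productKernel k u * (u p * u q)
      = if p = q then kernelSecondMoment k else 0 := by
  have := integral_prod_mul_kernel (k := k) (dI := dI) (dC := dC)
    fun r s => (if r = p then s else 1) * (if r = q then s else 1)
  simp only [Finset.prod_mul_distrib, Finset.prod_ite_eq', Finset.mem_univ, if_true] at this
  rw [this]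
  split_ifs with hpq
  · subst hpq
    rw [Finset.prod_eq_single p]
    · simp only [if_true, kernelSecondMoment]
      congr with s
      ring
    · intro r _ hr
      simp [hr, hk.integral_eq_one]
    · simp
  · rw [Finset.prod_eq_zero (Finset.mem_univ p)]
    simp only [if_true, hpq, if_false, mul_one, mul_comm (k _), hk.integral_id_mul]

/-- The product `ψ(u₁, c) ψ(u₂, c)` as a function of `(u₁, u₂; c)`. -/
def pairProduct (ψ : Regressor dI dC → ℝ) (v : JointRegressor dI dC 2) : ℝ :=
  ψ (Sum.elim (v.1 0) v.2) * ψ (Sum.elim (v.1 1) v.2)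

/-- The two individual-level blocks integrate to 1 separately. The shared cluster block carries k
twice and contributes ∫ k² per coordinate. -/
lemma integral_pairProduct_productKernel (hk : IsUnivariateKernel k) :
    ∫ v, pairProduct (productKernel k : Regressor dI dC → ℝ) v = kernelRoughness k ^ dC := by
  have h1 : ∀ v : JointRegressor dI dC 2, pairProduct (productKernel k) v
      = (∏ i, ∏ q, k (v.1 i q)) * ∏ q, k (v.2 q) ^ 2 := by
    intro v
    simp only [pairProduct, productKernel, Fintype.prod_sum_type, Sum.elim_inl, Sum.elim_inr,
      Fin.prod_univ_two, Finset.prod_pow]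
    ring
  simp_rw [h1]
  rw [Measure.volume_eq_prod, integral_prod_mul (fun a : Fin 2 → Fin dI → ℝ => ∏ i, ∏ q, k (a i q))
    (fun c : Fin dC → ℝ => ∏ q, k (c q) ^ 2)]
  have h2 : ∫ a : Fin 2 → Fin dI → ℝ, ∏ i, ∏ q, k (a i q) = 1 := by
    rw [integral_fintype_prod_volume_eq_prod fun (_ : Fin 2) (b : Fin dI → ℝ) => ∏ q, k (b q)]
    refine Finset.prod_eq_one fun i _ => ?_
    rw [integral_fintype_prod_volume_eq_prod fun (_ : Fin dI) (s : ℝ) => k s]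
    simp [hk.integral_eq_one]
  have h3 : ∫ c : Fin dC → ℝ, ∏ q, k (c q) ^ 2 = kernelRoughness k ^ dC := by
    rw [integral_fintype_prod_volume_eq_prod fun (_ : Fin dC) (s : ℝ) => k s ^ 2]
    simp [kernelRoughness]
  rw [h2, h3, one_mul]

lemma measurable_sumElim (i : Fin 2) :
    Measurable fun v : JointRegressor dI dC 2 => (Sum.elim (v.1 i) v.2 : Regressor dI dC) := by
  refine measurable_pi_lambda _ fun q => ?_
  rcases q with q | q
  · exact (measurable_pi_apply q).comp ((measurable_pi_apply i).comp measurable_fst)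
  · exact (measurable_pi_apply q).comp measurable_snd

/-- If both factors are nonzero, every coordinate of (u₁, u₂; c) is at most R in absolute value. The
radius is `max R 0` because the sup-norm criterion needs a nonnegative bound. -/
lemma IsBump.pairProduct {R C : ℝ} {ψ : Regressor dI dC → ℝ} (hψ : IsBump R C ψ) :
    IsBump (max R 0) (C * C) (pairProduct ψ) where
  measurable := (hψ.measurable.comp (measurable_sumElim 0)).mul
    (hψ.measurable.comp (measurable_sumElim 1))
  bound v := by
    rw [_root_.pairProduct, abs_mul]
    exact mul_le_mul (hψ.bound _) (hψ.bound _) (abs_nonneg _)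
      ((abs_nonneg _).trans (hψ.bound 0))
  support v hv := by
    by_contra hne
    have h0 : ‖(Sum.elim (v.1 0) v.2 : Regressor dI dC)‖ ≤ R := by
      by_contra h
      exact hne (by rw [_root_.pairProduct, hψ.support _ (not_le.1 h), zero_mul])
    have h1 : ‖(Sum.elim (v.1 1) v.2 : Regressor dI dC)‖ ≤ R := by
      by_contra h
      exact hne (by rw [_root_.pairProduct, hψ.support _ (not_le.1 h), mul_zero])
    have hb : ∀ i : Fin 2, ‖(Sum.elim (v.1 i) v.2 : Regressor dI dC)‖ ≤ max R 0 := by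
      intro i
      fin_cases i
      · exact h0.trans (le_max_left _ _)
      · exact h1.trans (le_max_left _ _)
    refine absurd hv (not_lt.2 (norm_prod_le_iff.2 ⟨?_, ?_⟩))
    · refine (pi_norm_le_iff_of_nonneg (le_max_right _ _)).2 fun i =>
        (pi_norm_le_iff_of_nonneg (le_max_right _ _)).2 fun q => ?_
      exact (norm_le_pi_norm (Sum.elim (v.1 i) v.2 : Regressor dI dC) (Sum.inl q)).trans (hb i)
    · refine (pi_norm_le_iff_of_nonneg (le_max_right _ _)).2 fun q => ?_
      exact (norm_le_pi_norm (Sum.elim (v.1 0) v.2 : Regressor dI dC) (Sum.inr q)).trans (hb 0)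

end Kernel

/-! ### Moments under clustered sampling -/

section General

variable {Ω : Type*} [MeasurableSpace Ω] {P : Measure Ω} [IsProbabilityMeasure P]

omit [IsProbabilityMeasure P] in
lemma IsDensity.integral_eq {E : Type*} [MeasureSpace E] {ν : Measure E} {f : E → ℝ}
    (hf : IsDensity ν f) (F : E → ℝ) : ∫ z, F z ∂ν = ∫ z, F z * f z := by
  rw [hf.2.2, integral_withDensity_eq_integral_toReal_smul hf.1.ennreal_ofReal
    (ae_of_all _ fun _ => ENNReal.ofReal_lt_top)]
  congr with z
  rw [ENNReal.toReal_ofReal (hf.2.1 z), smul_eq_mul, mul_comm]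

/-- Disintegrate the joint law of (X, Z) along X. Measurability of φ is not needed, which matters
because the conditional variance and covariance functions are only known to be continuous near x. -/
lemma HasCondMean.integral_mul_eq {E : Type*} [MeasurableSpace E] {Z : Ω → ℝ} {X : Ω → E}
    {φ : E → ℝ} (h : HasCondMean P Z X φ) (hX : Measurable X) (hZ : Measurable Z) {ψ : E → ℝ}
    (hψ : Measurable ψ) (hint : Integrable (fun ω => ψ (X ω) * Z ω) P) :
    ∫ ω, ψ (X ω) * Z ω ∂P = ∫ z, ψ z * φ z ∂(P.map X) := by
  have hXZ : Measurable fun ω => (X ω, Z ω) := hX.prodMk hZ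
  have hF : Measurable fun p : E × ℝ => ψ p.1 * p.2 := (hψ.comp measurable_fst).mul measurable_snd
  have h1 : Integrable (fun p : E × ℝ => ψ p.1 * p.2) ((P.map X) ⊗ₘ condDistrib Z X P) := by
    rw [compProd_map_condDistrib hZ.aemeasurable,
      integrable_map_measure hF.aestronglyMeasurable hXZ.aemeasurable]
    exact hint
  have h2 : ∫ ω, ψ (X ω) * Z ω ∂P = ∫ p, ψ p.1 * p.2 ∂((P.map X) ⊗ₘ condDistrib Z X P) := by
    rw [compProd_map_condDistrib hZ.aemeasurable,
      integral_map hXZ.aemeasurable hF.aestronglyMeasurable]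
  rw [h2, Measure.integral_compProd h1]
  refine integral_congr_ae ?_
  filter_upwards [h] with z hz
  rw [integral_const_mul, hz.2]

/-- Variances of independent terms add, and a variance is at most the second moment. The terms will
be whole cluster totals, so dependence inside a cluster is unrestricted. -/
lemma integral_sq_sum_sub_le {ι : Type*} [Fintype ι] {X : ι → Ω → ℝ} (hind : iIndepFun X P)
    (hX : ∀ i, MemLp (X i) 2 P) :
    ∫ ω, (∑ i, X i ω - ∑ i, ∫ ω', X i ω' ∂P) ^ 2 ∂P ≤ ∑ i, ∫ ω, X i ω ^ 2 ∂P := by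
  have h1 := IndepFun.variance_sum (s := Finset.univ) (fun i _ => hX i)
    fun i _ j _ hij => hind.indepFun hij
  have h2 : variance (∑ i, X i) P = ∫ ω, (∑ i, X i ω - ∑ i, ∫ ω', X i ω' ∂P) ^ 2 ∂P := by
    rw [variance_eq_integral (memLp_finsetSum' _ fun i _ => hX i).aestronglyMeasurable.aemeasurable]
    simp only [Finset.sum_apply]
    rw [integral_finsetSum _ fun i _ => (hX i).integrable (by norm_num)]
  rw [← h2, h1]
  exact Finset.sum_le_sum fun i _ => variance_le_expectation_sq (hX i).aestronglyMeasurable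

lemma integral_sq_sum_eq {ι : Type*} [Fintype ι] {X : ι → Ω → ℝ} (hind : iIndepFun X P)
    (hX : ∀ i, MemLp (X i) 2 P) (hX0 : ∀ i, ∫ ω, X i ω ∂P = 0) :
    ∫ ω, (∑ i, X i ω) ^ 2 ∂P = ∑ i, ∫ ω, X i ω ^ 2 ∂P := by
  have h1 := IndepFun.variance_sum (s := Finset.univ) (fun i _ => hX i)
    fun i _ j _ hij => hind.indepFun hij
  have h2 : variance (∑ i, X i) P = ∫ ω, (∑ i, X i ω) ^ 2 ∂P := by
    rw [variance_of_integral_eq_zero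
      (memLp_finsetSum' _ fun i _ => hX i).aestronglyMeasurable.aemeasurable]
    · simp
    · simp only [Finset.sum_apply]
      rw [integral_finsetSum _ fun i _ => (hX i).integrable (by norm_num)]
      simp [hX0]
  rw [← h2, h1]
  refine Finset.sum_congr rfl fun i _ => ?_
  rw [variance_of_integral_eq_zero (hX i).aestronglyMeasurable.aemeasurable (hX0 i)]

omit [IsProbabilityMeasure P] in
lemma integral_sq_sum_exchangeable {n : ℕ} {a : Fin n → Ω → ℝ} (ha : ∀ j, MemLp (a j) 2 P)
    {A B : ℝ} (hA : ∀ j, ∫ ω, a j ω ^ 2 ∂P = A)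
    (hB : ∀ j l, j ≠ l → ∫ ω, a j ω * a l ω ∂P = B) :
    ∫ ω, (∑ j, a j ω) ^ 2 ∂P = n * A + n * (n - 1) * B := by
  have hint : ∀ j l, Integrable (fun ω => a j ω * a l ω) P := fun j l =>
    (ha j).integrable_mul (ha l)
  simp_rw [sq, Finset.sum_mul_sum]
  rw [integral_finsetSum _ fun j _ => integrable_finsetSum _ fun l _ => hint j l]
  have h1 : ∀ j : Fin n, ∫ ω, ∑ l, a j ω * a l ω ∂P = A + (n - 1) * B := by
    intro j
    rw [integral_finsetSum _ fun l _ => hint j l, ← Finset.add_sum_erase _ _ (Finset.mem_univ j)]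
    congr 1
    · rw [← hA j]; simp only [sq]
    · rw [Finset.sum_congr rfl fun l hl => hB j l (Finset.ne_of_mem_erase hl).symm]
      have hn : 1 ≤ n := j.pos
      simp [Nat.cast_sub hn]
  simp_rw [h1]
  simp
  ring

end General

/-! ### Local moments of the regressors in one sample -/

section Sample

variable {dI dC : ℕ} {Ω : Type*} [MeasurableSpace Ω] {P : Measure Ω} [IsProbabilityMeasure P]
  {S : ClusterSample dI dC Ω} {M : RegressionModel dI dC}

/-- The rescaled regressor `(X_{gj} - x) / h`. -/
noncomputable def ClusterSample.scaledX (S : ClusterSample dI dC Ω) (x : Regressor dI dC) (h : ℝ)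
    (g : Fin S.G) (j : Fin (S.size g)) (ω : Ω) : Regressor dI dC :=
  h⁻¹ • (S.X g j ω - x)

omit [MeasurableSpace Ω] in
lemma ClusterSample.X_eq (S : ClusterSample dI dC Ω) (x : Regressor dI dC) {h : ℝ} (hh : 0 < h)
    (g : Fin S.G) (j : Fin (S.size g)) (ω : Ω) : S.X g j ω = x + h • S.scaledX x h g j ω := by
  rw [ClusterSample.scaledX, smul_inv_smul₀ hh.ne', add_sub_cancel]

namespace ClusterDGP

lemma measurable_X (hD : ClusterDGP P S M) (g : Fin S.G) (j : Fin (S.size g)) :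
    Measurable (S.X g j) := by
  refine measurable_pi_lambda _ fun q => ?_
  rcases q with q | q
  · exact (measurable_pi_apply q).comp (hD.measurable_Xind g j)
  · exact (measurable_pi_apply q).comp (hD.measurable_Xcls g)

lemma measurable_clusterX (hD : ClusterDGP P S M) (g : Fin S.G) : Measurable (S.clusterX g) :=
  measurable_pi_lambda _ fun j => hD.measurable_X g j

lemma measurable_jointX (hD : ClusterDGP P S M) (g : Fin S.G) {k : ℕ}
    (j : Fin k → Fin (S.size g)) : Measurable (S.jointX g j) :=
  (measurable_pi_lambda _ fun i => hD.measurable_Xind g (j i)).prodMk (hD.measurable_Xcls g)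

lemma measurable_err (hD : ClusterDGP P S M) (g : Fin S.G) (j : Fin (S.size g)) :
    Measurable (S.err M g j) :=
  (hD.measurable_Y g j).sub (M.measurable_m.comp (hD.measurable_X g j))

lemma measurable_scaledX (hD : ClusterDGP P S M) (x : Regressor dI dC) (h : ℝ) (g : Fin S.G)
    (j : Fin (S.size g)) : Measurable (S.scaledX x h g j) :=
  ((hD.measurable_X g j).sub_const x).const_smul h⁻¹

lemma integral_scaledX (hD : ClusterDGP P S M) (x : Regressor dI dC) {h : ℝ} (hh : 0 < h)
    (g : Fin S.G) (j : Fin (S.size g)) {ψ G : Regressor dI dC → ℝ} (hψ : Measurable ψ)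
    (hG : Measurable G) :
    ∫ ω, ψ (S.scaledX x h g j ω) * G (S.X g j ω) ∂P
      = h ^ (dI + dC) * ∫ u, ψ u * (G (x + h • u) * M.f (x + h • u)) := by
  have h1 : Measurable fun z : Regressor dI dC => ψ (h⁻¹ • (z - x)) * G z :=
    (hψ.comp (by fun_prop)).mul hG
  have h2 := integral_map (hD.measurable_X g j).aemeasurable (μ := P) h1.aestronglyMeasurable
  rw [(hD.marginal_density g j).integral_eq] at h2
  have h3 := integral_rescale_mul volume hh x ψ fun z => G z * M.f z
  simp only [ClusterSample.scaledX]
  rw [← h2]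
  simp only [mul_assoc]
  rw [h3]
  simp

omit [MeasurableSpace Ω] in
lemma pairProduct_jointX (x : Regressor dI dC) (h : ℝ) (g : Fin S.G) (j l : Fin (S.size g))
    (ψ : Regressor dI dC → ℝ) (ω : Ω) :
    pairProduct ψ (h⁻¹ • (S.jointX g ![j, l] ω - diagPoint x))
      = ψ (S.scaledX x h g j ω) * ψ (S.scaledX x h g l ω) := by
  have h1 : ∀ i : Fin 2, (Sum.elim ((h⁻¹ • (S.jointX g ![j, l] ω - diagPoint x)).1 i)
      (h⁻¹ • (S.jointX g ![j, l] ω - diagPoint x)).2 : Regressor dI dC)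
      = S.scaledX x h g (![j, l] i) ω := by
    intro i
    funext q
    rcases q with q | q <;> simp [ClusterSample.scaledX, ClusterSample.jointX, ClusterSample.X,
      diagPoint]
  rw [pairProduct, h1, h1]
  rfl

instance isAddHaarMeasure_jointRegressor :
    (volume : Measure (JointRegressor dI dC 2)).IsAddHaarMeasure :=
  have : (volume : Measure (Fin 2 → Fin dI → ℝ)).IsAddHaarMeasure :=
    Measure.pi.isAddHaarMeasure fun _ => (volume : Measure (Fin dI → ℝ))
  Measure.prod.instIsAddHaarMeasure _ _

lemma finrank_jointRegressor_two : Module.finrank ℝ (JointRegressor dI dC 2) = 2 * dI + dC := by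
  simp [Module.finrank_prod, Module.finrank_pi_fintype]

/-- The shared cluster regressors are counted once, so a pair has local mass of order h^{2 d_ind +
d_cls}, larger by h^{-d_cls} than the h^{2d} of two independent observations. This excess keeps
within-cluster covariance in the limit. -/
lemma integral_scaledX_pair (hD : ClusterDGP P S M) (x : Regressor dI dC) {h : ℝ} (hh : 0 < h)
    (g : Fin S.G) {j l : Fin (S.size g)} (hjl : j ≠ l) {ψ : Regressor dI dC → ℝ}
    {G : JointRegressor dI dC 2 → ℝ} (hψ : Measurable ψ) (hG : Measurable G) :
    ∫ ω, ψ (S.scaledX x h g j ω) * ψ (S.scaledX x h g l ω) * G (S.jointX g ![j, l] ω) ∂P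
      = h ^ (2 * dI + dC) * ∫ v, pairProduct ψ v *
          (G (diagPoint x + h • v) * M.fJoint 2 (diagPoint x + h • v)) := by
  have hpair : Measurable (pairProduct ψ) :=
    (hψ.comp (measurable_sumElim 0)).mul (hψ.comp (measurable_sumElim 1))
  have h1 : Measurable fun z : JointRegressor dI dC 2 =>
      pairProduct ψ (h⁻¹ • (z - diagPoint x)) * G z :=
    (hpair.comp (show Measurable fun z : JointRegressor dI dC 2 => h⁻¹ • (z - diagPoint x) by
      fun_prop)).mul hG
  have hinj : Function.Injective ![j, l] := by
    intro a b hab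
    fin_cases a <;> fin_cases b <;> simp_all [eq_comm]
  have h2 := integral_map (hD.measurable_jointX g ![j, l]).aemeasurable (μ := P)
    h1.aestronglyMeasurable
  rw [(hD.joint_density 2 (by simp) g ![j, l] hinj).integral_eq] at h2
  have h3 := integral_rescale_mul volume hh (diagPoint x) (pairProduct ψ)
    fun z => G z * M.fJoint 2 z
  simp only [pairProduct_jointX] at h2
  rw [← h2]
  simp only [mul_assoc]
  rw [h3, finrank_jointRegressor_two]

lemma iIndepFun_cluster_sum (hD : ClusterDGP P S M) {φ : Regressor dI dC → ℝ → ℝ}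
    (hφ : Measurable (Function.uncurry φ)) :
    iIndepFun (fun (g : Fin S.G) ω => ∑ j, φ (S.X g j ω) (S.Y g j ω)) P := by
  refine hD.indep.comp (fun g v => ∑ j, φ (v j).2 (v j).1) fun g => ?_
  refine Finset.measurable_sum _ fun j _ => ?_
  exact hφ.comp ((measurable_snd.comp (measurable_pi_apply j)).prodMk
    (measurable_fst.comp (measurable_pi_apply j)))

/-! ### Local moments of the errors -/

section Errors

variable {x : Regressor dI dC} {N : Set (Regressor dI dC)} {h r v R C : ℝ}
  {ψ : Regressor dI dC → ℝ}

lemma lintegral_err_rpow_le (hD : ClusterDGP P S M) {g : Fin S.G} {j : Fin (S.size g)}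
    (hv : ∀ᵐ z ∂(P.map (S.X g j)), z ∈ N →
      ∫⁻ y, ENNReal.ofReal (|y| ^ (2 * r)) ∂(condDistrib (S.err M g j) (S.X g j) P z)
        ≤ ENNReal.ofReal (v ^ 2))
    {A : Set (Regressor dI dC)} (hA : MeasurableSet A) (hAN : A ⊆ N) :
    ∫⁻ ω, A.indicator 1 (S.X g j ω) * ENNReal.ofReal (|S.err M g j ω| ^ (2 * r)) ∂P
      ≤ ENNReal.ofReal (v ^ 2) * (P.map (S.X g j)) A := by
  have hF : Measurable fun p : Regressor dI dC × ℝ =>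
      A.indicator (1 : Regressor dI dC → ENNReal) p.1 * ENNReal.ofReal (|p.2| ^ (2 * r)) :=
    ((measurable_one.indicator hA).comp measurable_fst).mul
      ((measurable_snd.abs.pow_const _).ennreal_ofReal)
  have hXZ : Measurable fun ω => (S.X g j ω, S.err M g j ω) :=
    (hD.measurable_X g j).prodMk (hD.measurable_err g j)
  have h1 := lintegral_map (μ := P) hF hXZ
  rw [← h1, ← compProd_map_condDistrib (hD.measurable_err g j).aemeasurable,
    Measure.lintegral_compProd hF]
  calc _ ≤ ∫⁻ z, A.indicator (fun _ => ENNReal.ofReal (v ^ 2)) z ∂(P.map (S.X g j)) := by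
        refine lintegral_mono_ae ?_
        filter_upwards [hv] with z hz
        by_cases hzA : z ∈ A
        · simpa [hzA] using hz (hAN hzA)
        · simp [hzA]
    _ = _ := by rw [lintegral_indicator_const hA]

/-- Since |e|^p ≤ 1 + |e|^{2r} for 0 < p ≤ 2r, the single moment hypothesis serves both p = 2 and p
= r. The factor h^d is the probability that the regressor falls in the ball of radius hR around x.
-/
lemma integrable_rpow_bump_mul_err (hD : ClusterDGP P S M) (hh : 0 < h) {g : Fin S.G}
    {j : Fin (S.size g)} (hψ : IsBump R C ψ) (hball : ∀ u, ‖u‖ ≤ R → x + h • u ∈ N)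
    (hv : ∀ᵐ z ∂(P.map (S.X g j)), z ∈ N →
      ∫⁻ y, ENNReal.ofReal (|y| ^ (2 * r)) ∂(condDistrib (S.err M g j) (S.X g j) P z)
        ≤ ENNReal.ofReal (v ^ 2)) {p : ℝ} (hp : 0 < p) (hpr : p ≤ 2 * r) :
    Integrable (fun ω => |ψ (S.scaledX x h g j ω) * S.err M g j ω| ^ p) P ∧
    ∫ ω, |ψ (S.scaledX x h g j ω) * S.err M g j ω| ^ p ∂P
      ≤ C ^ p * (1 + v ^ 2) * (h ^ (dI + dC) *
        ∫ u, (Metric.closedBall (0 : Regressor dI dC) R).indicator (fun _ => (1 : ℝ)) u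
          * M.f (x + h • u)) := by
  have hC : 0 ≤ C := (abs_nonneg _).trans (hψ.bound 0)
  set A : Set (Regressor dI dC) :=
    (fun z => h⁻¹ • (z - x)) ⁻¹' Metric.closedBall (0 : Regressor dI dC) R with hAdef
  have hA : MeasurableSet A :=
    (show Measurable fun z : Regressor dI dC => h⁻¹ • (z - x) by fun_prop)
      Metric.isClosed_closedBall.measurableSet
  have hAN : A ⊆ N := by
    intro z hz
    have := hball (h⁻¹ • (z - x)) (by simpa [hAdef] using hz)
    rwa [smul_inv_smul₀ hh.ne', add_sub_cancel] at this
  have hm : Measurable fun ω => |ψ (S.scaledX x h g j ω) * S.err M g j ω| ^ p :=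
    (((hψ.measurable.comp (hD.measurable_scaledX x h g j)).mul
      (hD.measurable_err g j)).abs).pow_const p
  have hpt : ∀ ω, ENNReal.ofReal (|ψ (S.scaledX x h g j ω) * S.err M g j ω| ^ p)
      ≤ ENNReal.ofReal (C ^ p) * (A.indicator 1 (S.X g j ω)
        + A.indicator 1 (S.X g j ω) * ENNReal.ofReal (|S.err M g j ω| ^ (2 * r))) := by
    intro ω
    by_cases hω : S.X g j ω ∈ A
    · simp only [Set.indicator_of_mem hω, Pi.one_apply, one_mul]
      rw [← ENNReal.ofReal_one, ← ENNReal.ofReal_add zero_le_one (by positivity),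
        ← ENNReal.ofReal_mul (by positivity)]
      refine ENNReal.ofReal_le_ofReal ?_
      rw [abs_mul, Real.mul_rpow (abs_nonneg _) (abs_nonneg _)]
      have h1 : |S.err M g j ω| ^ p ≤ 1 + |S.err M g j ω| ^ (2 * r) := by
        rcases le_total |S.err M g j ω| 1 with h1 | h1
        · exact (Real.rpow_le_one (abs_nonneg _) h1 hp.le).trans
            (le_add_of_nonneg_right (by positivity))
        · exact (Real.rpow_le_rpow_of_exponent_le h1 hpr).trans
            (le_add_of_nonneg_left zero_le_one)
      gcongr
      exact hψ.bound _
    · have : ψ (S.scaledX x h g j ω) = 0 := by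
        refine hψ.support _ ?_
        simpa [hAdef, ClusterSample.scaledX] using hω
      simp [this, Real.zero_rpow hp.ne']
  have hPA : ∫⁻ ω, A.indicator (1 : Regressor dI dC → ENNReal) (S.X g j ω) ∂P
      = (P.map (S.X g j)) A := by
    rw [← lintegral_map (f := A.indicator 1) (measurable_one.indicator hA) (hD.measurable_X g j),
      lintegral_indicator_one hA]
  have hlin : ∫⁻ ω, ENNReal.ofReal (|ψ (S.scaledX x h g j ω) * S.err M g j ω| ^ p) ∂P
      ≤ ENNReal.ofReal (C ^ p * (1 + v ^ 2)) * (P.map (S.X g j)) A := by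
    refine (lintegral_mono hpt).trans ?_
    have hind : Measurable fun ω => A.indicator (1 : Regressor dI dC → ENNReal) (S.X g j ω) :=
      (measurable_one.indicator hA).comp (hD.measurable_X g j)
    rw [lintegral_const_mul' _ _ ENNReal.ofReal_ne_top, lintegral_add_left hind, hPA]
    rw [ENNReal.ofReal_mul (by positivity), mul_assoc, ENNReal.ofReal_add zero_le_one
      (sq_nonneg v), add_mul, ENNReal.ofReal_one, one_mul]
    gcongr
    exact hD.lintegral_err_rpow_le hv hA hAN
  have hmapP : IsProbabilityMeasure (P.map (S.X g j)) :=
    Measure.isProbabilityMeasure_map (hD.measurable_X g j).aemeasurable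
  have hint : Integrable (fun ω => |ψ (S.scaledX x h g j ω) * S.err M g j ω| ^ p) P := by
    refine ⟨hm.aestronglyMeasurable, ?_⟩
    rw [hasFiniteIntegral_iff_ofReal (ae_of_all _ fun ω => by positivity)]
    exact hlin.trans_lt (ENNReal.mul_lt_top ENNReal.ofReal_lt_top (measure_lt_top _ _))
  refine ⟨hint, ?_⟩
  have hreal : (P.map (S.X g j)).real A = h ^ (dI + dC) *
        ∫ u, (Metric.closedBall (0 : Regressor dI dC) R).indicator (fun _ => (1 : ℝ)) u
          * M.f (x + h • u) := by
    have h1 := hD.integral_scaledX x hh g j (isBump_indicator_closedBall R).measurable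
      (measurable_const (a := (1 : ℝ)))
    simp only [mul_one, one_mul] at h1
    rw [← h1, ← integral_indicator_one hA, integral_map (hD.measurable_X g j).aemeasurable
      (measurable_one.indicator hA).aestronglyMeasurable]
    rfl
  rw [← hreal, integral_eq_lintegral_of_nonneg_ae (ae_of_all _ fun ω => by positivity)
    hm.aestronglyMeasurable]
  refine ENNReal.toReal_le_of_le_ofReal (by positivity) ?_
  rw [ENNReal.ofReal_mul (by positivity), ofReal_measureReal]
  exact hlin

lemma memLp_bump_mul_err (hD : ClusterDGP P S M) (hh : 0 < h) {g : Fin S.G}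
    {j : Fin (S.size g)} (hψ : IsBump R C ψ) (hball : ∀ u, ‖u‖ ≤ R → x + h • u ∈ N)
    (hr : 2 ≤ r)
    (hv : ∀ᵐ z ∂(P.map (S.X g j)), z ∈ N →
      ∫⁻ y, ENNReal.ofReal (|y| ^ (2 * r)) ∂(condDistrib (S.err M g j) (S.X g j) P z)
        ≤ ENNReal.ofReal (v ^ 2)) :
    MemLp (fun ω => ψ (S.scaledX x h g j ω) * S.err M g j ω) 2 P := by
  have hm : Measurable fun ω => ψ (S.scaledX x h g j ω) * S.err M g j ω :=
    (hψ.measurable.comp (hD.measurable_scaledX x h g j)).mul (hD.measurable_err g j)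
  rw [memLp_two_iff_integrable_sq hm.aestronglyMeasurable]
  have := (hD.integrable_rpow_bump_mul_err hh hψ hball hv (p := 2) two_pos (by linarith)).1
  simpa only [Real.rpow_ofNat, sq_abs] using this

lemma integral_bump_mul_err (hD : ClusterDGP P S M) {g : Fin S.G} {j : Fin (S.size g)}
    (hψ : Measurable ψ)
    (hL : MemLp (fun ω => ψ (S.scaledX x h g j ω) * S.err M g j ω) 2 P) :
    ∫ ω, ψ (S.scaledX x h g j ω) * S.err M g j ω ∂P = 0 := by
  have := (hD.cond_mean g j).integral_mul_eq (hD.measurable_clusterX g) (hD.measurable_err g j)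
    (ψ := fun z => ψ (h⁻¹ • (z j - x))) (hψ.comp (by fun_prop)) (hL.integrable (by norm_num))
  simpa using! this

/-- `M.condVar` may fail to be measurable off N. Truncating it to the open set N, where it is
continuous, makes it Borel and changes nothing where ψ is nonzero. -/
lemma integral_sq_bump_mul_err (hD : ClusterDGP P S M) (hh : 0 < h) (hN : IsOpen N)
    (hc : ContinuousOn M.condVar N) {g : Fin S.G} {j : Fin (S.size g)} (hψ : IsBump R C ψ)
    (hball : ∀ u, ‖u‖ ≤ R → x + h • u ∈ N)
    (hL : MemLp (fun ω => ψ (S.scaledX x h g j ω) * S.err M g j ω) 2 P) :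
    ∫ ω, (ψ (S.scaledX x h g j ω) * S.err M g j ω) ^ 2 ∂P
      = h ^ (dI + dC) * ∫ u, ψ u * ψ u *
          (N.indicator M.condVar (x + h • u) * M.f (x + h • u)) := by
  have hG : Measurable (N.indicator M.condVar) := by
    classical
    rw [← Set.piecewise_eq_indicator]
    exact hc.measurable_piecewise continuousOn_const hN.measurableSet
  have hψm : Measurable fun z : Fin (S.size g) → Regressor dI dC => ψ (h⁻¹ • (z j - x)) :=
    hψ.measurable.comp (by fun_prop)
  have h1 := (hD.cond_var g j).integral_mul_eq (hD.measurable_clusterX g)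
    ((hD.measurable_err g j).pow_const 2)
    (ψ := fun z => ψ (h⁻¹ • (z j - x)) * ψ (h⁻¹ • (z j - x))) (hψm.mul hψm)
    (hL.integrable_sq.congr (ae_of_all _ fun ω => by
      simp only [ClusterSample.scaledX, ClusterSample.clusterX]; ring))
  have h2 : ∀ z : Fin (S.size g) → Regressor dI dC,
      ψ (h⁻¹ • (z j - x)) * ψ (h⁻¹ • (z j - x)) * M.condVar (z j)
        = ψ (h⁻¹ • (z j - x)) * ψ (h⁻¹ • (z j - x)) * N.indicator M.condVar (z j) := by
    intro z
    by_cases hz : ‖h⁻¹ • (z j - x)‖ ≤ R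
    · have := hball _ hz
      rw [smul_inv_smul₀ hh.ne', add_sub_cancel] at this
      rw [Set.indicator_of_mem this]
    · rw [hψ.support _ (not_le.1 hz)]
      simp
  simp only [h2] at h1
  have hF : Measurable fun z : Fin (S.size g) → Regressor dI dC =>
      ψ (h⁻¹ • (z j - x)) * ψ (h⁻¹ • (z j - x)) * N.indicator M.condVar (z j) :=
    (hψm.mul hψm).mul (hG.comp (measurable_pi_apply j))
  rw [integral_map (hD.measurable_clusterX g).aemeasurable hF.aestronglyMeasurable] at h1
  refine Eq.trans ?_ (hD.integral_scaledX x hh g j (hψ.measurable.mul hψ.measurable) hG)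
  refine Eq.trans (integral_congr_ae (ae_of_all _ fun ω => ?_)) h1
  simp only [ClusterSample.scaledX, ClusterSample.clusterX]
  ring

omit [MeasurableSpace Ω] in
lemma isOpen_jointNhd (hN : IsOpen N) (k : ℕ) : IsOpen (jointNhd N k) := by
  have : jointNhd N k = ⋂ i : Fin k,
      (fun z : JointRegressor dI dC k => (Sum.elim (z.1 i) z.2 : Regressor dI dC)) ⁻¹' N := by
    ext z
    simp [jointNhd]
  rw [this]
  refine isOpen_iInter_of_finite fun i => hN.preimage ?_
  refine continuous_pi fun q => ?_
  rcases q with q | q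
  · simp only [Sum.elim_inl]; fun_prop
  · simp only [Sum.elim_inr]; fun_prop

lemma integral_bump_mul_err_pair (hD : ClusterDGP P S M) (hh : 0 < h) (hN : IsOpen N)
    (hc : ContinuousOn M.condCov (jointNhd N 2)) {g : Fin S.G} {j l : Fin (S.size g)}
    (hjl : j ≠ l) (hψ : IsBump R C ψ) (hball : ∀ u, ‖u‖ ≤ R → x + h • u ∈ N)
    (hL : ∀ j, MemLp (fun ω => ψ (S.scaledX x h g j ω) * S.err M g j ω) 2 P) :
    ∫ ω, (ψ (S.scaledX x h g j ω) * S.err M g j ω) * (ψ (S.scaledX x h g l ω) * S.err M g l ω) ∂P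
      = h ^ (2 * dI + dC) * ∫ v, pairProduct ψ v *
          ((jointNhd N 2).indicator M.condCov (diagPoint x + h • v)
            * M.fJoint 2 (diagPoint x + h • v)) := by
  have hG : Measurable ((jointNhd N 2).indicator M.condCov) := by
    classical
    rw [← Set.piecewise_eq_indicator]
    exact hc.measurable_piecewise continuousOn_const (isOpen_jointNhd hN 2).measurableSet
  have hψm : ∀ j, Measurable fun z : Fin (S.size g) → Regressor dI dC =>
      ψ (h⁻¹ • (z j - x)) := fun j => hψ.measurable.comp (by fun_prop)
  set J : (Fin (S.size g) → Regressor dI dC) → JointRegressor dI dC 2 :=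
    fun z => (![z j ∘ Sum.inl, z l ∘ Sum.inl], z j ∘ Sum.inr) with hJ
  have hJm : Measurable J := by
    refine Measurable.prodMk (measurable_pi_lambda _ fun i => measurable_pi_lambda _ fun q => ?_)
      (measurable_pi_lambda _ fun q => ?_)
    · fin_cases i
      · exact (measurable_pi_apply (Sum.inl q)).comp (measurable_pi_apply j)
      · exact (measurable_pi_apply (Sum.inl q)).comp (measurable_pi_apply l)
    · exact (measurable_pi_apply (Sum.inr q)).comp (measurable_pi_apply j)
  have hJX : ∀ ω, J (S.clusterX g ω) = S.jointX g ![j, l] ω := by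
    intro ω
    refine Prod.ext (funext fun i => ?_) rfl
    fin_cases i <;> rfl
  have h1 := (hD.cond_cov g j l hjl).integral_mul_eq (hD.measurable_clusterX g)
    ((hD.measurable_err g j).mul (hD.measurable_err g l))
    (ψ := fun z => ψ (h⁻¹ • (z j - x)) * ψ (h⁻¹ • (z l - x))) ((hψm j).mul (hψm l))
    (((hL j).integrable_mul (hL l)).congr (ae_of_all _ fun ω => by
      simp only [Pi.mul_apply, ClusterSample.scaledX, ClusterSample.clusterX]; ring))
  -- `J` reads the cluster coordinates from z_j alone. Membership in `jointNhd` also needs them to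
  -- be those of z_l, which holds almost surely under the law of the cluster regressors.
  have hae : ∀ᵐ z ∂(P.map (S.clusterX g)), z j ∘ Sum.inr = z l ∘ Sum.inr := by
    refine (ae_map_iff (hD.measurable_clusterX g).aemeasurable
      (measurableSet_eq_fun ?_ ?_)).2 (ae_of_all _ fun ω => rfl)
    · exact measurable_pi_lambda _ fun q => by simp only [Function.comp]; fun_prop
    · exact measurable_pi_lambda _ fun q => by simp only [Function.comp]; fun_prop
  have h2 : ∀ᵐ z ∂(P.map (S.clusterX g)),
      ψ (h⁻¹ • (z j - x)) * ψ (h⁻¹ • (z l - x)) * M.condCov (J z)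
        = ψ (h⁻¹ • (z j - x)) * ψ (h⁻¹ • (z l - x)) * (jointNhd N 2).indicator M.condCov (J z) := by
    filter_upwards [hae] with z hz
    have hmem : ∀ i, ‖h⁻¹ • (z i - x)‖ ≤ R → z i ∈ N := by
      intro i hi
      have := hball _ hi
      rwa [smul_inv_smul₀ hh.ne', add_sub_cancel] at this
    by_cases hj : ‖h⁻¹ • (z j - x)‖ ≤ R
    · by_cases hl : ‖h⁻¹ • (z l - x)‖ ≤ R
      · rw [Set.indicator_of_mem]
        intro i
        fin_cases i
        · simpa [hJ] using hmem j hj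
        · simpa [hJ, hz] using hmem l hl
      · rw [hψ.support _ (not_le.1 hl)]
        simp
    · rw [hψ.support _ (not_le.1 hj)]
      simp
  have hF : Measurable fun z : Fin (S.size g) → Regressor dI dC =>
      ψ (h⁻¹ • (z j - x)) * ψ (h⁻¹ • (z l - x)) * (jointNhd N 2).indicator M.condCov (J z) :=
    ((hψm j).mul (hψm l)).mul (hG.comp hJm)
  rw [integral_congr_ae h2, integral_map (hD.measurable_clusterX g).aemeasurable
    hF.aestronglyMeasurable] at h1
  rw [← hD.integral_scaledX_pair x hh g hjl hψ.measurable hG]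
  simp only [hJX] at h1
  refine Eq.trans (integral_congr_ae (ae_of_all _ fun ω => ?_)) h1
  simp only [ClusterSample.scaledX, ClusterSample.clusterX]
  ring

end Errors

end ClusterDGP

end Sample

/-! ### Limit theorems for local averages -/

section SingleSample

variable {Ω : Type*} [MeasurableSpace Ω] {P : Measure Ω}

/-- The power-mean inequality bounds the r-th power of a cluster total with no assumption on the
dependence inside the cluster. Its price n_g^r is why ∑ n_g^r must be controlled. -/
lemma integrable_rpow_sum {n : ℕ} {a : Fin n → Ω → ℝ} {r D : ℝ} (hr : 1 ≤ r)
    (ha : ∀ j, AEStronglyMeasurable (a j) P) (hint : ∀ j, Integrable (fun ω => |a j ω| ^ r) P)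
    (hD : ∀ j, ∫ ω, |a j ω| ^ r ∂P ≤ D) (c : ℝ) :
    Integrable (fun ω => |c * ∑ j, a j ω| ^ r) P ∧
      ∫ ω, |c * ∑ j, a j ω| ^ r ∂P ≤ |c| ^ r * ((n : ℝ) ^ r * D) := by
  have hr0 : 0 < r := one_pos.trans_le hr
  rcases Nat.eq_zero_or_pos n with rfl | hn
  · simp [Real.zero_rpow hr0.ne']
  have hn' : (0 : ℝ) < n := Nat.cast_pos.2 hn
  have hle : ∀ ω, |c * ∑ j, a j ω| ^ r ≤ |c| ^ r * ((n : ℝ) ^ (r - 1) * ∑ j, |a j ω| ^ r) := by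
    intro ω
    rw [abs_mul, Real.mul_rpow (abs_nonneg _) (abs_nonneg _)]
    gcongr
    have h1 := Real.rpow_sum_le_const_mul_sum_rpow Finset.univ (fun j => a j ω) hr
    rw [Finset.card_univ, Fintype.card_fin] at h1
    exact (Real.rpow_le_rpow (abs_nonneg _) (Finset.abs_sum_le_sum_abs _ _) hr0.le).trans h1
  have hI : Integrable (fun ω => |c| ^ r * ((n : ℝ) ^ (r - 1) * ∑ j, |a j ω| ^ r)) P :=
    ((integrable_finsetSum _ fun j _ => hint j).const_mul _).const_mul _
  have hm : AEStronglyMeasurable (fun ω => |c * ∑ j, a j ω| ^ r) P := by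
    have h1 : AEStronglyMeasurable (fun ω => c * ∑ j, a j ω) P :=
      (Finset.aestronglyMeasurable_fun_sum _ fun j _ => ha j).const_mul c
    exact (h1.aemeasurable.abs.pow_const r).aestronglyMeasurable
  have hint' : Integrable (fun ω => |c * ∑ j, a j ω| ^ r) P := by
    refine hI.mono' hm (ae_of_all _ fun ω => ?_)
    rw [Real.norm_of_nonneg (by positivity)]
    exact hle ω
  refine ⟨hint', (integral_mono hint' hI hle).trans ?_⟩
  rw [integral_const_mul, integral_const_mul, integral_finsetSum _ fun j _ => hint j]
  refine mul_le_mul_of_nonneg_left ?_ (by positivity)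
  calc _ ≤ (n : ℝ) ^ (r - 1) * ∑ _j : Fin n, D :=
        mul_le_mul_of_nonneg_left (Finset.sum_le_sum fun j _ => hD j) (by positivity)
    _ = (n : ℝ) ^ r * D := by
        rw [Finset.sum_const, Finset.card_univ, Fintype.card_fin, nsmul_eq_mul, ← mul_assoc]
        congr 1
        rw [Real.rpow_sub_one hn'.ne', div_mul_cancel₀ _ hn'.ne']

lemma measurable_indicator_of_continuousOn {E : Type*} [TopologicalSpace E] [MeasurableSpace E]
    [OpensMeasurableSpace E] {s : Set E} (hs : IsOpen s) {f : E → ℝ} (hf : ContinuousOn f s) :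
    Measurable (s.indicator f) := by
  classical
  rw [← Set.piecewise_eq_indicator]
  exact hf.measurable_piecewise continuousOn_const hs.measurableSet

variable {dI dC : ℕ} {S : ClusterSample dI dC Ω}

/-- The average number `n⁻¹ ∑_g n_g (n_g - 1)` of within-cluster neighbours, times `h ^ dI`. -/
noncomputable def pairRate (S : ClusterSample dI dC Ω) (h : ℝ) : ℝ :=
  (∑ g, (S.size g : ℝ) * (S.size g - 1)) * h ^ dI / S.n

/-- Because h^{2 d_ind + d_cls} = h^d h^{d_ind}, factoring out n h^d leaves exactly `pairRate` in
front of the cross term. -/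
lemma sum_integral_sq_cluster {a : ∀ g : Fin S.G, Fin (S.size g) → Ω → ℝ}
    (ha : ∀ g j, MemLp (a g j) 2 P) {h A B : ℝ} (hn : 0 < S.n)
    (hA : ∀ g j, ∫ ω, a g j ω ^ 2 ∂P = h ^ (dI + dC) * A)
    (hB : ∀ g j l, j ≠ l → ∫ ω, a g j ω * a g l ω ∂P = h ^ (2 * dI + dC) * B) (c : ℝ) :
    ∑ g, ∫ ω, (c * ∑ j, a g j ω) ^ 2 ∂P
      = c ^ 2 * (S.n * h ^ (dI + dC)) * (A + pairRate S h * B) := by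
  have hn' : (S.n : ℝ) ≠ 0 := Nat.cast_ne_zero.2 hn.ne'
  have h1 : ∀ g, ∫ ω, (c * ∑ j, a g j ω) ^ 2 ∂P = c ^ 2 * (S.size g * (h ^ (dI + dC) * A)
      + (S.size g : ℝ) * (S.size g - 1) * (h ^ (2 * dI + dC) * B)) := by
    intro g
    simp only [mul_pow]
    rw [integral_const_mul, integral_sq_sum_exchangeable (ha g) (hA g) (hB g)]
  simp_rw [h1]
  rw [← Finset.mul_sum, Finset.sum_add_distrib, ← Finset.sum_mul, ← Finset.sum_mul, pairRate]
  have h2 : ∑ g, (S.size g : ℝ) = S.n := by simp [ClusterSample.n]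
  rw [h2, mul_assoc]
  congr 1
  field_simp
  ring

end SingleSample

/-! ### Law of large numbers for local averages -/

section Asymptotic

variable {dI dC : ℕ} {Ω : ℕ → Type*} {S : ∀ t, ClusterSample dI dC (Ω t)} {h : ℕ → ℝ}

lemma BandwidthCondition.eventually_n_pos (hh : BandwidthCondition S h) :
    ∀ᶠ t in atTop, 0 < (S t).n := by
  filter_upwards [hh.effective_size.eventually (eventually_gt_atTop 0)] with t ht
  by_contra hn
  rw [Nat.eq_zero_of_not_pos hn] at ht
  simp at ht

/-- Passing from n_g² to n_g(n_g - 1) costs h^{d_ind}, which vanishes because d_ind ≥ 1. -/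
lemma BandwidthCondition.tendsto_pairRate (hh : BandwidthCondition S h) (hdI : 1 ≤ dI) {lam : ℝ}
    (hlam : ClusterSizeLimit S h lam) :
    Tendsto (fun t => pairRate (S t) (h t)) atTop (𝓝 lam) := by
  have h1 : Tendsto (fun t => h t ^ dI) atTop (𝓝 0) := by
    simpa [Nat.one_le_iff_ne_zero.1 hdI] using hh.tendsto_zero.pow dI
  have h2 := Tendsto.sub hlam h1
  rw [sub_zero] at h2
  refine h2.congr' ?_
  filter_upwards [hh.eventually_n_pos] with t ht
  have hn' : ((S t).n : ℝ) ≠ 0 := Nat.cast_ne_zero.2 ht.ne'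
  have h3 : ∑ g, ((S t).size g : ℝ) * ((S t).size g - 1)
      = ∑ g, ((S t).size g : ℝ) ^ 2 - (S t).n := by
    have h4 : ∑ g, ((S t).size g : ℝ) = (S t).n := by simp [ClusterSample.n]
    rw [← h4, ← Finset.sum_sub_distrib]
    exact Finset.sum_congr rfl fun g _ => by ring
  rw [pairRate, h3]
  field_simp

variable [∀ t, MeasurableSpace (Ω t)] {P : ∀ t, Measure (Ω t)} [∀ t, IsProbabilityMeasure (P t)]
  {M : RegressionModel dI dC} {x : Regressor dI dC} {N : Set (Regressor dI dC)} {lam : ℝ}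

/-- Measurability of f is asserted only through an observation, so some sample must be shown
nonempty. -/
lemma ClusterDGP.measurable_density (hD : ∀ t, ClusterDGP (P t) (S t) M)
    (hh : BandwidthCondition S h) : Measurable M.f := by
  obtain ⟨t, ht⟩ := hh.eventually_n_pos.exists
  have hG : 0 < (S t).G := by
    by_contra h0
    have : IsEmpty (Fin (S t).G) := by
      rw [Nat.eq_zero_of_not_pos h0]; infer_instance
    simp [ClusterSample.n] at ht
  exact ((hD t).marginal_density ⟨0, hG⟩ ⟨0, (S t).size_pos _⟩).1

omit [∀ t, MeasurableSpace (Ω t)] in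
lemma diagPoint_mem_jointNhd (hx : x ∈ N) : diagPoint x ∈ jointNhd N 2 := by
  intro i
  simpa [diagPoint] using hx

/-- The law of large numbers for kernel-weighted local averages of the regressors. -/
theorem tendstoInProb_localAverage (hD : ∀ t, ClusterDGP (P t) (S t) M)
    (hh : BandwidthCondition S h)
    (hrate : Tendsto (fun t => pairRate (S t) (h t)) atTop (𝓝 lam)) (hN : IsOpen N) (hx : x ∈ N)
    (hs : SmoothnessCondition M x N) {R C : ℝ} {ψ : ℕ → Regressor dI dC → ℝ}
    {φ : Regressor dI dC → ℝ} (hψ : ∀ᶠ t in atTop, IsBump R C (ψ t))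
    (hlim : ∀ u, Tendsto (fun t => ψ t u) atTop (𝓝 (φ u))) :
    TendstoInProb P (fun t ω => (((S t).n : ℝ) * h t ^ (dI + dC))⁻¹ *
      ∑ g, ∑ j, ψ t ((S t).scaledX x (h t) g j ω)) (M.f x * ∫ u, φ u) := by
  have hfm := ClusterDGP.measurable_density hD hh
  have hf : ContinuousAt M.f x := hs.contDiff_f.continuousOn.continuousAt (hN.mem_nhds hx)
  have hN2 := ClusterDGP.isOpen_jointNhd hN 2
  have hx2 := diagPoint_mem_jointNhd hx
  set G : JointRegressor dI dC 2 → ℝ := (jointNhd N 2).indicator 1 with hG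
  have hGm : Measurable G := measurable_one.indicator hN2.measurableSet
  have hGf : (fun z => G z * M.fJoint 2 z) = (jointNhd N 2).indicator (M.fJoint 2) := by
    funext z
    by_cases hz : z ∈ jointNhd N 2 <;> simp [hG, hz]
  have hGfm : Measurable fun z => G z * M.fJoint 2 z := by
    rw [hGf]
    exact measurable_indicator_of_continuousOn hN2 hs.contDiff_f2.continuousOn
  have hGfc : ContinuousAt (fun z => G z * M.fJoint 2 z) (diagPoint x) := by
    refine (hs.contDiff_f2.continuousOn.continuousAt (hN2.mem_nhds hx2)).congr ?_
    filter_upwards [hN2.mem_nhds hx2] with z hz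
    simp [hG, hz]
  have hmean := tendsto_integral_bump_mul (μ := volume) hh.tendsto_zero hfm hf hψ hlim
  have hI1 := tendsto_integral_bump_mul (μ := volume) hh.tendsto_zero hfm hf
    (hψ.mono fun t ht => ht.mul ht) fun u => (hlim u).mul (hlim u)
  have hI2 := tendsto_integral_bump_mul (μ := volume) hh.tendsto_zero hGfm hGfc
    (hψ.mono fun t ht => ht.pairProduct)
    fun v => (hlim (Sum.elim (v.1 0) v.2)).mul (hlim (Sum.elim (v.1 1) v.2))
  have hball := eventually_forall_norm_le_rescale hh.tendsto_zero (hN.mem_nhds hx) R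
  -- The second moment about the mean is at most (n h^d)⁻¹ times a convergent quantity, so it
  -- vanishes. The trailing `- 0` matches `TendstoInProb.of_sq` at the constant 0.
  have key : ∀ᶠ t in atTop, Integrable (fun ω => ((((S t).n : ℝ) * h t ^ (dI + dC))⁻¹ *
      ∑ g, ∑ j, ψ t ((S t).scaledX x (h t) g j ω)
        - (∫ u, ψ t u * M.f (x + h t • u)) - 0) ^ 2) (P t) ∧
      ∫ ω, ((((S t).n : ℝ) * h t ^ (dI + dC))⁻¹ *
      ∑ g, ∑ j, ψ t ((S t).scaledX x (h t) g j ω)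
        - (∫ u, ψ t u * M.f (x + h t • u)) - 0) ^ 2 ∂(P t)
      ≤ (((S t).n : ℝ) * h t ^ (dI + dC))⁻¹ * ((∫ u, ψ t u * ψ t u * M.f (x + h t • u))
        + pairRate (S t) (h t) * ∫ v, pairProduct (ψ t) v *
          (G (diagPoint x + h t • v) * M.fJoint 2 (diagPoint x + h t • v))) := by
    filter_upwards [hh.eventually_n_pos, hψ, hball] with t hn hψt hb
    have hpos := hh.pos t
    have hn' : (0 : ℝ) < (S t).n := Nat.cast_pos.2 hn
    set c : ℝ := (((S t).n : ℝ) * h t ^ (dI + dC))⁻¹ with hc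
    have hc0 : ((S t).n : ℝ) * h t ^ (dI + dC) ≠ 0 := by positivity
    have hL : ∀ g j, MemLp (fun ω => ψ t ((S t).scaledX x (h t) g j ω)) 2 (P t) := fun g j =>
      MemLp.of_bound (hψt.measurable.comp
        ((hD t).measurable_scaledX x (h t) g j)).aestronglyMeasurable C
        (ae_of_all _ fun ω => hψt.bound _)
    have hξL : ∀ g, MemLp (fun ω => c * ∑ j, ψ t ((S t).scaledX x (h t) g j ω)) 2 (P t) :=
      fun g => (memLp_finsetSum _ fun j _ => hL g j).const_mul c
    have hind : iIndepFun (fun g ω => c * ∑ j, ψ t ((S t).scaledX x (h t) g j ω)) (P t) := by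
      have := (hD t).iIndepFun_cluster_sum
        (φ := fun z _ => c * ψ t ((h t)⁻¹ • (z - x)))
        ((hψt.measurable.comp (show Measurable fun p : Regressor dI dC × ℝ =>
          (h t)⁻¹ • (p.1 - x) by fun_prop)).const_mul c)
      simpa only [ClusterSample.scaledX, Finset.mul_sum] using this
    have hE : ∀ g, ∫ ω, c * ∑ j, ψ t ((S t).scaledX x (h t) g j ω) ∂(P t)
        = c * ((S t).size g * (h t ^ (dI + dC) * ∫ u, ψ t u * M.f (x + h t • u))) := by
      intro g
      rw [integral_const_mul, integral_finsetSum _ fun j _ => (hL g j).integrable (by norm_num)]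
      have h1 : ∀ j, ∫ ω, ψ t ((S t).scaledX x (h t) g j ω) ∂(P t)
          = h t ^ (dI + dC) * ∫ u, ψ t u * M.f (x + h t • u) := fun j => by
        have := (hD t).integral_scaledX x hpos g j hψt.measurable (measurable_const (a := (1 : ℝ)))
        simpa only [mul_one, one_mul] using this
      simp [h1]
    have hEsum : ∑ g, ∫ ω, c * ∑ j, ψ t ((S t).scaledX x (h t) g j ω) ∂(P t)
        = ∫ u, ψ t u * M.f (x + h t • u) := by
      simp_rw [hE]
      rw [← Finset.mul_sum, ← Finset.sum_mul]
      have h2 : ∑ g, ((S t).size g : ℝ) = (S t).n := by simp [ClusterSample.n]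
      rw [h2, ← mul_assoc, ← mul_assoc, mul_assoc c, hc, inv_mul_cancel₀ hc0, one_mul]
    have heq : ∀ ω, (c * ∑ g, ∑ j, ψ t ((S t).scaledX x (h t) g j ω)
        - (∫ u, ψ t u * M.f (x + h t • u)) - 0)
        = ∑ g, c * ∑ j, ψ t ((S t).scaledX x (h t) g j ω)
          - ∑ g, ∫ ω, c * ∑ j, ψ t ((S t).scaledX x (h t) g j ω) ∂(P t) := by
      intro ω
      rw [hEsum, Finset.mul_sum, sub_zero]
    simp_rw [heq]
    refine ⟨(((memLp_finsetSum _ fun g _ => hξL g).sub (memLp_const _))).integrable_sq, ?_⟩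
    refine (integral_sq_sum_sub_le hind hξL).trans_eq ?_
    rw [sum_integral_sq_cluster hL hn (A := ∫ u, ψ t u * ψ t u * M.f (x + h t • u))
      (B := ∫ v, pairProduct (ψ t) v *
          (G (diagPoint x + h t • v) * M.fJoint 2 (diagPoint x + h t • v))) (h := h t)]
    · rw [sq, hc, mul_assoc (_⁻¹), inv_mul_cancel₀ hc0, mul_one]
    · intro g j
      have := (hD t).integral_scaledX x hpos g j (hψt.measurable.mul hψt.measurable)
        (measurable_const (a := (1 : ℝ)))
      simpa only [mul_one, one_mul, sq, Pi.mul_apply] using this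
    · intro g j l hjl
      -- Inserting G is free: where both weights are nonzero, both regressors lie in N and G equals
      -- 1.
      rw [← (hD t).integral_scaledX_pair x hpos g hjl hψt.measurable hGm]
      congr with ω
      by_cases hj : ‖(S t).scaledX x (h t) g j ω‖ ≤ R
      · by_cases hl : ‖(S t).scaledX x (h t) g l ω‖ ≤ R
        · have : (S t).jointX g ![j, l] ω ∈ jointNhd N 2 := by
            intro i
            have hj' := hb _ hj
            have hl' := hb _ hl
            rw [← ClusterSample.X_eq (S t) x hpos] at hj' hl'
            fin_cases i
            · exact hj'
            · exact hl'
          simp [hG, this]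
        · simp [hψt.support _ (not_le.1 hl)]
      · simp [hψt.support _ (not_le.1 hj)]
  have h0 : TendstoInProb P (fun t ω => (((S t).n : ℝ) * h t ^ (dI + dC))⁻¹ *
      ∑ g, ∑ j, ψ t ((S t).scaledX x (h t) g j ω)
        - (∫ u, ψ t u * M.f (x + h t • u))) 0 := by
    refine TendstoInProb.of_sq (key.mono fun t ht => ht.1) ?_
    refine squeeze_zero' (Eventually.of_forall fun t => integral_nonneg fun ω => sq_nonneg _)
      (key.mono fun t ht => ht.2) ?_
    simpa using (tendsto_inv_atTop_zero.comp hh.effective_size).mul (hI1.add (hrate.mul hI2))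
  simpa using h0.add (TendstoInProb.of_tendsto hmean)

end Asymptotic

/-! ### Central limit theorem for local error sums -/

section CLT

variable {dI dC : ℕ} {Ω : ℕ → Type*} {S : ∀ t, ClusterSample dI dC (Ω t)} {h : ℕ → ℝ}
  [∀ t, MeasurableSpace (Ω t)] {P : ∀ t, Measure (Ω t)} [∀ t, IsProbabilityMeasure (P t)]
  {M : RegressionModel dI dC} {x : Regressor dI dC} {N : Set (Regressor dI dC)} {lam r : ℝ}

/-- The size condition gives ∑ n_g^r ≤ C^r n^{r/4}. What remains, n^{-r/4} h^{d - dr/2}, is the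
square root of the bounded quantity n^{-r/2} h^{-(dr - d)} times h^{d/2}, and the last factor tends
to 0. -/
lemma MomentCondition.tendsto_lyapunov_ratio (hm : MomentCondition P S M h N r)
    (hdI : 1 ≤ dI) (hh : BandwidthCondition S h) :
    Tendsto (fun t => |(√(((S t).n : ℝ) * h t ^ (dI + dC)))⁻¹| ^ r * h t ^ (dI + dC)
      * ∑ g, ((S t).size g : ℝ) ^ r) atTop (𝓝 0) := by
  obtain ⟨C, hC0, hC⟩ := hm.size_moment
  obtain ⟨A, hA⟩ := hm.bandwidth_moment.bound
  have hr := hm.two_le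
  have hr0 : 0 < r := by linarith
  set d : ℝ := ((dI + dC : ℕ) : ℝ) with hd
  have hd0 : 0 < d := by
    rw [hd]; exact_mod_cast (show 0 < dI + dC by omega)
  have hlim : Tendsto (fun t => C ^ r * (|A| ^ (1 / 2 : ℝ) * h t ^ (d / 2))) atTop (𝓝 0) := by
    have h1 : Tendsto (fun t => h t ^ (d / 2)) atTop (𝓝 0) := by
      have := hh.tendsto_zero.rpow_const (p := d / 2) (Or.inr (by positivity))
      rwa [Real.zero_rpow (by positivity)] at this
    simpa using (h1.const_mul (|A| ^ (1 / 2 : ℝ))).const_mul (C ^ r)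
  refine squeeze_zero' (Eventually.of_forall fun t => ?_) ?_ hlim
  · have := (hh.pos t).le
    positivity
  filter_upwards [hA, hh.eventually_n_pos] with t hAt hnt
  have hpos := hh.pos t
  have hn : (0 : ℝ) < (S t).n := Nat.cast_pos.2 hnt
  set n : ℝ := ((S t).n : ℝ) with hndef
  have hsum : ∑ g, ((S t).size g : ℝ) ^ r ≤ C ^ r * n ^ (r / 4) := by
    have h1 := hC t
    rw [div_le_iff₀ (by positivity)] at h1
    have h2 := Real.rpow_le_rpow (by positivity) h1 hr0.le
    rw [← Real.rpow_mul (by positivity), one_div_mul_cancel hr0.ne', Real.rpow_one,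
      Real.mul_rpow hC0.le (by positivity), ← Real.rpow_mul hn.le] at h2
    convert h2 using 3
    ring
  have hhd : h t ^ (dI + dC) = h t ^ d := by rw [hd, Real.rpow_natCast]
  have hsqrt : |(√(n * h t ^ (dI + dC)))⁻¹| ^ r = n ^ (-(r / 2)) * h t ^ (-(d * r / 2)) := by
    rw [abs_of_nonneg (by positivity), hhd, Real.sqrt_eq_rpow, ← Real.rpow_neg_one,
      ← Real.rpow_mul (by positivity), ← Real.rpow_mul (by positivity),
      Real.mul_rpow hn.le (by positivity), ← Real.rpow_mul hpos.le]
    congr 2 <;> ring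
  have hAt' : n ^ (-(r / 2)) * h t ^ (-(d * r - d)) ≤ |A| := by
    rw [Real.norm_of_nonneg (by positivity), norm_one, mul_one] at hAt
    refine le_trans (le_of_eq ?_) (hAt.trans (le_abs_self A))
    rw [Real.rpow_neg hn.le, Real.rpow_neg hpos.le, one_div, mul_inv]
  calc _ ≤ |(√(n * h t ^ (dI + dC)))⁻¹| ^ r * h t ^ (dI + dC) * (C ^ r * n ^ (r / 4)) := by
        gcongr
    _ = C ^ r * ((n ^ (-(r / 2)) * h t ^ (-(d * r - d))) ^ (1 / 2 : ℝ) * h t ^ (d / 2)) := by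
        rw [hsqrt, hhd, Real.mul_rpow (by positivity) (by positivity), ← Real.rpow_mul hn.le,
          ← Real.rpow_mul hpos.le]
        have e1 : n ^ (-(r / 2)) * n ^ (r / 4) = n ^ (-(r / 2) * (1 / 2)) := by
          rw [← Real.rpow_add hn]; congr 1; ring
        have e2 : h t ^ (-(d * r / 2)) * h t ^ d
            = h t ^ (-(d * r - d) * (1 / 2)) * h t ^ (d / 2) := by
          rw [← Real.rpow_add hpos, ← Real.rpow_add hpos]; congr 1; ring
        rw [← e1, mul_assoc (n ^ (-(r / 2))) (n ^ (r / 4)), mul_assoc (n ^ (-(r / 2))), e2]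
        ring
    _ ≤ _ := by gcongr

/-- The normalised local average of the errors. -/
noncomputable def localError (S : ∀ t, ClusterSample dI dC (Ω t)) (M : RegressionModel dI dC)
    (h : ℕ → ℝ) (x : Regressor dI dC) (ψ : Regressor dI dC → ℝ) (t : ℕ) (ω : Ω t) : ℝ :=
  ∑ g, (√(((S t).n : ℝ) * h t ^ (dI + dC)))⁻¹ *
    ∑ j, ψ ((S t).scaledX x (h t) g j ω) * (S t).err M g j ω

/-- The limiting variance of the normalised local average of the errors. -/
noncomputable def localErrorVariance (M : RegressionModel dI dC) (x : Regressor dI dC)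
    (ψ : Regressor dI dC → ℝ) (lam : ℝ) : ℝ :=
  M.condVar x * M.f x * (∫ u, ψ u * ψ u) +
    lam * (M.condCov (diagPoint x) * M.fJoint 2 (diagPoint x) * ∫ v, pairProduct ψ v)

lemma ClusterDGP.measurable_localError (hD : ∀ t, ClusterDGP (P t) (S t) M)
    {ψ : Regressor dI dC → ℝ} (hψ : Measurable ψ) (t : ℕ) :
    Measurable (localError S M h x ψ t) :=
  Finset.measurable_sum _ fun g _ => (Finset.measurable_sum _ fun j _ =>
    (hψ.comp ((hD t).measurable_scaledX x (h t) g j)).mul ((hD t).measurable_err g j)).const_mul _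

/-- The central limit theorem for kernel-weighted local averages of the errors. -/
theorem tendsto_charFun_localError (hD : ∀ t, ClusterDGP (P t) (S t) M) (hdI : 1 ≤ dI)
    (hh : BandwidthCondition S h)
    (hrate : Tendsto (fun t => pairRate (S t) (h t)) atTop (𝓝 lam)) (hN : IsOpen N) (hx : x ∈ N)
    (hs : SmoothnessCondition M x N) (hm : MomentCondition P S M h N r)
    {R C : ℝ} {ψ : Regressor dI dC → ℝ} (hψ : IsBump R C ψ) :
    BoundedInProb P (localError S M h x ψ) ∧ ∀ s : ℝ,
      Tendsto (fun t => charFun ((P t).map (localError S M h x ψ t)) s) atTop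
        (𝓝 (Real.exp (-(s ^ 2 * localErrorVariance M x ψ lam / 2)) : ℝ)) := by
  obtain ⟨v, hv⟩ := hm.error_moment
  have hr := hm.two_le
  have hC : 0 ≤ C := (abs_nonneg _).trans (hψ.bound 0)
  have hfm := ClusterDGP.measurable_density hD hh
  have hf : ContinuousAt M.f x := hs.contDiff_f.continuousOn.continuousAt (hN.mem_nhds hx)
  have hN2 := ClusterDGP.isOpen_jointNhd hN 2
  have hx2 := diagPoint_mem_jointNhd hx
  have hball := eventually_forall_norm_le_rescale hh.tendsto_zero (hN.mem_nhds hx) R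
  have hg1m : Measurable fun z => N.indicator M.condVar z * M.f z :=
    (measurable_indicator_of_continuousOn hN hs.continuous_condVar).mul hfm
  have hg1c : ContinuousAt (fun z => N.indicator M.condVar z * M.f z) x := by
    refine ((hs.continuous_condVar.continuousAt (hN.mem_nhds hx)).congr ?_).mul hf
    filter_upwards [hN.mem_nhds hx] with z hz
    rw [Set.indicator_of_mem hz]
  have hg2m : Measurable fun z => (jointNhd N 2).indicator M.condCov z * M.fJoint 2 z := by
    have h1 := measurable_indicator_of_continuousOn hN2
      (hs.continuous_condCov.mul hs.contDiff_f2.continuousOn)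
    convert h1 using 1
    funext z
    by_cases hz : z ∈ jointNhd N 2 <;> simp [hz]
  have hg2c : ContinuousAt (fun z => (jointNhd N 2).indicator M.condCov z * M.fJoint 2 z)
      (diagPoint x) := by
    refine ((hs.continuous_condCov.continuousAt (hN2.mem_nhds hx2)).congr ?_).mul
      (hs.contDiff_f2.continuousOn.continuousAt (hN2.mem_nhds hx2))
    filter_upwards [hN2.mem_nhds hx2] with z hz
    rw [Set.indicator_of_mem hz]
  have hI1 := tendsto_integral_bump_mul (μ := volume) (ψ := fun _ => fun u => ψ u * ψ u)
    hh.tendsto_zero hg1m hg1c (Eventually.of_forall fun _ => hψ.mul hψ)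
    fun u => tendsto_const_nhds
  have hI2 := tendsto_integral_bump_mul (μ := volume) (ψ := fun _ => pairProduct ψ)
    hh.tendsto_zero hg2m hg2c (Eventually.of_forall fun _ => hψ.pairProduct)
    fun u => tendsto_const_nhds
  -- The rescaled probability of the ball converges to J, hence is eventually below J + 1; this
  -- makes the r-th moment bound uniform in g and j.
  have hJ := tendsto_integral_bump_mul (μ := volume)
    (ψ := fun _ => (Metric.closedBall (0 : Regressor dI dC) R).indicator fun _ => (1 : ℝ))
    hh.tendsto_zero hfm hf (Eventually.of_forall fun _ => isBump_indicator_closedBall R)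
    fun u => tendsto_const_nhds
  simp only [Set.indicator_of_mem hx, Set.indicator_of_mem hx2] at hI1 hI2
  set J : ℝ := M.f x * ∫ u, (Metric.closedBall (0 : Regressor dI dC) R).indicator
    (fun _ => (1 : ℝ)) u with hJdef
  set ξ : ∀ t, Fin (S t).G → Ω t → ℝ := fun t g ω => (√(((S t).n : ℝ) * h t ^ (dI + dC)))⁻¹ *
    ∑ j, ψ ((S t).scaledX x (h t) g j ω) * (S t).err M g j ω with hξ
  have hL : ∀ᶠ t in atTop, ∀ g j, MemLp
      (fun ω => ψ ((S t).scaledX x (h t) g j ω) * (S t).err M g j ω) 2 (P t) := by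
    filter_upwards [hball] with t hb g j
    exact (hD t).memLp_bump_mul_err (hh.pos t) hψ hb hr (hv t g j)
  have hξL : ∀ᶠ t in atTop, ∀ g, MemLp (ξ t g) 2 (P t) := by
    filter_upwards [hL] with t ht g
    exact (memLp_finsetSum _ fun j _ => ht g j).const_mul _
  have hξ0 : ∀ᶠ t in atTop, ∀ g, ∫ ω, ξ t g ω ∂(P t) = 0 := by
    filter_upwards [hL] with t ht g
    simp only [hξ]
    rw [integral_const_mul, integral_finsetSum _ fun j _ => (ht g j).integrable (by norm_num)]
    simp [fun j => (hD t).integral_bump_mul_err hψ.measurable (ht g j)]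
  have hind : ∀ t, iIndepFun (ξ t) (P t) := by
    intro t
    have := (hD t).iIndepFun_cluster_sum
      (φ := fun z y => (√(((S t).n : ℝ) * h t ^ (dI + dC)))⁻¹ *
        (ψ ((h t)⁻¹ • (z - x)) * (y - M.m z)))
      (((hψ.measurable.comp (show Measurable fun p : Regressor dI dC × ℝ =>
          (h t)⁻¹ • (p.1 - x) by fun_prop)).mul
          (measurable_snd.sub (M.measurable_m.comp measurable_fst))).const_mul _)
    simpa only [hξ, ClusterSample.scaledX, ClusterSample.err, Finset.mul_sum] using this
  -- The squared normalisation cancels n h^d exactly, leaving the diagonal integral plus `pairRate`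
  -- times the pair integral.
  have hV : Tendsto (fun t => ∑ g, ∫ ω, ξ t g ω ^ 2 ∂(P t)) atTop
      (𝓝 (localErrorVariance M x ψ lam)) := by
    refine (hI1.add (hrate.mul hI2)).congr' ?_
    filter_upwards [hL, hball, hh.eventually_n_pos] with t ht hb hn
    have hpos := hh.pos t
    have hn' : (0 : ℝ) < (S t).n := Nat.cast_pos.2 hn
    rw [sum_integral_sq_cluster ht hn
      (fun g j => (hD t).integral_sq_bump_mul_err hpos hN hs.continuous_condVar hψ hb (ht g j))
      fun g j l hjl => (hD t).integral_bump_mul_err_pair hpos hN hs.continuous_condCov hjl hψ hb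
        (ht g)]
    rw [inv_pow, Real.sq_sqrt (by positivity), inv_mul_cancel₀ (by positivity), one_mul]
  have hLr : ∀ᶠ t in atTop, ∀ g, Integrable (fun ω => |ξ t g ω| ^ r) (P t) ∧
      ∫ ω, |ξ t g ω| ^ r ∂(P t) ≤ |(√(((S t).n : ℝ) * h t ^ (dI + dC)))⁻¹| ^ r *
        (((S t).size g : ℝ) ^ r * (C ^ r * (1 + v ^ 2) * (h t ^ (dI + dC) * (J + 1)))) := by
    filter_upwards [hL, hball, hJ.eventually (gt_mem_nhds (lt_add_one J))] with t ht hb hJt g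
    have hpos := hh.pos t
    have hr2 : 0 < r := by linarith
    refine integrable_rpow_sum (by linarith) (fun j => (ht g j).aestronglyMeasurable)
      (fun j => ((hD t).integrable_rpow_bump_mul_err hpos hψ hb (hv t g j) hr2 (by linarith)).1)
      (fun j => ((hD t).integrable_rpow_bump_mul_err hpos hψ hb (hv t g j) hr2
        (by linarith)).2.trans ?_) _
    gcongr
  have hLyap : Tendsto (fun t => ∑ g, ∫ ω, |ξ t g ω| ^ r ∂(P t)) atTop (𝓝 0) := by
    have h1 := (hm.tendsto_lyapunov_ratio hdI hh).const_mul (C ^ r * (1 + v ^ 2) * (J + 1))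
    rw [mul_zero] at h1
    refine squeeze_zero' (Eventually.of_forall fun t => Finset.sum_nonneg fun g _ =>
      integral_nonneg fun ω => by positivity) ?_ h1
    filter_upwards [hLr] with t ht
    refine (Finset.sum_le_sum fun g _ => (ht g).2).trans_eq ?_
    rw [← Finset.mul_sum, ← Finset.sum_mul]
    ring
  constructor
  · refine BoundedInProb.of_sq (c := localErrorVariance M x ψ lam) ?_ (hV.congr' ?_)
    · filter_upwards [hξL] with t ht
      exact (memLp_finsetSum _ fun g _ => ht g).integrable_sq
    · filter_upwards [hξL, hξ0] with t ht ht0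
      exact (integral_sq_sum_eq (hind t) ht ht0).symm
  · exact tendsto_charFun_sum_of_lyapunov hr (Eventually.of_forall hind) hξL hξ0
      (hLr.mono fun t ht g => (ht g).1) hV hLyap

end CLT

/-! ### The local linear estimator -/

section Algebra

variable {dI dC : ℕ}

/-- The vector `(1, u)`. -/
def affineVec (u : Regressor dI dC) : Unit ⊕ (Fin dI ⊕ Fin dC) → ℝ :=
  Sum.elim (fun _ => 1) u

lemma measurable_affineVec (a : Unit ⊕ (Fin dI ⊕ Fin dC)) :
    Measurable fun u : Regressor dI dC => affineVec u a := by
  rcases a with _ | q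
  · exact measurable_const
  · exact measurable_pi_apply q

lemma abs_affineVec_le {R : ℝ} {u : Regressor dI dC} (hu : ‖u‖ ≤ R)
    (a : Unit ⊕ (Fin dI ⊕ Fin dC)) : |affineVec u a| ≤ max 1 R := by
  rcases a with _ | q
  · simp [affineVec]
  · exact ((norm_le_pi_norm u q).trans hu).trans (le_max_right _ _)

/-- Cramer's formula det⁻¹ · adjugate is also valid at singular matrices, where both conventions for
the inverse give 0, so measurability holds everywhere. -/
lemma measurable_matrix_inv_apply {ι : Type*} [Fintype ι] [DecidableEq ι] (a b : ι) :
    Measurable fun A : ι → ι → ℝ => (Matrix.of A)⁻¹ a b := by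
  have h1 : ∀ A : ι → ι → ℝ, (Matrix.of A)⁻¹ a b
      = (Matrix.of A).det⁻¹ * (Matrix.of A).adjugate a b := by
    intro A
    rw [Matrix.inv_def, Ring.inverse_eq_inv', Matrix.smul_apply, smul_eq_mul]
  simp_rw [h1]
  have h2 : Continuous fun A : ι → ι → ℝ => Matrix.of A := continuous_id
  exact h2.matrix_det.measurable.inv.mul (h2.matrix_adjugate.matrix_elem a b).measurable

lemma continuousAt_matrix_inv_apply {ι : Type*} [Fintype ι] [DecidableEq ι] {A : ι → ι → ℝ}
    (hA : (Matrix.of A).det ≠ 0) (a b : ι) :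
    ContinuousAt (fun A : ι → ι → ℝ => (Matrix.of A)⁻¹ a b) A := by
  have h1 : ∀ A : ι → ι → ℝ, (Matrix.of A)⁻¹ a b
      = (Matrix.of A).det⁻¹ * (Matrix.of A).adjugate a b := by
    intro A
    rw [Matrix.inv_def, Ring.inverse_eq_inv', Matrix.smul_apply, smul_eq_mul]
  simp_rw [h1]
  have h2 : Continuous fun A : ι → ι → ℝ => Matrix.of A := continuous_id
  exact (h2.matrix_det.continuousAt.inv₀ hA).mul
    (h2.matrix_adjugate.matrix_elem a b).continuousAt

variable {Ω : Type*} (S : ClusterSample dI dC Ω) (k : ℝ → ℝ) (h : ℝ) (x : Regressor dI dC) (ω : Ω)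

/-- The local average `(n h^d)⁻¹ ∑_i ψ((X_i - x) / h) Z_i`. -/
noncomputable def localAverage (ψ : Regressor dI dC → ℝ)
    (Z : (g : Fin S.G) → Fin (S.size g) → ℝ) : ℝ :=
  ((S.n : ℝ) * h ^ (dI + dC))⁻¹ * ∑ g, ∑ j, ψ (S.scaledX x h g j ω) * Z g j

/-- The normalised design matrix `(n h^d)⁻¹ ∑_i K(z_i) (1, z_i) (1, z_i)ᵀ`, with
`z_i = (X_i - x) / h`. -/
noncomputable def localGram (a b : Unit ⊕ (Fin dI ⊕ Fin dC)) : ℝ :=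
  ((S.n : ℝ) * h ^ (dI + dC))⁻¹ * ∑ g, ∑ j, productKernel k (S.scaledX x h g j ω) *
    affineVec (S.scaledX x h g j ω) a * affineVec (S.scaledX x h g j ω) b

lemma llDesign_gram_apply (a b : Unit ⊕ (Fin dI ⊕ Fin dC)) :
    ((llDesign S x ω).transpose * llWeightMatrix S k h x ω * llDesign S x ω) a b
      = ∑ g, ∑ j, llVector x (S.X g j ω) a * scaledKernel k h (S.X g j ω - x) *
          llVector x (S.X g j ω) b := by
  rw [Matrix.mul_apply, Fintype.sum_sigma]
  simp [llWeightMatrix, llDesign]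

variable {S h}

/-- The scaling (1, X - x) = D (1, z) uses D = diag(1, h, …, h), encoded as `affineVec` of the
constant vector h. -/
lemma llVector_X (hh : 0 < h) (g : Fin S.G) (j : Fin (S.size g))
    (a : Unit ⊕ (Fin dI ⊕ Fin dC)) :
    llVector x (S.X g j ω) a
      = affineVec (fun _ => h : Regressor dI dC) a * affineVec (S.scaledX x h g j ω) a := by
  rcases a with _ | q
  · simp [llVector, affineVec]
  · simp [llVector, affineVec, ClusterSample.scaledX, hh.ne']

/-- The raw Gram matrix is D A (nD), so its inverse is (nD)⁻¹ A⁻¹ D⁻¹; D⁻¹ turns (1, X - x) into (1,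
z), and the first entry of D is 1. Reversal of products under the inverse also holds for singular A,
hence no determinant hypothesis. -/
lemma llKernel_eq (hh : 0 < h) (hn : 0 < S.n) (g : Fin S.G) (j : Fin (S.size g)) :
    llKernel S k h x ω (S.X g j ω) = ((S.n : ℝ) * h ^ (dI + dC))⁻¹ *
      (∑ a, (Matrix.of (localGram S k h x ω))⁻¹ (Sum.inl ()) a *
        affineVec (S.scaledX x h g j ω) a) * productKernel k (S.scaledX x h g j ω) := by
  have hn' : (S.n : ℝ) ≠ 0 := Nat.cast_ne_zero.2 hn.ne'
  set D : Unit ⊕ (Fin dI ⊕ Fin dC) → ℝ := affineVec (fun _ => h) with hDdef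
  have hD : ∀ a, D a ≠ 0 := by
    intro a
    rcases a with _ | q
    · simp [hDdef, affineVec]
    · simpa [hDdef, affineVec] using hh.ne'
  have h1 : (llDesign S x ω).transpose * llWeightMatrix S k h x ω * llDesign S x ω
      = Matrix.diagonal D * Matrix.of (localGram S k h x ω) *
        Matrix.diagonal (fun a => S.n * D a) := by
    ext a b
    rw [llDesign_gram_apply, Matrix.mul_diagonal, Matrix.diagonal_mul, Matrix.of_apply, localGram]
    simp only [llVector_X x ω hh, scaledKernel, ← hDdef]
    simp only [Finset.mul_sum, Finset.sum_mul]
    refine Finset.sum_congr rfl fun g _ => Finset.sum_congr rfl fun j _ => ?_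
    rw [← ClusterSample.scaledX]
    field_simp
  have h2 : (Matrix.diagonal fun a => (S.n : ℝ) * D a)⁻¹
      = Matrix.diagonal fun a => ((S.n : ℝ) * D a)⁻¹ := by
    refine Matrix.inv_eq_right_inv ?_
    rw [Matrix.diagonal_mul_diagonal, ← Matrix.diagonal_one]
    congr 1
    funext a
    exact mul_inv_cancel₀ (mul_ne_zero hn' (hD a))
  have h3 : (Matrix.diagonal D)⁻¹ = Matrix.diagonal fun a => (D a)⁻¹ := by
    refine Matrix.inv_eq_right_inv ?_
    rw [Matrix.diagonal_mul_diagonal, ← Matrix.diagonal_one]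
    congr 1
    funext a
    exact mul_inv_cancel₀ (hD a)
  rw [llKernel, h1, Matrix.mul_inv_rev, Matrix.mul_inv_rev, h2, h3, ← Matrix.mulVec_mulVec,
    Matrix.mulVec_diagonal, ← Matrix.mulVec_mulVec]
  have h4 : (Matrix.diagonal fun a => (D a)⁻¹).mulVec (llVector x (S.X g j ω))
      = affineVec (S.scaledX x h g j ω) := by
    funext a
    rw [Matrix.mulVec_diagonal, llVector_X x ω hh, ← hDdef, inv_mul_cancel_left₀ (hD a)]
  rw [h4, scaledKernel, ← ClusterSample.scaledX]
  have h5 : D (Sum.inl ()) = 1 := rfl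
  rw [h5, Matrix.mulVec, dotProduct, mul_one, mul_inv]
  ring

lemma affineVec_dot (β : Unit ⊕ (Fin dI ⊕ Fin dC) → ℝ) (u : Regressor dI dC) :
    ∑ b, affineVec u b * β b = β (Sum.inl ()) + ∑ q, u q * β (Sum.inr q) := by
  simp [affineVec, Fintype.sum_sum_type]

lemma localLinear_eq (hh : 0 < h) (hn : 0 < S.n) :
    localLinear S k h x ω = ∑ a, (Matrix.of (localGram S k h x ω))⁻¹ (Sum.inl ()) a *
      localAverage S h x ω (fun u => productKernel k u * affineVec u a) (fun g j => S.Y g j ω) := by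
  simp only [localLinear, llKernel_eq k x ω hh hn, localAverage, Finset.mul_sum, Finset.sum_mul]
  symm
  rw [Finset.sum_comm]
  refine Finset.sum_congr rfl fun g _ => ?_
  rw [Finset.sum_comm]
  refine Finset.sum_congr rfl fun j _ => Finset.sum_congr rfl fun a _ => ?_
  ring

variable (M : RegressionModel dI dC)

/-- Affine functions of z are reproduced exactly: A⁻¹ A β = β, and the first coordinate of β is
m(x). The gradient therefore drops out with no estimate. -/
lemma localLinear_sub_eq (hh : 0 < h) (hn : 0 < S.n)
    (hdet : (Matrix.of (localGram S k h x ω)).det ≠ 0) :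
    localLinear S k h x ω - M.m x = ∑ a, (Matrix.of (localGram S k h x ω))⁻¹ (Sum.inl ()) a *
      (h ^ 2 * (((S.n : ℝ) * h ^ (dI + dC))⁻¹ * ∑ g, ∑ j,
        productKernel k (S.scaledX x h g j ω) * affineVec (S.scaledX x h g j ω) a *
          taylorRemainder M.m x h (S.scaledX x h g j ω))
      + ((S.n : ℝ) * h ^ (dI + dC))⁻¹ * ∑ g, ∑ j,
        productKernel k (S.scaledX x h g j ω) * affineVec (S.scaledX x h g j ω) a *
          S.err M g j ω) := by
  set β : Unit ⊕ (Fin dI ⊕ Fin dC) → ℝ :=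
    Sum.elim (fun _ => M.m x) (fun q => h * fderiv ℝ M.m x (Pi.single q 1)) with hβ
  have hY : ∀ g j, S.Y g j ω = ∑ b, affineVec (S.scaledX x h g j ω) b * β b
      + h ^ 2 * taylorRemainder M.m x h (S.scaledX x h g j ω) + S.err M g j ω := by
    intro g j
    have h1 : fderiv ℝ M.m x (S.scaledX x h g j ω)
        = ∑ q, S.scaledX x h g j ω q * fderiv ℝ M.m x (Pi.single q 1) := by
      conv_lhs => rw [pi_eq_sum_univ' (S.scaledX x h g j ω)]
      simp [map_sum]
    rw [affineVec_dot, hβ]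
    simp only [Sum.elim_inl, Sum.elim_inr, taylorRemainder, ← ClusterSample.X_eq S x hh,
      ClusterSample.err]
    have h2 : ∑ q, S.scaledX x h g j ω q * (h * fderiv ℝ M.m x (Pi.single q 1))
        = h * fderiv ℝ M.m x (S.scaledX x h g j ω) := by
      rw [h1, Finset.mul_sum]
      exact Finset.sum_congr rfl fun q _ => by ring
    rw [h2]
    field_simp
    ring
  have hinv : ∑ a, (Matrix.of (localGram S k h x ω))⁻¹ (Sum.inl ()) a *
      ∑ b, localGram S k h x ω a b * β b = M.m x := by
    have h1 : ((Matrix.of (localGram S k h x ω))⁻¹).mulVec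
        ((Matrix.of (localGram S k h x ω)).mulVec β) = β := by
      rw [Matrix.mulVec_mulVec, Matrix.nonsing_inv_mul _ (isUnit_iff_ne_zero.2 hdet),
        Matrix.one_mulVec]
    exact congrFun h1 (Sum.inl ())
  rw [localLinear_eq k x ω hh hn, ← hinv, ← Finset.sum_sub_distrib]
  refine Finset.sum_congr rfl fun a _ => ?_
  rw [← mul_sub]
  congr 1
  have h3 : ∑ b, localGram S k h x ω a b * β b = ((S.n : ℝ) * h ^ (dI + dC))⁻¹ * ∑ g, ∑ j,
      productKernel k (S.scaledX x h g j ω) * affineVec (S.scaledX x h g j ω) a *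
        ∑ b, affineVec (S.scaledX x h g j ω) b * β b := by
    simp only [localGram, Finset.mul_sum, Finset.sum_mul]
    rw [Finset.sum_comm]
    refine Finset.sum_congr rfl fun g _ => ?_
    rw [Finset.sum_comm]
    refine Finset.sum_congr rfl fun j _ => Finset.sum_congr rfl fun b _ => ?_
    ring
  rw [h3, localAverage]
  simp only [hY, mul_add, Finset.sum_add_distrib]
  have h4 : ∑ g, ∑ j, productKernel k (S.scaledX x h g j ω) * affineVec (S.scaledX x h g j ω) a *
      (h ^ 2 * taylorRemainder M.m x h (S.scaledX x h g j ω))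
      = h ^ 2 * ∑ g, ∑ j, productKernel k (S.scaledX x h g j ω) *
        affineVec (S.scaledX x h g j ω) a * taylorRemainder M.m x h (S.scaledX x h g j ω) := by
    simp only [Finset.mul_sum]
    refine Finset.sum_congr rfl fun g _ => Finset.sum_congr rfl fun j _ => ?_
    ring
  rw [h4]
  ring

end Algebra

/-! ### Limiting kernel moments, the bias constant and measurability of the estimator -/

section Limits

variable {dI dC : ℕ} {k : ℝ → ℝ}

lemma IsBump.integrable {E : Type*} [NormedAddCommGroup E] [NormedSpace ℝ E] [MeasurableSpace E]
    [BorelSpace E] [FiniteDimensional ℝ E] {μ : Measure E} [IsFiniteMeasureOnCompacts μ]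
    {R C : ℝ} {ψ : E → ℝ} (hψ : IsBump R C ψ) : Integrable ψ μ := by
  have : ProperSpace E := FiniteDimensional.proper ℝ E
  have h1 : Integrable ((Metric.closedBall (0 : E) R).indicator fun _ => C) μ :=
    (integrable_indicator_iff Metric.isClosed_closedBall.measurableSet).2
      (integrableOn_const (isCompact_closedBall (0 : E) R).measure_lt_top.ne)
  refine h1.mono' hψ.measurable.aestronglyMeasurable (ae_of_all _ fun u => ?_)
  by_cases hu : u ∈ Metric.closedBall (0 : E) R
  · simpa [hu] using hψ.bound u
  · rw [hψ.support u (by simpa using hu), Set.indicator_of_notMem hu, norm_zero]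

lemma integral_productKernel_mul_affineVec_mul_affineVec (hk : IsUnivariateKernel k)
    (a b : Unit ⊕ (Fin dI ⊕ Fin dC)) :
    ∫ u : Regressor dI dC, productKernel k u * affineVec u a * affineVec u b
      = Matrix.diagonal (Sum.elim (fun _ => 1) fun _ => kernelSecondMoment k) a b := by
  rcases a with _ | p <;> rcases b with _ | q
  · simp [affineVec, integral_productKernel hk]
  · simp [affineVec, integral_productKernel_mul_apply hk]
  · simp [affineVec, integral_productKernel_mul_apply hk]
  · simp only [affineVec, Sum.elim_inr, mul_assoc,
      integral_productKernel_mul_apply_mul_apply hk, Matrix.diagonal_apply, Sum.inr.injEq]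

lemma bilin_apply_eq_sum (H : Regressor dI dC →L[ℝ] Regressor dI dC →L[ℝ] ℝ)
    (u : Regressor dI dC) :
    H u u = ∑ p, ∑ q, (u p * u q) * H (Pi.single p 1) (Pi.single q 1) := by
  have h1 : ∀ (L : Regressor dI dC →L[ℝ] ℝ), L u = ∑ q, u q * L (Pi.single q 1) := by
    intro L
    conv_lhs => rw [pi_eq_sum_univ' u]
    simp [map_sum]
  have h2 : H u = ∑ p, u p • H (Pi.single p 1) := by
    conv_lhs => rw [pi_eq_sum_univ' u]
    simp [map_sum]
  rw [h1, h2]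
  simp only [FunLike.coe_sum, Finset.sum_apply, FunLike.coe_smul, Pi.smul_apply,
    smul_eq_mul, Finset.mul_sum]
  rw [Finset.sum_comm]
  refine Finset.sum_congr rfl fun p _ => Finset.sum_congr rfl fun q _ => ?_
  ring

/-- Mixed second moments of K vanish since k is even, so only the trace of the bilinear form
survives. -/
lemma integral_productKernel_mul_bilin (hk : IsUnivariateKernel k) {R C : ℝ}
    (hK : IsBump R C (productKernel k : Regressor dI dC → ℝ))
    (H : Regressor dI dC →L[ℝ] Regressor dI dC →L[ℝ] ℝ) :
    ∫ u, productKernel k u * (H u u / 2)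
      = kernelSecondMoment k / 2 * ∑ q, H (Pi.single q 1) (Pi.single q 1) := by
  have hint : ∀ p q, Integrable (fun u : Regressor dI dC => productKernel k u * (u p * u q)) := by
    intro p q
    refine (hK.mul_of_bound (C' := R * R) (by fun_prop) fun u hu => ?_).integrable
    rw [abs_mul]
    have h1 := (norm_le_pi_norm u p).trans hu
    have h2 := (norm_le_pi_norm u q).trans hu
    exact mul_le_mul h1 h2 (abs_nonneg _) ((norm_nonneg _).trans h1)
  have h1 : ∀ u : Regressor dI dC, productKernel k u * (H u u / 2)
      = ∑ p, ∑ q, productKernel k u * (u p * u q) * (H (Pi.single p 1) (Pi.single q 1) / 2) := by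
    intro u
    rw [bilin_apply_eq_sum, Finset.sum_div, Finset.mul_sum]
    refine Finset.sum_congr rfl fun p _ => ?_
    rw [Finset.sum_div, Finset.mul_sum]
    exact Finset.sum_congr rfl fun q _ => by ring
  simp_rw [h1]
  rw [integral_finsetSum _ fun p _ => integrable_finsetSum _ fun q _ => (hint p q).mul_const _,
    Finset.mul_sum]
  refine Finset.sum_congr rfl fun p _ => ?_
  rw [integral_finsetSum _ fun q _ => (hint p q).mul_const _]
  simp_rw [integral_mul_const, integral_productKernel_mul_apply_mul_apply hk]
  simp
  ring

/-- m is differentiable throughout a neighbourhood of x, so the inner line derivative agrees there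
with an evaluation of Dm and may be differentiated again. -/
lemma partialDeriv_partialDeriv_eq {m : Regressor dI dC → ℝ} {x : Regressor dI dC}
    (hm : ContDiffAt ℝ 2 m x) (q : Fin dI ⊕ Fin dC) :
    partialDeriv (partialDeriv m q) q x
      = fderiv ℝ (fderiv ℝ m) x (Pi.single q 1) (Pi.single q 1) := by
  have hd2 : HasFDerivAt (fderiv ℝ m) (fderiv ℝ (fderiv ℝ m) x) x :=
    ((hm.fderiv_right (m := 1) (by norm_num)).differentiableAt (by simp)).hasFDerivAt
  have h1 : partialDeriv m q =ᶠ[𝓝 x] fun y => fderiv ℝ m y (Pi.single q 1) := by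
    filter_upwards [hm.eventually (by simp)] with y hy
    exact (hy.differentiableAt (by simp)).lineDeriv_eq_fderiv
  have h2 := (hd2.clm_apply (hasFDerivAt_const (Pi.single q (1 : ℝ)) x)).congr_of_eventuallyEq h1
  rw [partialDeriv, (h2.hasLineDerivAt (Pi.single q 1)).lineDeriv]
  simp

variable {Ω : ℕ → Type*} {S : ∀ t, ClusterSample dI dC (Ω t)} {h : ℕ → ℝ}
  [∀ t, MeasurableSpace (Ω t)] {P : ∀ t, Measure (Ω t)} [∀ t, IsProbabilityMeasure (P t)]
  {M : RegressionModel dI dC} {x : Regressor dI dC} {N : Set (Regressor dI dC)} {lam r : ℝ}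

lemma ClusterDGP.measurable_localLinear {Ω : Type*} [MeasurableSpace Ω] {P : Measure Ω}
    [IsProbabilityMeasure P] {S : ClusterSample dI dC Ω} (hD : ClusterDGP P S M)
    (hk : IsUnivariateKernel k) (h : ℝ) : Measurable (localLinear S k h x) := by
  have hX := fun g j => hD.measurable_X g j
  have hvec : ∀ a, Measurable fun u : Regressor dI dC => llVector x u a := by
    intro a
    rcases a with _ | q
    · exact measurable_const
    · simp only [llVector, Sum.elim_inr, Pi.sub_apply]
      fun_prop
  have hker : Measurable fun u : Regressor dI dC => scaledKernel k h (u - x) :=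
    ((measurable_productKernel hk).comp
      (show Measurable fun u : Regressor dI dC => h⁻¹ • (u - x) by fun_prop)).const_mul _
  refine Finset.measurable_sum _ fun g _ => Finset.measurable_sum _ fun j _ =>
    Measurable.mul ?_ (hD.measurable_Y g j)
  refine Measurable.mul ?_ (hker.comp (hX g j))
  simp only [Matrix.mulVec, dotProduct]
  refine Finset.measurable_sum _ fun a _ => Measurable.mul ?_ ((hvec a).comp (hX g j))
  refine (measurable_matrix_inv_apply (Sum.inl ()) a).comp
    (measurable_pi_lambda _ fun b => measurable_pi_lambda _ fun c => ?_)
  have hgram : Measurable fun ω =>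
      ((llDesign S x ω).transpose * llWeightMatrix S k h x ω * llDesign S x ω) b c := by
    simp only [llDesign_gram_apply]
    exact Finset.measurable_sum _ fun g _ => Finset.measurable_sum _ fun j _ =>
      (((hvec b).comp (hX g j)).mul (hker.comp (hX g j))).mul ((hvec c).comp (hX g j))
  exact hgram

end Limits

lemma BoundedInProb.of_bounded {Ω : ℕ → Type*} [∀ t, MeasurableSpace (Ω t)]
    {P : ∀ t, Measure (Ω t)} {c : ℕ → ℝ} {K : ℝ} (hc : ∀ᶠ t in atTop, |c t| ≤ K) :
    BoundedInProb P fun t _ => c t := by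
  intro δ _
  refine ⟨K + 1, ?_⟩
  filter_upwards [hc] with t ht
  have : ¬ (K + 1 ≤ |c t|) := by linarith
  simp [this]

/-! ### Reduction of the estimator to its leading error term -/

section LocalLinearLimit

variable {dI dC : ℕ} {k : ℝ → ℝ} {Ω : ℕ → Type*} {S : ∀ t, ClusterSample dI dC (Ω t)} {h : ℕ → ℝ}
  [∀ t, MeasurableSpace (Ω t)] {P : ∀ t, Measure (Ω t)} [∀ t, IsProbabilityMeasure (P t)]
  {M : RegressionModel dI dC} {x : Regressor dI dC} {N : Set (Regressor dI dC)} {lam r R C : ℝ}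

/-- The weight `K(u) (1, u)_a`. -/
def weightedKernel (k : ℝ → ℝ) (a : Unit ⊕ (Fin dI ⊕ Fin dC)) (u : Regressor dI dC) : ℝ :=
  productKernel k u * affineVec u a

lemma isBump_weightedKernel (hKb : IsBump R C (productKernel k : Regressor dI dC → ℝ))
    (a : Unit ⊕ (Fin dI ⊕ Fin dC)) : IsBump R (C * |max 1 R|) (weightedKernel k a) :=
  hKb.mul_of_bound (measurable_affineVec a) fun _ hu => abs_affineVec_le hu a

lemma weightedKernel_inl :
    weightedKernel (dI := dI) (dC := dC) k (Sum.inl ()) = productKernel k := by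
  funext u
  simp [weightedKernel, affineVec]

/-- The diagonal entries `f(x) (1, κ₂, …, κ₂)` of the limit of the normalised design matrix. -/
noncomputable def gramLimit (M : RegressionModel dI dC) (k : ℝ → ℝ) (x : Regressor dI dC) :
    Unit ⊕ (Fin dI ⊕ Fin dC) → ℝ :=
  fun a => M.f x * (Sum.elim (fun _ => 1) fun _ => kernelSecondMoment k :
    Unit ⊕ (Fin dI ⊕ Fin dC) → ℝ) a

lemma gramLimit_ne_zero (hk : IsUnivariateKernel k) (hf : 0 < M.f x)
    (a : Unit ⊕ (Fin dI ⊕ Fin dC)) : gramLimit M k x a ≠ 0 := by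
  rcases a with _ | q
  · simpa [gramLimit] using hf.ne'
  · simpa [gramLimit] using ⟨hf.ne', hk.kernelSecondMoment_pos.ne'⟩

lemma det_gramLimit_ne_zero (hk : IsUnivariateKernel k) (hf : 0 < M.f x) :
    (Matrix.of (Matrix.diagonal (gramLimit M k x))).det ≠ 0 := by
  change (Matrix.diagonal (gramLimit M k x)).det ≠ 0
  rw [Matrix.det_diagonal]
  exact Finset.prod_ne_zero_iff.2 fun a _ => gramLimit_ne_zero hk hf a

lemma inv_gramLimit_apply (hk : IsUnivariateKernel k) (hf : 0 < M.f x)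
    (a : Unit ⊕ (Fin dI ⊕ Fin dC)) :
    (Matrix.of (Matrix.diagonal (gramLimit M k x)))⁻¹ (Sum.inl ()) a
      = if a = Sum.inl () then (M.f x)⁻¹ else 0 := by
  have h1 : (Matrix.diagonal (gramLimit M k x))⁻¹
      = Matrix.diagonal (fun a => (gramLimit M k x a)⁻¹) := by
    refine Matrix.inv_eq_right_inv ?_
    rw [Matrix.diagonal_mul_diagonal, ← Matrix.diagonal_one]
    congr 1
    funext a
    exact mul_inv_cancel₀ (gramLimit_ne_zero hk hf a)
  change (Matrix.diagonal (gramLimit M k x))⁻¹ (Sum.inl ()) a = _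
  rw [h1, Matrix.diagonal_apply]
  rcases a with _ | q <;> simp [gramLimit]

lemma tendstoInProb_localGram (hD : ∀ t, ClusterDGP (P t) (S t) M) (hh : BandwidthCondition S h)
    (hrate : Tendsto (fun t => pairRate (S t) (h t)) atTop (𝓝 lam)) (hN : IsOpen N) (hx : x ∈ N)
    (hs : SmoothnessCondition M x N) (hk : IsUnivariateKernel k)
    (hKb : IsBump R C (productKernel k : Regressor dI dC → ℝ)) :
    TendstoInProb P (fun t ω => localGram (S t) k (h t) x ω)
      (Matrix.diagonal (gramLimit M k x) :
        Unit ⊕ (Fin dI ⊕ Fin dC) → Unit ⊕ (Fin dI ⊕ Fin dC) → ℝ) := by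
  refine TendstoInProb.pi fun a => TendstoInProb.pi fun b => ?_
  have h1 := tendstoInProb_localAverage hD hh hrate hN hx hs
    (ψ := fun _ u => weightedKernel k a u * affineVec u b) (Eventually.of_forall fun _ =>
      (isBump_weightedKernel hKb a).mul_of_bound (measurable_affineVec b)
        fun u hu => abs_affineVec_le hu b)
    (fun u => tendsto_const_nhds)
  have h2 : Matrix.diagonal (gramLimit M k x) a b
      = M.f x * ∫ u, weightedKernel k a u * affineVec u b := by
    simp only [weightedKernel, integral_productKernel_mul_affineVec_mul_affineVec hk,
      Matrix.diagonal_apply, gramLimit]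
    split_ifs <;> simp
  rw [h2]
  exact h1

omit [∀ t, IsProbabilityMeasure (P t)] in
lemma tendstoInProb_inv_localGram (hk : IsUnivariateKernel k) (hf : 0 < M.f x)
    (hA : TendstoInProb P (fun t ω => localGram (S t) k (h t) x ω)
      (Matrix.diagonal (gramLimit M k x) :
        Unit ⊕ (Fin dI ⊕ Fin dC) → Unit ⊕ (Fin dI ⊕ Fin dC) → ℝ))
    (a : Unit ⊕ (Fin dI ⊕ Fin dC)) :
    TendstoInProb P (fun t ω => (Matrix.of (localGram (S t) k (h t) x ω))⁻¹ (Sum.inl ()) a)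
      (if a = Sum.inl () then (M.f x)⁻¹ else 0) := by
  rw [← inv_gramLimit_apply hk hf a]
  exact hA.comp (φ := fun A : Unit ⊕ (Fin dI ⊕ Fin dC) → Unit ⊕ (Fin dI ⊕ Fin dC) → ℝ =>
      (Matrix.of A)⁻¹ (Sum.inl ()) a)
    (continuousAt_matrix_inv_apply (det_gramLimit_ne_zero hk hf) (Sum.inl ()) a)

omit [∀ t, IsProbabilityMeasure (P t)] in
lemma tendsto_measure_det_localGram_eq_zero (hk : IsUnivariateKernel k) (hf : 0 < M.f x)
    (hA : TendstoInProb P (fun t ω => localGram (S t) k (h t) x ω)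
      (Matrix.diagonal (gramLimit M k x) :
        Unit ⊕ (Fin dI ⊕ Fin dC) → Unit ⊕ (Fin dI ⊕ Fin dC) → ℝ)) :
    Tendsto (fun t => P t {ω | (Matrix.of (localGram (S t) k (h t) x ω)).det = 0}) atTop
      (𝓝 0) := by
  have h2 : Continuous fun A : Unit ⊕ (Fin dI ⊕ Fin dC) → Unit ⊕ (Fin dI ⊕ Fin dC) → ℝ =>
    (Matrix.of A).det := Continuous.matrix_det continuous_id
  have h3 := hA.comp (φ := fun A : Unit ⊕ (Fin dI ⊕ Fin dC) → Unit ⊕ (Fin dI ⊕ Fin dC) → ℝ =>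
    (Matrix.of A).det) h2.continuousAt
  exact h3.tendsto_measure_eq (det_gramLimit_ne_zero hk hf).symm

/-- The local average of the Taylor remainders of the regression function. -/
noncomputable def localBias (S : ∀ t, ClusterSample dI dC (Ω t)) (M : RegressionModel dI dC)
    (k : ℝ → ℝ) (h : ℕ → ℝ) (x : Regressor dI dC) (a : Unit ⊕ (Fin dI ⊕ Fin dC)) (t : ℕ)
    (ω : Ω t) : ℝ :=
  (((S t).n : ℝ) * h t ^ (dI + dC))⁻¹ * ∑ g, ∑ j, weightedKernel k a ((S t).scaledX x (h t) g j ω) *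
    taylorRemainder M.m x (h t) ((S t).scaledX x (h t) g j ω)

/-- The law of large numbers applies with weights depending on t: the Taylor remainders converge
pointwise to D²m(x)(u, u)/2 and are eventually bounded uniformly on the support of K. -/
lemma tendstoInProb_localBias (hD : ∀ t, ClusterDGP (P t) (S t) M) (hh : BandwidthCondition S h)
    (hrate : Tendsto (fun t => pairRate (S t) (h t)) atTop (𝓝 lam)) (hN : IsOpen N) (hx : x ∈ N)
    (hs : SmoothnessCondition M x N)
    (hKb : IsBump R C (productKernel k : Regressor dI dC → ℝ)) (a : Unit ⊕ (Fin dI ⊕ Fin dC)) :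
    TendstoInProb P (localBias S M k h x a)
      (M.f x * ∫ u, weightedKernel k a u * (fderiv ℝ (fderiv ℝ M.m) x u u / 2)) := by
  have hm2 : ContDiffAt ℝ 2 M.m x := hs.contDiff_m.contDiffAt (hN.mem_nhds hx)
  obtain ⟨Cρ, hCρ⟩ := exists_bound_taylorRemainder hm2 hh.pos hh.tendsto_zero R
  have hρm : ∀ t, Measurable (taylorRemainder M.m x (h t)) := by
    intro t
    have h1 : Measurable fun u : Regressor dI dC => M.m (x + h t • u) :=
      M.measurable_m.comp (by fun_prop)
    exact ((h1.sub_const _).sub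
      ((fderiv ℝ M.m x).continuous.measurable.const_mul _)).div_const _
  exact tendstoInProb_localAverage hD hh hrate hN hx hs
    (ψ := fun t u => weightedKernel k a u * taylorRemainder M.m x (h t) u)
    (hCρ.mono fun t ht => (isBump_weightedKernel hKb a).mul_of_bound (hρm t) ht)
    (fun u => (tendsto_taylorRemainder hm2 hh.pos hh.tendsto_zero u).const_mul _)

/-- The limiting inverse annihilates all components but the intercept, where 1/f(x) cancels the
design density and leaves the bias constant. -/
lemma tendstoInProb_sum_inv_mul_localBias (hD : ∀ t, ClusterDGP (P t) (S t) M)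
    (hh : BandwidthCondition S h)
    (hrate : Tendsto (fun t => pairRate (S t) (h t)) atTop (𝓝 lam)) (hN : IsOpen N) (hx : x ∈ N)
    (hs : SmoothnessCondition M x N) (hk : IsUnivariateKernel k)
    (hKb : IsBump R C (productKernel k : Regressor dI dC → ℝ)) :
    TendstoInProb P (fun t ω => ∑ a, (Matrix.of (localGram (S t) k (h t) x ω))⁻¹ (Sum.inl ()) a *
      localBias S M k h x a t ω - llBias k M.m x) 0 := by
  have hm2 : ContDiffAt ℝ 2 M.m x := hs.contDiff_m.contDiffAt (hN.mem_nhds hx)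
  have hA := tendstoInProb_localGram hD hh hrate hN hx hs hk hKb
  have h1 := (TendstoInProb.sum fun a =>
    (tendstoInProb_inv_localGram hk hs.density_pos hA a).mul
      (tendstoInProb_localBias hD hh hrate hN hx hs hKb a)).sub
    (tendstoInProb_const (llBias k M.m x))
  have h2 : ∑ a, (if a = Sum.inl () then (M.f x)⁻¹ else 0) * (M.f x * ∫ u, weightedKernel k a u *
      (fderiv ℝ (fderiv ℝ M.m) x u u / 2)) - llBias k M.m x = 0 := by
    simp only [ite_mul, zero_mul, Finset.sum_ite_eq', Finset.mem_univ, if_true]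
    rw [inv_mul_cancel_left₀ hs.density_pos.ne', weightedKernel_inl,
      integral_productKernel_mul_bilin hk hKb, llBias]
    simp only [partialDeriv_partialDeriv_eq hm2, sub_self]
  rwa [h2] at h1

omit [∀ t, MeasurableSpace (Ω t)] in
lemma sqrt_mul_localLinear_sub_eq {t : ℕ} (ht : 0 < h t) (hn : 0 < (S t).n) (ω : Ω t)
    (hdet : (Matrix.of (localGram (S t) k (h t) x ω)).det ≠ 0) (B : ℝ) :
    √(((S t).n : ℝ) * h t ^ (dI + dC)) * (localLinear (S t) k (h t) x ω - M.m x - h t ^ 2 * B)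
      = √(((S t).n : ℝ) * h t ^ (dI + dC)) * h t ^ 2 *
        (∑ a, (Matrix.of (localGram (S t) k (h t) x ω))⁻¹ (Sum.inl ()) a *
          localBias S M k h x a t ω - B)
      + ∑ a, (Matrix.of (localGram (S t) k (h t) x ω))⁻¹ (Sum.inl ()) a *
          localError S M h x (weightedKernel k a) t ω := by
  have hn' : (0 : ℝ) < (S t).n := Nat.cast_pos.2 hn
  have hs : √(((S t).n : ℝ) * h t ^ (dI + dC)) * (((S t).n : ℝ) * h t ^ (dI + dC))⁻¹
      = (√(((S t).n : ℝ) * h t ^ (dI + dC)))⁻¹ := by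
    rw [← div_eq_mul_inv, Real.sqrt_div_self', one_div]
  have hTa : ∀ a, localError S M h x (weightedKernel k a) t ω
      = √(((S t).n : ℝ) * h t ^ (dI + dC)) *
        ((((S t).n : ℝ) * h t ^ (dI + dC))⁻¹ * ∑ g, ∑ j,
        productKernel k ((S t).scaledX x (h t) g j ω) *
          affineVec ((S t).scaledX x (h t) g j ω) a * (S t).err M g j ω) := by
    intro a
    rw [← mul_assoc, hs, localError, ← Finset.mul_sum]
    rfl
  rw [localLinear_sub_eq k x ω M ht hn hdet]
  simp only [hTa, mul_add, Finset.sum_add_distrib, localBias, weightedKernel]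
  have e1 : ∀ (q e : Unit ⊕ (Fin dI ⊕ Fin dC) → ℝ) (c : ℝ),
      ∑ a, q a * (c * e a) = c * ∑ a, q a * e a := by
    intro q e c
    rw [Finset.mul_sum]
    exact Finset.sum_congr rfl fun a _ => by ring
  rw [e1 _ _ (h t ^ 2), e1 _ _ (√(((S t).n : ℝ) * h t ^ (dI + dC)))]
  ring

omit [∀ t, IsProbabilityMeasure (P t)] in
lemma NormalityCondition.boundedInProb_sqrt_mul_sq (hh : BandwidthCondition S h)
    (hnormal : NormalityCondition S M k h x lam) :
    BoundedInProb P fun t _ => √(((S t).n : ℝ) * h t ^ (dI + dC)) * h t ^ 2 := by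
  obtain ⟨B, hB⟩ := hnormal.bandwidth_upper.bound
  refine BoundedInProb.of_bounded (K := √|B|) ?_
  filter_upwards [hB] with t ht
  have hpos := hh.pos t
  rw [Real.norm_of_nonneg (by positivity), norm_one, mul_one] at ht
  refine Real.abs_le_sqrt ?_
  rw [mul_pow, Real.sq_sqrt (by positivity)]
  refine le_trans (le_of_eq ?_) (ht.trans (le_abs_self B))
  ring

/-- The difference is a bounded factor times the vanishing bias bracket, plus products of error sums
bounded in probability with entries of A⁻¹ minus their limits. The decomposition fails only where
det A = 0, an event of vanishing probability. -/
lemma tendstoInProb_localLinear_sub_localError (hdI : 1 ≤ dI)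
    (hD : ∀ t, ClusterDGP (P t) (S t) M) (hh : BandwidthCondition S h)
    (hrate : Tendsto (fun t => pairRate (S t) (h t)) atTop (𝓝 lam)) (hN : IsOpen N) (hx : x ∈ N)
    (hs : SmoothnessCondition M x N) (hk : IsUnivariateKernel k)
    (hKb : IsBump R C (productKernel k : Regressor dI dC → ℝ)) (hm : MomentCondition P S M h N r)
    (hnormal : NormalityCondition S M k h x lam) :
    TendstoInProb P (fun t ω => √(((S t).n : ℝ) * h t ^ (dI + dC)) *
        (localLinear (S t) k (h t) x ω - M.m x - h t ^ 2 * llBias k M.m x)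
        - (M.f x)⁻¹ * localError S M h x (productKernel k) t ω) 0 := by
  have hA := tendstoInProb_localGram hD hh hrate hN hx hs hk hKb
  have hT : ∀ a, BoundedInProb P (localError S M h x (weightedKernel k a)) := fun a =>
    (tendsto_charFun_localError hD hdI hh hrate hN hx hs hm (isBump_weightedKernel hKb a)).1
  have hb : ∀ a, TendstoInProb P (fun t ω =>
      (Matrix.of (localGram (S t) k (h t) x ω))⁻¹ (Sum.inl ()) a
        - (if a = Sum.inl () then (M.f x)⁻¹ else 0)) 0 := by
    intro a
    have := (tendstoInProb_inv_localGram hk hs.density_pos hA a).sub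
      (tendstoInProb_const (if a = Sum.inl () then (M.f x)⁻¹ else 0))
    rwa [sub_self] at this
  have hdiff := ((hnormal.boundedInProb_sqrt_mul_sq hh).mul_tendsto_zero
    (tendstoInProb_sum_inv_mul_localBias hD hh hrate hN hx hs hk hKb)).add
    (TendstoInProb.sum fun a => (hT a).mul_tendsto_zero (hb a))
  rw [Finset.sum_const_zero, add_zero] at hdiff
  refine hdiff.congr_prob ?_
  refine tendsto_of_tendsto_of_tendsto_of_le_of_le' tendsto_const_nhds
    (tendsto_measure_det_localGram_eq_zero hk hs.density_pos hA)
    (Eventually.of_forall fun _ => zero_le) ?_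
  filter_upwards [hh.eventually_n_pos] with t hn
  refine measure_mono fun ω hω => ?_
  by_contra hdω
  refine hω ?_
  have hsum : ∑ a, localError S M h x (weightedKernel k a) t ω *
      ((Matrix.of (localGram (S t) k (h t) x ω))⁻¹ (Sum.inl ()) a
        - if a = Sum.inl () then (M.f x)⁻¹ else 0)
      = ∑ a, (Matrix.of (localGram (S t) k (h t) x ω))⁻¹ (Sum.inl ()) a *
          localError S M h x (weightedKernel k a) t ω
        - (M.f x)⁻¹ * localError S M h x (productKernel k) t ω := by
    simp only [mul_sub, Finset.sum_sub_distrib, mul_ite, mul_zero, Finset.sum_ite_eq',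
      Finset.mem_univ, if_true, weightedKernel_inl]
    rw [mul_comm (M.f x)⁻¹]
    congr 1
    exact Finset.sum_congr rfl fun a _ => mul_comm _ _
  rw [hsum, sqrt_mul_localLinear_sub_eq (M := M) (hh.pos t) hn ω hdω]
  ring

lemma localErrorVariance_div_sq_eq (hk : IsUnivariateKernel k) (hf : 0 < M.f x) :
    localErrorVariance M x (productKernel k) lam / M.f x ^ 2 = asymptoticVariance k M x lam := by
  have h2 : ∫ u : Regressor dI dC, productKernel k u * productKernel k u
      = kernelRoughness k ^ (dI + dC) := by
    simp only [← sq, integral_productKernel_sq]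
  rw [localErrorVariance, asymptoticVariance, h2, integral_pairProduct_productKernel hk]
  field_simp

-- Ensures that `toNNReal` in the Gaussian variance discards nothing.
omit [∀ t, MeasurableSpace (Ω t)] in
lemma NormalityCondition.asymptoticVariance_nonneg (hf : 0 < M.f x)
    (hnormal : NormalityCondition S M k h x lam) : 0 ≤ asymptoticVariance k M x lam := by
  have h1 := hnormal.variance_pos
  have h2 : asymptoticVariance k M x lam = (kernelRoughness k ^ (dI + dC) * M.f x * M.condVar x +
    lam * kernelRoughness k ^ dC * M.fJoint 2 (diagPoint x) * M.condCov (diagPoint x))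
      / M.f x ^ 2 := by
    rw [asymptoticVariance]
    field_simp
  rw [h2]
  positivity

end LocalLinearLimit

/-! ### Asymptotic normality -/

theorem mainTheorem2 {dI dC : ℕ} (hdI : 1 ≤ dI)
    {Ω : ℕ → Type*} [∀ t, MeasurableSpace (Ω t)]
    (P : ∀ t, Measure (Ω t)) [∀ t, IsProbabilityMeasure (P t)]
    (S : ∀ t, ClusterSample dI dC (Ω t)) (M : RegressionModel dI dC)
    (k : ℝ → ℝ) (h : ℕ → ℝ) (x : Regressor dI dC) (N : Set (Regressor dI dC)) (lam : ℝ)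
    (hN : IsOpen N) (hxN : x ∈ N)
    (hk : IsUnivariateKernel k)
    (hK : HasCompactSupport (productKernel k : Regressor dI dC → ℝ))
    (hdgp : ∀ t, ClusterDGP (P t) (S t) M)
    (hh : BandwidthCondition S h)
    (hsmooth : SmoothnessCondition M x N)
    (hlam : ClusterSizeLimit S h lam)
    (hmoment : ∃ r : ℝ, MomentCondition P S M h N r)
    (hnormal : NormalityCondition S M k h x lam) :
    TendstoInDistribution
      (fun t ω => Real.sqrt (((S t).n : ℝ) * h t ^ (dI + dC)) *
        (localLinear (S t) k (h t) x ω - M.m x - h t ^ 2 * llBias k M.m x))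
      atTop (id : ℝ → ℝ) P (gaussianReal 0 (asymptoticVariance k M x lam).toNNReal) := by
  obtain ⟨r, hm⟩ := hmoment
  obtain ⟨R, C, hKb⟩ := exists_isBump_productKernel (dI := dI) (dC := dC) hk hK
  have hrate := hh.tendsto_pairRate hdI hlam
  have hWm : ∀ t, Measurable fun ω => √(((S t).n : ℝ) * h t ^ (dI + dC)) *
        (localLinear (S t) k (h t) x ω - M.m x - h t ^ 2 * llBias k M.m x) := fun t =>
    ((((hdgp t).measurable_localLinear hk (h t)).sub_const _).sub_const _).const_mul _
  have hUm := ClusterDGP.measurable_localError (x := x) (h := h) hdgp hKb.measurable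
  refine ⟨fun t => (hWm t).aemeasurable, aemeasurable_id, ?_⟩
  -- Lévy's continuity theorem reduces the claim to characteristic functions at a fixed s.
  refine ProbabilityMeasure.tendsto_iff_tendsto_charFun.2 fun s => ?_
  simp only [ProbabilityMeasure.coe_mk]
  have hlim : charFun ((gaussianReal 0 (asymptoticVariance k M x lam).toNNReal).map id) s
      = ((Real.exp (-(((M.f x)⁻¹ * s) ^ 2 * localErrorVariance M x (productKernel k) lam / 2)) : ℝ)
        : ℂ) := by
    rw [Measure.map_id, charFun_gaussianReal, Complex.ofReal_exp]
    congr 1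
    rw [Real.coe_toNNReal _ (hnormal.asymptoticVariance_nonneg hsmooth.density_pos),
      ← localErrorVariance_div_sq_eq hk hsmooth.density_pos]
    push_cast
    ring
  rw [hlim]
  refine tendsto_charFun_of_tendstoInProb_sub (fun t => ((hUm t).const_mul _).aemeasurable)
    (fun t => (hWm t).aemeasurable) (tendstoInProb_localLinear_sub_localError hdI hdgp hh hrate hN
      hxN hsmooth hk hKb hm hnormal) ?_
  -- The factor 1/f(x) moves into the argument, so the central limit theorem for the errors is used
  -- at s/f(x).
  simp_rw [fun t => charFun_map_mul_comp (hUm t).aemeasurable (μ := P t) (M.f x)⁻¹ s]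
  exact (tendsto_charFun_localError hdgp hdI hh hrate hN hxN hsmooth hm hKb).2 _
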